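/- Let $d>3$ be an integer and let $0<C_1\le C_2$. Let $\{w_{x,y}\}$, indexed by the unordered pairs of distinct points $x\neq y$ of $\mathbb Z^d$ (so $w_{x,y}=w_{y,x}$), be independent random variables on a probability space $(\Omega,\mathcal A,\mathbb P)$ with $\mathbb E[w_{x,y}]=1$ and $C_1\le w_{x,y}(\omega)\le C_2$ for all $\omega\in\Omega$ and $x\ne y$ (not necessarily identically distributed). Let $|\cdot|$ be the Euclidean norm. For an integer $k\ge 2$ and $u\in L^2(k^{-1}\mathbb Z^d)$ (square summable functions) put $$\mathcal L^{(k),\omega}u(x)=(\log k)^{-1}k^{-d}\sum_{y\in k^{-1}\mathbb Z^d,\ y\ne x}(u(y)-u(x))\frac{w_{kx,ky}(\omega)}{|x-y|^{d+2}},\qquad x\in k^{-1}\mathbb Z^d.$$ The limit $$a_0:=\lim_{k\to\infty}\frac1{2d\log k}\sum_{z\in\mathbb Z^d,\ 0<|z|\le k}|z|^{-d}$$ exists and is positive; put $\bar{\mathcal L}=a_0\Delta$. For $\lambda>0$ let $\mathscr S_0^\lambda=\{(\lambda-\bar{\mathcal L})g:\ g\in C_c^\infty(\mathbb R^d)\}$.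 For $f\in\mathscr S_0^\lambda$, let $\bar R_\lambda f$ be the resolvent of $\bar{\mathcal L}$ on $L^2(\mathbb R^d)$, that is, the unique $v\in H^1(\mathbb R^d)$ with $\lambda\int v\varphi\,dx+a_0\int\nabla v\cdot\nabla\varphi\,dx=\int f\varphi\,dx$ for all $\varphi\in H^1(\mathbb R^d)$. Let $R^{(k),\omega}_\lambda f$ be the unique $u\in L^2(k^{-1}\mathbb Z^d)$ with $(\lambda-\mathcal L^{(k),\omega})u=f$ on $k^{-1}\mathbb Z^d$, extended to $\mathbb R^d$ by the value $u(z)$ on each cell $\prod_{i=1}^d(z_i,z_i+k^{-1}]$, $z\in k^{-1}\mathbb Z^d$. These resolvents exist and are unique. Then for every $\lambda>0$ and $\gamma>0$ there are a constant $C_0=C_0(f)>0$ for each $f\in\mathscr S_0^\lambda$, depending only on $f,\gamma,\lambda$ (and on $d,C_1,C_2$), and an integer-valued random variable $k_0=k_0(\omega)\ge2$, depending on $\gamma$ and $\lambda$ but not on $f$, such that for $\mathbb P$-almost every $\omega$, for all $f\in\mathscr S_0^\lambda$ and all integers $k\ge k_0(\omega)$, $$\big\|R^{(k),\omega}_\lambda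 f-\bar R_\lambda f\big\|_{L^2(\mathbb R^d;dx)}\le C_0(f)\,(\log k)^{-\frac12+\frac{1+\gamma}{2(d-2)}}.$$ -/

import Mathlib

open MeasureTheory ProbabilityTheory Filter Topology
open scoped ENNReal InnerProductSpace

noncomputable section

namespace CriticalWalk

/-- The integer lattice. -/
abbrev Lattice (d : ℕ) : Type := Fin d → ℤ

/-- Euclidean space, with the Euclidean norm. -/
abbrev Space (d : ℕ) : Type := EuclideanSpace ℝ (Fin d)

/-- The point `z / k` of the scaled lattice. Throughout, a function on the scaled lattice is
identified with the function `z ↦ u (z / k)` on the integer lattice. -/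
def point {d : ℕ} (k : ℕ) (z : Lattice d) : Space d :=
  WithLp.toLp 2 fun i => (z i : ℝ) / (k : ℝ)

/-- Random conductances on the unordered pairs of distinct lattice points: independent random
variables with mean one and values in `[C₁, C₂]`. Symmetry is built in by indexing with
unordered pairs; the values on the diagonal of `Sym2` are irrelevant. -/
structure IsConductance {d : ℕ} {Ω : Type*} [MeasurableSpace Ω] (P : Measure Ω) (C₁ C₂ : ℝ)
    (w : Sym2 (Lattice d) → Ω → ℝ) : Prop where
  measurable : ∀ e : Sym2 (Lattice d), ¬ e.IsDiag → Measurable (w e)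
  indep : iIndepFun (fun e : {e : Sym2 (Lattice d) // ¬ e.IsDiag} => w e.1) P
  mean_one : ∀ e : Sym2 (Lattice d), ¬ e.IsDiag → ∫ ω, w e ω ∂P = 1
  bounds : ∀ e : Sym2 (Lattice d), ¬ e.IsDiag → ∀ ω, C₁ ≤ w e ω ∧ w e ω ≤ C₂

/-- The scaled generator at the point `x / k`, in the fixed environment `w`:
`(log k)⁻¹ k⁻ᵈ ∑_{y ≠ x} (u(y/k) - u(x/k)) w_{x,y} / |y/k - x/k| ^ (d + 2)`.
The term `y = x` of the sum is zero. -/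
def scaledGenerator {d : ℕ} (w : Sym2 (Lattice d) → ℝ) (k : ℕ) (u : Lattice d → ℝ)
    (x : Lattice d) : ℝ :=
  (Real.log k)⁻¹ * ((k : ℝ) ^ d)⁻¹ *
    ∑' y : Lattice d, (u y - u x) * (w s(x, y) / ‖point k y - point k x‖ ^ (d + 2))

/-- `u` is the resolvent at `lam` of the scaled generator, applied to the restriction of `f` to
the scaled lattice: a square summable solution of `(lam - L) u = f`. -/
def IsScaledResolvent {d : ℕ} (w : Sym2 (Lattice d) → ℝ) (k : ℕ) (lam : ℝ) (f : Space d → ℝ)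
    (u : Lattice d → ℝ) : Prop :=
  Memℓp u 2 ∧ ∀ x, lam * u x - scaledGenerator w k u x = f (point k x)

/-- The piecewise constant extension to the whole space: the value at `x` is the value at the
lattice point `z / k` with `x` in the product of the intervals `(z i / k, z i / k + 1 / k]`. -/
def extendCells {d : ℕ} (k : ℕ) (u : Lattice d → ℝ) (x : Space d) : ℝ :=
  u fun i => ⌈(k : ℝ) * x i⌉ - 1

/-- `u` is in the Sobolev space `H¹` with weak gradient `G`. -/
def IsSobolev {d : ℕ} (u : Space d → ℝ) (G : Space d → Space d) : Prop :=
  MemLp u 2 volume ∧ MemLp G 2 volume ∧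
    ∀ φ : Space d → ℝ, ContDiff ℝ (⊤ : ℕ∞) φ → HasCompactSupport φ → ∀ i : Fin d,
      ∫ x, u x * fderiv ℝ φ x (EuclideanSpace.single i 1) = - ∫ x, G x i * φ x

/-- `v` is the resolvent at `lam` of `a Δ` on `L²`, applied to `f`: the weak solution in `H¹` of
`(lam - a Δ) v = f`. -/
def IsLimitResolvent {d : ℕ} (a lam : ℝ) (f v : Space d → ℝ) : Prop :=
  ∃ G : Space d → Space d, IsSobolev v G ∧
    ∀ (φ : Space d → ℝ) (H : Space d → Space d), IsSobolev φ H →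
      lam * (∫ x, v x * φ x) + a * (∫ x, ⟪G x, H x⟫_ℝ) = ∫ x, f x * φ x

/-- The functions `(lam - a Δ) g` with `g` smooth and compactly supported. -/
def testData (d : ℕ) (a lam : ℝ) : Set (Space d → ℝ) :=
  {f | ∃ g : Space d → ℝ, ContDiff ℝ (⊤ : ℕ∞) g ∧ HasCompactSupport g ∧
    f = fun x => lam * g x - a * Laplacian.laplacian g x}

/-- The quantity `(2 d log k)⁻¹ ∑_{0 < |z| ≤ k} |z|⁻ᵈ`, whose limit is the effective
coefficient. -/
def coefficientApprox (d k : ℕ) : ℝ :=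
  1 / (2 * d * Real.log k) *
    ∑' z : {z : Lattice d // 0 < ‖point 1 z‖ ∧ ‖point 1 z‖ ≤ k}, (‖point 1 z.1‖ ^ d)⁻¹

end CriticalWalk

end

/-! Every `f` in the class is `(lam - a₀ Δ) g` with `g` smooth and compactly supported, so the limit
resolvent is `g` itself, and only `h = u - g` on the scaled lattice has to be estimated. Testing the
equation of `h` with `h`, and using that the rates are at least `C₁ |z|^(-d-2)`, gives
(`IsScaledResolvent.energy_le`) a bound on `lam ‖h‖² + (C₁ / 2) Y²` by the pairing of `(L - a₀ Δ) g`
with `h`, where `L` is the scaled generator and `Y²` the scaled Dirichlet energy of `h`. It suffices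
to bound this pairing by `e (‖h‖ + Y)`: then `‖h‖` is at most a multiple of `e`.

With `2^n ≤ k < 2^(n+1)`, the rates split into four pieces. Mean rates, jumps up to `2^n`
(`exists_consistency`): in the Taylor expansion of `g` the first moments vanish by symmetry, the
second moments are a multiple of the identity, and the sum of `|z|^(-d)` over `0 < |z| ≤ R` is `2 d
a₀ log R + O(1)`. The error is `O(1 / log k)`. Comparison with an integral identifies `a₀` as half
the volume of the unit ball. Jumps beyond `2^n` (`exists_far_le`): their total rate is `O(k^(-2))`,
so after scaling they contribute `O(1 / log k)`. Fluctuations `w - 1` at jumps up to `cut n =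
(n+1)^3` (`exists_near_le`): no cancellation is used. Symmetrisation and Cauchy-Schwarz bound them
by `√(log (cut n) / log k) Y`, and `log (cut n)` is of order `log log k`. Fluctuations at jumps
between `cut n` and `2^n` (`exists_mid_le`): after a Taylor expansion the dangerous term pairs the
random drift `V = ∑ (w - 1) |z|^(-d-2) z` with `φ = ∂g h`. Averages of `V` over cubes of side `2^j`
have variance of order `2^(-jd)`, because an edge occurs at most twice in them, while `φ` differs
from its own cube averages by `2^j` times its discrete gradient, which the energy and `‖h‖` control.
A telescoping decomposition over scales (`abs_tsum_mul_le_multiscale`) pairs the two, and the gain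
and the loss balance at each of the `n` scales. The cutoff makes the variance so small, of order
`(n+1)^(-6)`, that the `n` scales are paid for.

The probabilistic input (`IsConductance.exists_isGoodScale`) is a weighted sum of expectations over
all scales and all boxes. Its finiteness yields one random threshold that serves every `g`, whatever
its support. The outcome is the rate `√(log log k / log k)`, which is stronger than `(log k)^(-1/2 +
δ/2)` for every `δ > 0`, in particular for `δ = (1 + γ) / (d - 2)`. -/

noncomputable section

namespace CriticalWalk

variable {d : ℕ}

/-! ### Lattice norms, shells and cells. -/

section Lattice

/-- The Euclidean norm of a lattice point. -/
def nrm (z : Lattice d) : ℝ := ‖point 1 z‖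

lemma point_eq_smul (k : ℕ) (z : Lattice d) : point k z = (k : ℝ)⁻¹ • point 1 z := by
  ext i
  simp [point, div_eq_inv_mul]

lemma point_add (k : ℕ) (y z : Lattice d) : point k (y + z) = point k y + point k z := by
  ext i
  simp [point, add_div]

lemma point_neg (k : ℕ) (z : Lattice d) : point k (-z) = -point k z := by
  ext i
  simp [point, neg_div]

lemma point_sub (k : ℕ) (y z : Lattice d) : point k (y - z) = point k y - point k z := by
  ext i
  simp [point, sub_div]

lemma norm_point (k : ℕ) (z : Lattice d) : ‖point k z‖ = nrm z / k := by
  rw [point_eq_smul, norm_smul, nrm, norm_inv, Real.norm_natCast, div_eq_inv_mul]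

lemma nrm_nonneg (z : Lattice d) : 0 ≤ nrm z := norm_nonneg _

@[simp] lemma nrm_neg (z : Lattice d) : nrm (-z) = nrm z := by
  rw [nrm, point_neg, norm_neg, nrm]

@[simp] lemma nrm_zero : nrm (0 : Lattice d) = 0 := by
  have : point 1 (0 : Lattice d) = 0 := by ext i; simp [point]
  rw [nrm, this, norm_zero]

lemma nrm_sq (z : Lattice d) : nrm z ^ 2 = ∑ i, (z i : ℝ) ^ 2 := by
  rw [nrm, EuclideanSpace.norm_sq_eq]
  simp [point]

lemma abs_le_nrm (z : Lattice d) (i : Fin d) : |(z i : ℝ)| ≤ nrm z := by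
  apply abs_le_of_sq_le_sq _ (nrm_nonneg z)
  rw [nrm_sq]
  exact Finset.single_le_sum (f := fun i => (z i : ℝ) ^ 2) (fun _ _ => sq_nonneg _)
    (Finset.mem_univ i)

lemma one_le_nrm {z : Lattice d} (hz : z ≠ 0) : 1 ≤ nrm z := by
  obtain ⟨i, hi⟩ := Function.ne_iff.1 hz
  refine le_trans ?_ (abs_le_nrm z i)
  exact_mod_cast Int.one_le_abs hi

lemma nrm_pos_iff {z : Lattice d} : 0 < nrm z ↔ z ≠ 0 := by
  refine ⟨?_, fun h => lt_of_lt_of_le one_pos (one_le_nrm h)⟩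
  rintro h rfl
  simp at h

/-- The jump kernel `|z| ^ (-d - 2)`, with value zero at the origin. -/
def kap (z : Lattice d) : ℝ := (nrm z ^ (d + 2))⁻¹

lemma kap_nonneg (z : Lattice d) : 0 ≤ kap z := inv_nonneg.2 (pow_nonneg (nrm_nonneg z) _)

@[simp] lemma kap_neg (z : Lattice d) : kap (-z) = kap z := by simp [kap]

@[simp] lemma kap_zero : kap (0 : Lattice d) = 0 := by simp [kap]

/-- The lattice points in the cube of side `2 * M` around the origin. -/
def box (d M : ℕ) : Finset (Lattice d) := Finset.Icc (fun _ => -(M : ℤ)) (fun _ => (M : ℤ))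

lemma mem_box {M : ℕ} {z : Lattice d} : z ∈ box d M ↔ ∀ i, |z i| ≤ (M : ℤ) := by
  simp [box, Pi.le_def, abs_le, forall_and]

lemma card_box (M : ℕ) : (box d M).card = (2 * M + 1) ^ d := by
  rw [box, Pi.card_Icc]
  simp only [Int.card_Icc, Finset.prod_const, Finset.card_univ, Fintype.card_fin]
  congr 1
  omega

open Classical in
/-- The lattice points with `r < |z| ≤ R`. -/
def shell (d r R : ℕ) : Finset (Lattice d) :=
  (box d R).filter fun z => (r : ℝ) < nrm z ∧ nrm z ≤ R

lemma mem_shell {r R : ℕ} {z : Lattice d} : z ∈ shell d r R ↔ (r : ℝ) < nrm z ∧ nrm z ≤ R := by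
  classical
  rw [shell, Finset.mem_filter, and_iff_right_iff_imp]
  rintro ⟨-, h⟩
  rw [mem_box]
  intro i
  have := (abs_le_nrm z i).trans h
  exact_mod_cast this

lemma ne_zero_of_mem_shell {r R : ℕ} {z : Lattice d} (h : z ∈ shell d r R) : z ≠ 0 := by
  rw [← nrm_pos_iff]
  exact lt_of_le_of_lt (Nat.cast_nonneg r) (mem_shell.1 h).1

lemma neg_mem_shell {r R : ℕ} {z : Lattice d} : -z ∈ shell d r R ↔ z ∈ shell d r R := by
  simp [mem_shell]

lemma shell_subset_box (r R : ℕ) : shell d r R ⊆ box d R := by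
  classical
  exact Finset.filter_subset _ _

/-- The lower corner, in lattice units, of the cell of side `1 / k` that contains a point. -/
def cellIndex (k : ℕ) (x : Space d) : Lattice d := fun i => ⌈(k : ℝ) * x i⌉ - 1

lemma extendCells_eq (k : ℕ) (u : Lattice d → ℝ) (x : Space d) :
    extendCells k u x = u (cellIndex k x) := rfl

lemma measurable_cellIndex (k : ℕ) : Measurable (cellIndex (d := d) k) := by
  refine measurable_pi_lambda _ fun i => ?_
  have h1 : Measurable fun x : Space d => (k : ℝ) * x i :=
    ((measurable_pi_apply i).comp (PiLp.continuous_ofLp 2 _).measurable).const_mul _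
  exact (Int.measurable_ceil.comp h1).sub_const 1

lemma mem_cell_iff {k : ℕ} (hk : 0 < k) (x : Space d) (z : Lattice d) :
    cellIndex k x = z ↔ ∀ i, x i ∈ Set.Ioc ((z i : ℝ) / k) ((z i + 1 : ℝ) / k) := by
  have hk' : (0 : ℝ) < k := by exact_mod_cast hk
  rw [funext_iff]
  refine forall_congr' fun i => ?_
  rw [cellIndex, sub_eq_iff_eq_add, Int.ceil_eq_iff, Set.mem_Ioc, div_lt_iff₀ hk', le_div_iff₀ hk']
  push_cast
  simp [mul_comm]

lemma volume_cell {k : ℕ} (hk : 0 < k) (z : Lattice d) :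
    volume (cellIndex k ⁻¹' {z}) = ENNReal.ofReal (((k : ℝ) ^ d)⁻¹) := by
  have hk' : (0 : ℝ) < k := by exact_mod_cast hk
  have h : cellIndex k ⁻¹' {z} = (@WithLp.ofLp 2 (Fin d → ℝ)) ⁻¹'
      Set.pi Set.univ fun i => Set.Ioc ((z i : ℝ) / k) ((z i + 1 : ℝ) / k) := by
    ext x
    simp only [Set.mem_preimage, Set.mem_singleton_iff, Set.mem_univ_pi]
    exact mem_cell_iff hk x z
  rw [h, (PiLp.volume_preserving_ofLp (Fin d)).measure_preimage
    (MeasurableSet.univ_pi fun _ => measurableSet_Ioc).nullMeasurableSet, Real.volume_pi_Ioc]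
  simp only [← sub_div, add_sub_cancel_left, Finset.prod_const, Finset.card_univ, Fintype.card_fin]
  rw [← ENNReal.ofReal_pow (by positivity)]
  simp

lemma lintegral_cells {k : ℕ} (hk : 0 < k) (F : Lattice d → ℝ≥0∞) :
    ∫⁻ x, F (cellIndex k x) = ENNReal.ofReal (((k : ℝ) ^ d)⁻¹) * ∑' z, F z := by
  rw [← lintegral_map (f := F) (by fun_prop) (measurable_cellIndex k), lintegral_countable',
    ← ENNReal.tsum_mul_left]
  refine tsum_congr fun z => ?_
  rw [Measure.map_apply (measurable_cellIndex k) (measurableSet_singleton z), volume_cell hk,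
    mul_comm]

lemma norm_sub_point_cellIndex_le {k : ℕ} (hk : 0 < k) (x : Space d) :
    ‖x - point k (cellIndex k x)‖ ≤ √d / k := by
  have hk' : (0 : ℝ) < k := by exact_mod_cast hk
  rw [← abs_of_nonneg (norm_nonneg _), ← abs_of_nonneg (show 0 ≤ √d / k by positivity),
    ← sq_le_sq, EuclideanSpace.norm_sq_eq, div_pow, Real.sq_sqrt (by positivity)]
  have h := (mem_cell_iff hk x _).1 rfl
  calc _ ≤ ∑ i : Fin d, (1 / (k : ℝ)) ^ 2 := by
        refine Finset.sum_le_sum fun i _ => ?_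
        have h1 := (h i).1
        have h2 := (h i).2
        simp only [PiLp.sub_apply, Real.norm_eq_abs]
        apply pow_le_pow_left₀ (abs_nonneg _)
        rw [add_div] at h2
        simp only [point]
        rw [abs_le]
        have : 0 ≤ 1 / (k : ℝ) := by positivity
        constructor <;> linarith
    _ = _ := by
        simp
        ring

end Lattice

/-! ### The limit coefficient, by comparing lattice sums with integrals. -/

section Coefficient

lemma integrable_indicator_cell {k : ℕ} (hk : 0 < k) (z : Lattice d) (c : ℝ) :
    Integrable ((cellIndex k ⁻¹' {z}).indicator fun _ : Space d => c) := by
  refine (integrable_indicator_iff (measurable_cellIndex k (measurableSet_singleton z))).2 ?_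
  refine integrableOn_const ?_
  rw [volume_cell hk]
  exact ENNReal.ofReal_ne_top

open Classical in
lemma ite_cellIndex_eq_sum (k : ℕ) (s : Finset (Lattice d)) (F : Lattice d → ℝ) (x : Space d) :
    (if cellIndex k x ∈ s then F (cellIndex k x) else 0) =
      ∑ z ∈ s, (cellIndex k ⁻¹' {z}).indicator (fun _ : Space d => F z) x := by
  simp only [Set.indicator_apply, Set.mem_preimage, Set.mem_singleton_iff]
  rw [Finset.sum_ite_eq]

open Classical in
lemma integrable_cells {k : ℕ} (hk : 0 < k) (s : Finset (Lattice d)) (F : Lattice d → ℝ) :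
    Integrable fun x : Space d => if cellIndex k x ∈ s then F (cellIndex k x) else 0 := by
  simp only [ite_cellIndex_eq_sum]
  exact integrable_finsetSum _ fun z _ => integrable_indicator_cell hk z _

open Classical in
lemma integral_cells {k : ℕ} (hk : 0 < k) (s : Finset (Lattice d)) (F : Lattice d → ℝ) :
    ∫ x : Space d, (if cellIndex k x ∈ s then F (cellIndex k x) else 0) =
      ((k : ℝ) ^ d)⁻¹ * ∑ z ∈ s, F z := by
  simp only [ite_cellIndex_eq_sum]
  rw [integral_finsetSum _ fun z _ => integrable_indicator_cell hk z _, Finset.mul_sum]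
  refine Finset.sum_congr rfl fun z _ => ?_
  rw [integral_indicator (measurable_cellIndex k (measurableSet_singleton z)), setIntegral_const,
    measureReal_def, volume_cell hk, ENNReal.toReal_ofReal (by positivity), smul_eq_mul]

/-- The volume of the Euclidean unit ball. -/
def unitBallVolume (d : ℕ) : ℝ := (volume : Measure (Space d)).real (Metric.ball 0 1)

lemma unitBallVolume_pos (d : ℕ) : 0 < unitBallVolume d := by
  rw [unitBallVolume, measureReal_def]
  exact ENNReal.toReal_pos (Metric.measure_ball_pos _ _ one_pos).ne' measure_ball_lt_top.ne

lemma finrank_space (d : ℕ) : Module.finrank ℝ (Space d) = d := by simp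

lemma radial_aux (hd : 0 < d) {r : ℝ} (hr : 0 < r) : r ^ (d - 1) * (r ^ d)⁻¹ = r⁻¹ := by
  obtain ⟨m, rfl⟩ : ∃ m, d = m + 1 := ⟨d - 1, by omega⟩
  rw [Nat.add_sub_cancel, pow_succ]
  field_simp

lemma radial_aux' (hd : 0 < d) {r : ℝ} (hr : 0 < r) : r ^ (d - 1) * (r ^ (d + 1))⁻¹ = r ^ (-2 : ℝ) := by
  obtain ⟨m, rfl⟩ : ∃ m, d = m + 1 := ⟨d - 1, by omega⟩
  rw [Nat.add_sub_cancel, Real.rpow_neg hr.le]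
  norm_cast
  field_simp
  ring

open Classical in
lemma integral_annulus (hd : 0 < d) {R : ℝ} (hR : 1 ≤ R) :
    (Integrable fun y : Space d => if 1 < ‖y‖ ∧ ‖y‖ ≤ R then (‖y‖ ^ d)⁻¹ else 0) ∧
    ∫ y : Space d, (if 1 < ‖y‖ ∧ ‖y‖ ≤ R then (‖y‖ ^ d)⁻¹ else 0) =
      d * unitBallVolume d * Real.log R := by
  have : Nonempty (Fin d) := ⟨⟨0, hd⟩⟩
  set f : ℝ → ℝ := fun r => if 1 < r ∧ r ≤ R then (r ^ d)⁻¹ else 0 with hf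
  have key : ∀ r ∈ Set.Ioi (0 : ℝ), r ^ (Module.finrank ℝ (Space d) - 1) • f r =
      (Set.Ioc 1 R).indicator (fun r => r⁻¹) r := by
    intro r hr
    rw [finrank_space, Set.indicator_apply, hf]
    simp only [Set.mem_Ioc, smul_eq_mul, mul_ite, mul_zero]
    split_ifs
    · exact radial_aux hd hr
    · rfl
  have hint : IntegrableOn (fun r : ℝ => r⁻¹) (Set.Ioc 1 R) := by
    rw [← intervalIntegrable_iff_integrableOn_Ioc_of_le hR]
    refine intervalIntegral.intervalIntegrable_inv (fun x hx => ?_) continuousOn_id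
    rw [Set.uIcc_of_le hR] at hx
    exact (lt_of_lt_of_le one_pos hx.1).ne'
  have hsub : Set.Ioi (0 : ℝ) ∩ Set.Ioc 1 R = Set.Ioc 1 R := by
    rw [Set.inter_eq_right]
    exact fun x hx => lt_trans one_pos hx.1
  constructor
  · refine (integrable_fun_norm_addHaar (volume : Measure (Space d)) (f := f)).2 ?_
    rw [integrableOn_congr_fun key measurableSet_Ioi]
    exact ((integrable_indicator_iff measurableSet_Ioc).2 hint).integrableOn
  · refine (integral_fun_norm_addHaar (volume : Measure (Space d)) f).trans ?_
    rw [setIntegral_congr_fun measurableSet_Ioi key, setIntegral_indicator measurableSet_Ioc, hsub,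
      ← intervalIntegral.integral_of_le hR, integral_inv_of_pos one_pos (by linarith),
      finrank_space, unitBallVolume]
    simp [mul_assoc]

open Classical in
lemma integral_outer (hd : 0 < d) :
    (Integrable fun y : Space d => if 1 < ‖y‖ then (‖y‖ ^ (d + 1))⁻¹ else 0) ∧
    ∫ y : Space d, (if 1 < ‖y‖ then (‖y‖ ^ (d + 1))⁻¹ else 0) = d * unitBallVolume d := by
  have : Nonempty (Fin d) := ⟨⟨0, hd⟩⟩
  set f : ℝ → ℝ := fun r => if 1 < r then (r ^ (d + 1))⁻¹ else 0 with hf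
  have key : ∀ r ∈ Set.Ioi (0 : ℝ), r ^ (Module.finrank ℝ (Space d) - 1) • f r =
      (Set.Ioi 1).indicator (fun r => r ^ (-2 : ℝ)) r := by
    intro r hr
    rw [finrank_space, Set.indicator_apply, hf]
    simp only [Set.mem_Ioi, smul_eq_mul, mul_ite, mul_zero]
    split_ifs
    · exact radial_aux' hd hr
    · rfl
  have hint : IntegrableOn (fun r : ℝ => r ^ (-2 : ℝ)) (Set.Ioi 1) :=
    integrableOn_Ioi_rpow_of_lt (by norm_num) one_pos
  have hsub : Set.Ioi (0 : ℝ) ∩ Set.Ioi 1 = Set.Ioi 1 := by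
    rw [Set.inter_eq_right]
    exact fun x hx => lt_trans one_pos (Set.mem_Ioi.1 hx)
  constructor
  · refine (integrable_fun_norm_addHaar (volume : Measure (Space d)) (f := f)).2 ?_
    rw [integrableOn_congr_fun key measurableSet_Ioi]
    exact ((integrable_indicator_iff measurableSet_Ioi).2 hint).integrableOn
  · refine (integral_fun_norm_addHaar (volume : Measure (Space d)) f).trans ?_
    rw [setIntegral_congr_fun measurableSet_Ioi key, setIntegral_indicator measurableSet_Ioi, hsub,
      integral_Ioi_rpow_of_lt (by norm_num) one_pos, finrank_space, unitBallVolume]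
    norm_num

open Classical in
lemma integral_ball {R : ℝ} (hR : 0 ≤ R) :
    (Integrable fun y : Space d => if ‖y‖ ≤ R then (1 : ℝ) else 0) ∧
    ∫ y : Space d, (if ‖y‖ ≤ R then (1 : ℝ) else 0) = unitBallVolume d * R ^ d := by
  have h : (fun y : Space d => if ‖y‖ ≤ R then (1 : ℝ) else 0) =
      (Metric.closedBall 0 R).indicator 1 := by
    ext y
    simp [Set.indicator_apply]
  rw [h]
  constructor
  · exact (integrable_indicator_iff measurableSet_closedBall).2
      (integrableOn_const measure_closedBall_lt_top.ne)
  · rw [integral_indicator_one measurableSet_closedBall, measureReal_def,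
      Measure.addHaar_closedBall _ _ hR, finrank_space, ENNReal.toReal_mul,
      ENNReal.toReal_ofReal (by positivity), unitBallVolume, measureReal_def, mul_comm]

/-- The two conditions force `ρ` into `[2r/3, 4r/3]`. The factor `2^d` is the ratio of these
endpoints to the power `d`; the rest is the mean value bound for the `d`-th power. -/
lemma inv_pow_sub_inv_pow_le (hd : 0 < d) {r ρ : ℝ} (h : |r - ρ| ≤ d) (hr : 3 * d < r) :
    |(ρ ^ d)⁻¹ - (r ^ d)⁻¹| ≤ d ^ 2 * 2 ^ d * (r ^ (d + 1))⁻¹ := by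
  have hd' : (0 : ℝ) < d := by exact_mod_cast hd
  have hr0 : 0 < r := by linarith
  obtain ⟨h1, h2⟩ := abs_le.1 h
  have hρ1 : 2 / 3 * r ≤ ρ := by linarith
  have hρ2 : ρ ≤ 4 / 3 * r := by linarith
  have hρ0 : 0 < ρ := by linarith
  have e : (ρ ^ d)⁻¹ - (r ^ d)⁻¹ = (r ^ d - ρ ^ d) / (ρ ^ d * r ^ d) := by
    field_simp
  rw [e, abs_div, abs_of_pos (show 0 < ρ ^ d * r ^ d by positivity),
    div_le_iff₀ (by positivity)]
  have h3 := abs_pow_sub_pow_le r ρ d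
  have h4 : max |r| |ρ| ≤ 4 / 3 * r := by
    rw [abs_of_pos hr0, abs_of_pos hρ0]
    exact max_le (by linarith) hρ2
  have h5 : |r ^ d - ρ ^ d| ≤ d * d * (4 / 3 * r) ^ (d - 1) := by
    refine h3.trans ?_
    gcongr
  refine h5.trans ?_
  have h6 : (2 / 3 * r) ^ d ≤ ρ ^ d := by gcongr
  calc (d : ℝ) * d * (4 / 3 * r) ^ (d - 1) = d * d * ((4 / 3 * r) ^ (d - 1) * (4 / 3)) * (3 / 4) := by ring
    _ ≤ d * d * ((4 / 3 * r) ^ (d - 1) * (4 / 3)) * 1 := by gcongr; norm_num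
    _ = d ^ 2 * 2 ^ d * ((2 / 3 * r) ^ d * r⁻¹) := by
        obtain ⟨m, rfl⟩ : ∃ m, d = m + 1 := ⟨d - 1, by omega⟩
        have : (4 / 3 : ℝ) = 2 * (2 / 3) := by norm_num
        rw [Nat.add_sub_cancel, this, mul_assoc 2, mul_pow 2, pow_succ 2, pow_succ (2 / 3 * r)]
        field_simp
    _ ≤ d ^ 2 * 2 ^ d * (ρ ^ d * r⁻¹) := by gcongr
    _ = _ := by
        rw [pow_succ r]
        field_simp

-- The three error terms correspond to the bulk, where a shift by at most `d` changes `|y|^(-d)` by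
-- a multiple of `|y|^(-d-1)`; to the layer at the outer radius, where only one of the two
-- truncations may be active; and to a fixed ball around the origin. Starting the shell at `2 d`
-- ensures that every `y` with `|y| > 3 d` lies in a cell whose corner passes the inner truncation.
open Classical in
lemma cell_annulus_diff_le (hd : 0 < d) {R : ℕ} (hR : 1 ≤ R) (y : Space d) :
    |(if cellIndex 1 y ∈ shell d (2 * d) R then (nrm (cellIndex 1 y) ^ d)⁻¹ else 0) -
      (if 1 < ‖y‖ ∧ ‖y‖ ≤ R then (‖y‖ ^ d)⁻¹ else 0)| ≤
    d ^ 2 * 2 ^ d * (if 1 < ‖y‖ then (‖y‖ ^ (d + 1))⁻¹ else 0) +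
      2 ^ d * ((R : ℝ) ^ d)⁻¹ * (if ‖y‖ ≤ R + d then 1 else 0) +
      (if ‖y‖ ≤ 3 * d then 1 else 0) := by
  have hd1 : (1 : ℝ) ≤ d := by exact_mod_cast hd
  have hR1 : (1 : ℝ) ≤ R := by exact_mod_cast hR
  have hdist : |‖y‖ - nrm (cellIndex 1 y)| ≤ d := by
    refine (abs_norm_sub_norm_le _ _).trans ((norm_sub_point_cellIndex_le one_pos y).trans ?_)
    rw [Nat.cast_one, div_one, Real.sqrt_le_left (by linarith)]
    nlinarith
  simp only [mem_shell]
  push_cast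
  set r := ‖y‖
  set ρ := nrm (cellIndex 1 y)
  obtain ⟨h1, h2⟩ := abs_le.1 hdist
  have hr0 : 0 ≤ r := norm_nonneg _
  have hρ0 : 0 ≤ ρ := nrm_nonneg _
  have hA : 0 ≤ d ^ 2 * 2 ^ d * (if 1 < r then (r ^ (d + 1))⁻¹ else 0) := by
    split_ifs <;> positivity
  have hB : 0 ≤ 2 ^ d * ((R : ℝ) ^ d)⁻¹ * (if r ≤ R + d then 1 else 0) := by
    split_ifs <;> positivity
  have hinv : ∀ t : ℝ, 1 ≤ t → (t ^ d)⁻¹ ≤ 1 := fun t ht => inv_le_one_of_one_le₀ (one_le_pow₀ ht)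
  rcases le_or_gt r (3 * d) with hr | hr
  · rw [if_pos hr]
    have : ∀ a b : ℝ, 0 ≤ a → a ≤ 1 → 0 ≤ b → b ≤ 1 → |a - b| ≤ 1 := by
      intro a b _ _ _ _
      rw [abs_le]
      constructor <;> linarith
    refine (this _ _ ?_ ?_ ?_ ?_).trans (by linarith)
    · have := nrm_nonneg (cellIndex 1 y)
      split_ifs <;> positivity
    · split_ifs with h
      · exact hinv _ (by linarith [h.1])
      · exact zero_le_one
    · split_ifs <;> positivity
    · split_ifs with h
      · exact hinv _ h.1.le
      · exact zero_le_one
  · rw [if_neg hr.not_ge, add_zero]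
    have c1 : 2 * (d : ℝ) < ρ := by linarith
    have c2 : 1 < r := by linarith
    -- When exactly one of `ρ` and `r` is at most `R`, that one is still at least `R / 2`, since
    -- they differ by at most `d` and `r > 3 d`.
    have hsmall : ∀ t : ℝ, R ≤ 2 * t → (t ^ d)⁻¹ ≤ 2 ^ d * ((R : ℝ) ^ d)⁻¹ := by
      intro t ht
      have : (R / 2 : ℝ) ^ d ≤ t ^ d := by gcongr; linarith
      calc (t ^ d)⁻¹ ≤ ((R / 2 : ℝ) ^ d)⁻¹ := inv_anti₀ (by positivity) this
        _ = _ := by rw [div_pow, inv_div, div_eq_mul_inv]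
    simp only [c1, c2, true_and, if_true] at hA ⊢
    by_cases hρR : ρ ≤ R <;> by_cases hrR : r ≤ R
    · rw [if_pos hρR, if_pos hrR]
      linarith [inv_pow_sub_inv_pow_le hd hdist hr]
    · rw [if_pos hρR, if_neg hrR, sub_zero, abs_of_nonneg (by positivity), if_pos (by linarith),
        mul_one]
      linarith [hsmall ρ (by linarith)]
    · rw [if_neg hρR, if_pos hrR, zero_sub, abs_neg, abs_of_nonneg (by positivity),
        if_pos (by linarith), mul_one]
      linarith [hsmall r (by linarith)]
    · rw [if_neg hρR, if_neg hrR, sub_zero, abs_zero]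
      linarith

/-- The limit coefficient: half the volume of the unit ball. -/
def limitCoefficient (d : ℕ) : ℝ := unitBallVolume d / 2

lemma limitCoefficient_pos (d : ℕ) : 0 < limitCoefficient d := half_pos (unitBallVolume_pos d)

/-- The sum is the integral of a function constant on unit cells, and in polar coordinates the
integral of `|y|^(-d)` over `1 < |y| ≤ R` is `d` times the volume of the unit ball times `log R`. -/
theorem exists_shell_sum_sub_log_le (hd : 0 < d) :
    ∃ C : ℝ, 0 < C ∧ ∀ R : ℕ, 1 ≤ R →
      |∑ z ∈ shell d 0 R, (nrm z ^ d)⁻¹ - 2 * d * limitCoefficient d * Real.log R| ≤ C := by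
  classical
  set v := unitBallVolume d with hv
  have hv0 : 0 < v := unitBallVolume_pos d
  -- The cardinality accounts for the points within `2 d`, each contributing at most one; the rest
  -- are bounds, uniform in `R`, for the integrals of the three error terms of
  -- `cell_annulus_diff_le`.
  refine ⟨((shell d 0 (2 * d)).card : ℝ) + (d ^ 2 * 2 ^ d * (d * v) +
    2 ^ d * (v * (1 + d) ^ d) + v * (3 * d) ^ d), by positivity, fun R hR => ?_⟩
  have hR1 : (1 : ℝ) ≤ R := by exact_mod_cast hR
  have hsub : shell d (2 * d) R ⊆ shell d 0 R := fun z hz => by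
    rw [mem_shell] at hz ⊢
    refine ⟨lt_of_le_of_lt ?_ hz.1, hz.2⟩
    exact_mod_cast Nat.zero_le _
  have h1 : |∑ z ∈ shell d 0 R, (nrm z ^ d)⁻¹ - ∑ z ∈ shell d (2 * d) R, (nrm z ^ d)⁻¹| ≤
      ((shell d 0 (2 * d)).card : ℝ) := by
    rw [← Finset.sum_sdiff hsub, add_sub_cancel_right, abs_of_nonneg
      (Finset.sum_nonneg fun z _ => inv_nonneg.2 (pow_nonneg (nrm_nonneg z) _))]
    have h2 : shell d 0 R \ shell d (2 * d) R ⊆ shell d 0 (2 * d) := by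
      intro z hz
      simp only [Finset.mem_sdiff, mem_shell] at hz ⊢
      refine ⟨hz.1.1, ?_⟩
      by_contra h
      exact hz.2 ⟨not_le.1 h, hz.1.2⟩
    calc _ ≤ ∑ z ∈ shell d 0 R \ shell d (2 * d) R, (1 : ℝ) := by
          refine Finset.sum_le_sum fun z hz => ?_
          exact inv_le_one_of_one_le₀
            (one_le_pow₀ (one_le_nrm (ne_zero_of_mem_shell (h2 hz))))
      _ ≤ _ := by
          rw [Finset.sum_const, nsmul_eq_mul, mul_one]
          exact_mod_cast Finset.card_le_card h2
  have h3 : |∑ z ∈ shell d (2 * d) R, (nrm z ^ d)⁻¹ - 2 * d * limitCoefficient d * Real.log R| ≤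
      d ^ 2 * 2 ^ d * (d * v) + 2 ^ d * (v * (1 + d) ^ d) + v * (3 * d) ^ d := by
    obtain ⟨i1, e1⟩ := integral_annulus hd hR1
    obtain ⟨i2, e2⟩ := integral_outer hd
    obtain ⟨i3, e3⟩ := integral_ball (d := d) (R := R + d) (by positivity)
    obtain ⟨i4, e4⟩ := integral_ball (d := d) (R := 3 * d) (by positivity)
    have e0 := integral_cells one_pos (shell d (2 * d) R) fun z => (nrm z ^ d)⁻¹
    have i0 := integrable_cells one_pos (shell d (2 * d) R) fun z => (nrm z ^ d)⁻¹
    rw [Nat.cast_one, one_pow, inv_one, one_mul] at e0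
    have e5 : 2 * d * limitCoefficient d * Real.log R = d * v * Real.log R := by
      rw [limitCoefficient]
      ring
    rw [e5, ← e0, ← e1, ← integral_sub i0 i1]
    refine abs_integral_le_integral_abs.trans ((integral_mono (i0.sub i1).abs
      (((i2.const_mul _).add (i3.const_mul _)).add i4) (cell_annulus_diff_le hd hR)).trans ?_)
    rw [integral_add' (((i2.const_mul _).add (i3.const_mul _))) i4,
      integral_add' (i2.const_mul _) (i3.const_mul _), integral_const_mul, integral_const_mul,
      e2, e3, e4]
    have e6 : ((R : ℝ) ^ d)⁻¹ * (v * (R + d) ^ d) ≤ v * (1 + d) ^ d := by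
      have : (R + d : ℝ) ^ d ≤ (R * (1 + d)) ^ d := by
        gcongr
        nlinarith [show (0 : ℝ) ≤ d by positivity]
      rw [mul_pow] at this
      calc _ ≤ ((R : ℝ) ^ d)⁻¹ * (v * (R ^ d * (1 + d) ^ d)) := by
            apply mul_le_mul_of_nonneg_left _ (by positivity)
            exact mul_le_mul_of_nonneg_left this hv0.le
        _ = _ := by field_simp
    have e7 := mul_le_mul_of_nonneg_left e6 (show (0 : ℝ) ≤ 2 ^ d by positivity)
    rw [← mul_assoc] at e7
    linarith
  calc _ ≤ _ := abs_sub_le _ (∑ z ∈ shell d (2 * d) R, (nrm z ^ d)⁻¹) _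
    _ ≤ _ := add_le_add h1 h3

theorem coefficientApprox_eq (d k : ℕ) :
    coefficientApprox d k = 1 / (2 * d * Real.log k) * ∑ z ∈ shell d 0 k, (nrm z ^ d)⁻¹ := by
  rw [coefficientApprox, ← Finset.tsum_subtype]
  congr 1
  have : {z : Lattice d | 0 < ‖point 1 z‖ ∧ ‖point 1 z‖ ≤ k} = ↑(shell d 0 k) := by
    ext z
    rw [Finset.mem_coe, mem_shell]
    simp [nrm]
  exact tsum_congr_set_coe (fun z => (nrm z ^ d)⁻¹) this

theorem tendsto_coefficientApprox (hd : 0 < d) :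
    Tendsto (coefficientApprox d) atTop (𝓝 (limitCoefficient d)) := by
  obtain ⟨C, hC, h⟩ := exists_shell_sum_sub_log_le hd
  have hd' : (0 : ℝ) < d := by exact_mod_cast hd
  have hlog : Tendsto (fun k : ℕ => Real.log k) atTop atTop :=
    Real.tendsto_log_atTop.comp tendsto_natCast_atTop_atTop
  rw [tendsto_iff_norm_sub_tendsto_zero]
  refine squeeze_zero' (.of_forall fun _ => norm_nonneg _) ?_
    ((hlog.const_mul_atTop (show (0 : ℝ) < 2 * d by positivity)).const_div_atTop C)
  filter_upwards [eventually_ge_atTop 2] with k hk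
  have hl : 0 < Real.log k := Real.log_pos (by exact_mod_cast hk)
  have e : coefficientApprox d k - limitCoefficient d =
      (∑ z ∈ shell d 0 k, (nrm z ^ d)⁻¹ - 2 * d * limitCoefficient d * Real.log k) /
        (2 * d * Real.log k) := by
    rw [coefficientApprox_eq]
    field_simp
  rw [e, Real.norm_eq_abs, abs_div, abs_of_pos (show 0 < 2 * d * Real.log k by positivity)]
  gcongr
  exact h k (by omega)

end Coefficient

/-! ### Dyadic sums and symmetries of the jump kernel. -/

section Kernel

lemma sum_shell_add_sum_shell {r m R : ℕ} (h1 : r ≤ m) (h2 : m ≤ R) (f : Lattice d → ℝ) :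
    ∑ z ∈ shell d r R, f z = ∑ z ∈ shell d r m, f z + ∑ z ∈ shell d m R, f z := by
  classical
  have h1' : (r : ℝ) ≤ m := by exact_mod_cast h1
  have h2' : (m : ℝ) ≤ R := by exact_mod_cast h2
  rw [← Finset.sum_union]
  · refine Finset.sum_congr ?_ fun _ _ => rfl
    ext z
    simp only [Finset.mem_union, mem_shell]
    constructor
    · rintro ⟨a, b⟩
      rcases le_or_gt (nrm z) m with h | h
      · exact Or.inl ⟨a, h⟩
      · exact Or.inr ⟨h, b⟩
    · rintro (⟨a, b⟩ | ⟨a, b⟩)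
      · exact ⟨a, b.trans h2'⟩
      · exact ⟨h1'.trans_lt a, b⟩
  · rw [Finset.disjoint_left]
    intro z hz hz'
    rw [mem_shell] at hz hz'
    linarith [hz.2, hz'.1]

lemma kap_mul_nrm_sq {z : Lattice d} (hz : z ≠ 0) : kap z * nrm z ^ 2 = (nrm z ^ d)⁻¹ := by
  have := nrm_pos_iff.2 hz
  rw [kap]
  field_simp
  ring

/-- Subtracting the logarithmic asymptotics at two consecutive powers of two leaves a constant, so
each dyadic shell carries bounded mass. All later kernel sums reduce to geometric series through
this fact. -/
theorem exists_dyadic_shell_le (hd : 0 < d) :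
    ∃ C : ℝ, 0 < C ∧ ∑ z ∈ shell d 0 1, (nrm z ^ d)⁻¹ ≤ C ∧
      ∀ m : ℕ, ∑ z ∈ shell d (2 ^ m) (2 ^ (m + 1)), (nrm z ^ d)⁻¹ ≤ C := by
  obtain ⟨C, hC, h⟩ := exists_shell_sum_sub_log_le hd
  have ha := limitCoefficient_pos d
  have hl : 0 < Real.log 2 := Real.log_pos one_lt_two
  have hp : 0 ≤ 2 * d * limitCoefficient d * Real.log 2 := by positivity
  refine ⟨2 * C + 2 * d * limitCoefficient d * Real.log 2, by positivity, ?_, fun m => ?_⟩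
  · have h0 := (abs_le.1 (h 1 le_rfl)).2
    simp only [Nat.cast_one, Real.log_one, mul_zero, sub_zero] at h0
    linarith
  · have h0 := (abs_le.1 (h (2 ^ m) Nat.one_le_two_pow)).1
    have h1 := (abs_le.1 (h (2 ^ (m + 1)) Nat.one_le_two_pow)).2
    rw [sum_shell_add_sum_shell (Nat.zero_le _) (Nat.pow_le_pow_right two_pos (show m ≤ m + 1 by omega))]
      at h1
    push_cast [Real.log_pow] at h0 h1
    linarith

/-- Controls the third order Taylor remainder: the shells contribute a growing geometric series,
dominated by the last one. -/
theorem exists_sum_kap_mul_nrm_cube_le (hd : 0 < d) :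
    ∃ C : ℝ, 0 < C ∧ ∀ n : ℕ, ∑ z ∈ shell d 0 (2 ^ n), kap z * nrm z ^ 3 ≤ C * 2 ^ n := by
  obtain ⟨C, hC, h0, h⟩ := exists_dyadic_shell_le hd
  have key : ∀ r n : ℕ, ∑ z ∈ shell d r (2 ^ n), kap z * nrm z ^ 3 ≤
      2 ^ n * ∑ z ∈ shell d r (2 ^ n), (nrm z ^ d)⁻¹ := by
    intro r n
    rw [Finset.mul_sum]
    refine Finset.sum_le_sum fun z hz => ?_
    have h2 := (mem_shell.1 hz).2
    push_cast at h2
    rw [pow_succ, ← mul_assoc, kap_mul_nrm_sq (ne_zero_of_mem_shell hz), mul_comm]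
    have := nrm_nonneg z
    gcongr
  refine ⟨2 * C, by positivity, fun n => ?_⟩
  induction n with
  | zero =>
    refine (key 0 0).trans ?_
    norm_num
    linarith
  | succ n ih =>
    rw [sum_shell_add_sum_shell (Nat.zero_le _) (Nat.pow_le_pow_right two_pos (show n ≤ n + 1 by omega))]
    have h1 := (key (2 ^ n) (n + 1)).trans (mul_le_mul_of_nonneg_left (h n) (by positivity))
    calc _ ≤ 2 * C * 2 ^ n + 2 ^ (n + 1) * C := add_le_add ih h1
      _ = _ := by ring

lemma exists_sum_kap_shell_le (hd : 0 < d) :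
    ∃ C : ℝ, 0 < C ∧ ∑ z ∈ shell d 0 1, kap z ≤ C ∧
      ∀ n m : ℕ, ∑ z ∈ shell d (2 ^ n) (2 ^ (n + m)), kap z ≤ C * ((4 : ℝ) ^ n)⁻¹ := by
  obtain ⟨C, hC, h0, h⟩ := exists_dyadic_shell_le hd
  refine ⟨2 * C, by positivity, ?_, fun n m => ?_⟩
  · calc _ ≤ ∑ z ∈ shell d 0 1, (nrm z ^ d)⁻¹ := by
          refine Finset.sum_le_sum fun z hz => ?_
          have hz0 := ne_zero_of_mem_shell hz
          rw [← kap_mul_nrm_sq hz0]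
          exact le_mul_of_one_le_right (kap_nonneg z) (one_le_pow₀ (one_le_nrm hz0))
      _ ≤ _ := by linarith
  -- A telescoping strengthening suited to induction on `m`; `4 / 3` is the sum of the geometric
  -- series of ratio `1 / 4`.
  · have key : ∑ z ∈ shell d (2 ^ n) (2 ^ (n + m)), kap z ≤
        4 / 3 * C * (((4 : ℝ) ^ n)⁻¹ - ((4 : ℝ) ^ (n + m))⁻¹) := by
      induction m with
      | zero =>
        have : shell d (2 ^ n) (2 ^ (n + 0)) = ∅ := by
          refine Finset.eq_empty_of_forall_notMem fun z hz => ?_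
          have := mem_shell.1 hz
          rw [add_zero] at this
          linarith [this.1, this.2]
        rw [this]
        simp
      | succ m ih =>
        rw [sum_shell_add_sum_shell (m := 2 ^ (n + m)) (Nat.pow_le_pow_right two_pos (by omega))
          (Nat.pow_le_pow_right two_pos (by omega))]
        have h1 : ∑ z ∈ shell d (2 ^ (n + m)) (2 ^ (n + (m + 1))), kap z ≤
            ((4 : ℝ) ^ (n + m))⁻¹ * C := by
          refine le_trans ?_ (mul_le_mul_of_nonneg_left (h (n + m)) (by positivity))
          rw [Finset.mul_sum]
          refine Finset.sum_le_sum fun z hz => ?_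
          have hz0 := nrm_pos_iff.2 (ne_zero_of_mem_shell hz)
          have h2 := (mem_shell.1 hz).1
          push_cast at h2
          have h3 : (4 : ℝ) ^ (n + m) ≤ nrm z ^ 2 := by
            calc (4 : ℝ) ^ (n + m) = (2 ^ (n + m)) ^ 2 := by rw [← pow_mul, mul_comm, pow_mul]; norm_num
              _ ≤ _ := by gcongr
          rw [kap, pow_add, mul_inv, mul_comm]
          gcongr
        calc _ ≤ _ := add_le_add ih h1
          _ = _ := by
            rw [← add_assoc, pow_succ _ (n + m)]
            ring
    have h4 : 0 ≤ C * ((4 : ℝ) ^ n)⁻¹ := by positivity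
    have h5 : 0 ≤ C * ((4 : ℝ) ^ (n + m))⁻¹ := by positivity
    nlinarith

open Classical in
/-- The part of the jump kernel with jumps longer than `2 ^ n`. -/
def tailKap (d n : ℕ) (z : Lattice d) : ℝ := if (2 : ℝ) ^ n < nrm z then kap z else 0

lemma exists_subset_box (s : Finset (Lattice d)) : ∃ m : ℕ, ∀ z ∈ s, nrm z ≤ (2 : ℝ) ^ m := by
  obtain ⟨M, hM⟩ := (s.image nrm).bddAbove
  obtain ⟨m, hm⟩ := pow_unbounded_of_one_lt M one_lt_two
  exact ⟨m, fun z hz => (hM (by simpa using ⟨z, hz, rfl⟩)).trans hm.le⟩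

theorem exists_tsum_tailKap_le (hd : 0 < d) :
    ∃ C : ℝ, 0 < C ∧ ∀ n : ℕ, Summable (tailKap d n) ∧
      ∑' z, tailKap d n z ≤ C * ((4 : ℝ) ^ n)⁻¹ := by
  classical
  obtain ⟨C, hC, -, h⟩ := exists_sum_kap_shell_le hd
  refine ⟨C, hC, fun n => ?_⟩
  have hnn : ∀ z, 0 ≤ tailKap d n z := fun z => by
    rw [tailKap]
    split_ifs
    · exact kap_nonneg z
    · exact le_rfl
  have key : ∀ s : Finset (Lattice d), ∑ z ∈ s, tailKap d n z ≤ C * ((4 : ℝ) ^ n)⁻¹ := by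
    intro s
    obtain ⟨m, hm⟩ := exists_subset_box s
    refine le_trans ?_ (h n m)
    simp only [tailKap]
    rw [← Finset.sum_filter]
    refine Finset.sum_le_sum_of_subset_of_nonneg ?_ fun z _ _ => kap_nonneg z
    intro z hz
    rw [Finset.mem_filter] at hz
    rw [mem_shell]
    push_cast
    exact ⟨hz.2, (hm z hz.1).trans (pow_le_pow_right₀ one_le_two (by omega))⟩
  exact ⟨summable_of_sum_le hnn key, Real.tsum_le_of_sum_le hnn key⟩

theorem summable_kap (hd : 0 < d) : Summable (kap (d := d)) := by
  classical
  obtain ⟨C, -, h⟩ := exists_tsum_tailKap_le hd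
  refine ((h 0).1.add (summable_of_ne_finset_zero (s := shell d 0 1)
    (f := fun z => if z ∈ shell d 0 1 then kap z else 0) fun z hz => if_neg hz)).congr fun z => ?_
  rw [tailKap, pow_zero]
  by_cases h0 : z = 0
  · simp [h0]
  · have h1 := nrm_pos_iff.2 h0
    by_cases h2 : nrm z ≤ 1
    · rw [if_neg h2.not_gt, if_pos (mem_shell.2 (by simpa using ⟨h1, h2⟩)), zero_add]
    · rw [if_pos (not_le.1 h2), if_neg, add_zero]
      rw [mem_shell]
      simp [h2]

/-- This is where the dimension enters: `|z|^6 ≤ |z|^(d+2)` requires `d ≥ 4`. Cutting off jumps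
below `r` thus makes the variances small by a factor `r^(-2)`. -/
lemma kap_sq_mul_nrm_le (hd : 4 ≤ d) {r R : ℕ} (hr : 1 ≤ r) {z : Lattice d}
    (hz : z ∈ shell d r R) : kap z ^ 2 * nrm z ^ 4 ≤ ((r : ℝ) ^ 2)⁻¹ * kap z := by
  have h1 := one_le_nrm (ne_zero_of_mem_shell hz)
  have h2 := (mem_shell.1 hz).1
  have hr' : (1 : ℝ) ≤ r := by exact_mod_cast hr
  have h3 : (r : ℝ) ^ 2 * kap z * nrm z ^ 4 ≤ 1 := by
    calc (r : ℝ) ^ 2 * kap z * nrm z ^ 4 ≤ nrm z ^ 2 * kap z * nrm z ^ 4 := by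
          have := kap_nonneg z
          gcongr
      _ = kap z * nrm z ^ 6 := by ring
      _ ≤ kap z * nrm z ^ (d + 2) := by
          have := kap_nonneg z
          gcongr
          omega
      _ = 1 := inv_mul_cancel₀ (by positivity)
  have hr2 : (0 : ℝ) < (r : ℝ) ^ 2 := by positivity
  rw [inv_mul_eq_div, le_div_iff₀ hr2]
  nlinarith [mul_le_mul_of_nonneg_left h3 (kap_nonneg z)]

/-- The reflection `z ↦ -z` preserves the shell and changes the sign. -/
lemma sum_shell_radial_mul_coord {r R : ℕ} (f : ℝ → ℝ) (i : Fin d) :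
    ∑ z ∈ shell d r R, f (nrm z) * (z i : ℝ) = 0 := by
  have h : ∑ z ∈ shell d r R, f (nrm z) * (z i : ℝ) =
      ∑ z ∈ shell d r R, -(f (nrm z) * (z i : ℝ)) := by
    refine Finset.sum_nbij' (fun z => -z) (fun z => -z) ?_ ?_ ?_ ?_ ?_ <;> intro z hz
    · exact neg_mem_shell.2 hz
    · exact neg_mem_shell.2 hz
    · exact neg_neg z
    · exact neg_neg z
    · simp
  rw [Finset.sum_neg_distrib] at h
  linarith

lemma nrm_eq_of_sum_sq_eq {y z : Lattice d} (h : ∑ i, (y i : ℝ) ^ 2 = ∑ i, (z i : ℝ) ^ 2) :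
    nrm y = nrm z := by
  rw [← nrm_sq, ← nrm_sq] at h
  exact (pow_left_inj₀ (nrm_nonneg y) (nrm_nonneg z) two_ne_zero).1 h

/-- Reflecting the single coordinate `i` changes the sign of each term. -/
lemma sum_shell_radial_mul_coord_mul_coord {r R : ℕ} (f : ℝ → ℝ) {i j : Fin d} (hij : i ≠ j) :
    ∑ z ∈ shell d r R, f (nrm z) * ((z i : ℝ) * z j) = 0 := by
  set F : Lattice d → Lattice d := fun z => Function.update z i (-z i) with hF
  have hn : ∀ z, nrm (F z) = nrm z := by
    intro z
    apply nrm_eq_of_sum_sq_eq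
    refine Finset.sum_congr rfl fun l _ => ?_
    by_cases h : l = i
    · subst h
      simp [hF]
    · simp [hF, h]
  have hFF : ∀ z, F (F z) = z := by
    intro z
    simp [hF]
  have h : ∑ z ∈ shell d r R, f (nrm z) * ((z i : ℝ) * z j) =
      ∑ z ∈ shell d r R, -(f (nrm z) * ((z i : ℝ) * z j)) := by
    refine Finset.sum_nbij' F F ?_ ?_ ?_ ?_ ?_ <;> intro z hz
    · rwa [mem_shell, hn, ← mem_shell]
    · rwa [mem_shell, hn, ← mem_shell]
    · exact hFF z
    · exact hFF z
    · rw [hn]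
      simp [hF, hij.symm]
  rw [Finset.sum_neg_distrib] at h
  linarith

/-- Transposing coordinates shows that all `d` directions have the same second moment. -/
lemma sum_shell_radial_mul_coord_sq {r R : ℕ} (f : ℝ → ℝ) (i : Fin d) :
    d * ∑ z ∈ shell d r R, f (nrm z) * (z i : ℝ) ^ 2 =
      ∑ z ∈ shell d r R, f (nrm z) * nrm z ^ 2 := by
  have h : ∀ j, ∑ z ∈ shell d r R, f (nrm z) * (z j : ℝ) ^ 2 =
      ∑ z ∈ shell d r R, f (nrm z) * (z i : ℝ) ^ 2 := by
    intro j
    set F : Lattice d → Lattice d := fun z => z ∘ Equiv.swap i j with hF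
    have hn : ∀ z, nrm (F z) = nrm z := fun z =>
      nrm_eq_of_sum_sq_eq (Equiv.sum_comp (Equiv.swap i j) fun l => (z l : ℝ) ^ 2)
    have hFF : ∀ z, F (F z) = z := by
      intro z
      ext l
      simp [hF]
    refine Finset.sum_nbij' F F ?_ ?_ ?_ ?_ ?_ <;> intro z hz
    · rwa [mem_shell, hn, ← mem_shell]
    · rwa [mem_shell, hn, ← mem_shell]
    · exact hFF z
    · exact hFF z
    · rw [hn]
      simp [hF]
  simp only [nrm_sq, Finset.mul_sum]
  rw [Finset.sum_comm (s := shell d r R)]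
  have h' : ∀ j ∈ Finset.univ, ∑ z ∈ shell d r R, f (nrm z) * (z j : ℝ) ^ 2 =
      ∑ z ∈ shell d r R, f (nrm z) * (z i : ℝ) ^ 2 := fun j _ => h j
  rw [Finset.sum_congr rfl h', Finset.sum_const, Finset.card_univ, Fintype.card_fin,
    nsmul_eq_mul, Finset.mul_sum]

end Kernel

/-! ### Symmetric jump generators on `ℓ²`, their Dirichlet forms and resolvents. -/

section JumpForms

section EllTwo

variable {ι : Type*}

lemma memℓp_two_iff {f : ι → ℝ} : Memℓp f 2 ↔ Summable fun i => f i ^ 2 := by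
  rw [memℓp_gen_iff (by norm_num)]
  refine summable_congr fun i => ?_
  norm_num

/-- The `ℓ²` norm of a real function. -/
def ell2 (f : ι → ℝ) : ℝ := √(∑' i, f i ^ 2)

lemma ell2_nonneg (f : ι → ℝ) : 0 ≤ ell2 f := Real.sqrt_nonneg _

lemma ell2_sq (f : ι → ℝ) : ell2 f ^ 2 = ∑' i, f i ^ 2 :=
  Real.sq_sqrt (tsum_nonneg fun _ => sq_nonneg _)

lemma inner_lp_eq (u v : lp (fun _ : ι => ℝ) 2) : ⟪u, v⟫_ℝ = ∑' i, u i * v i := by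
  rw [lp.inner_eq_tsum]
  refine tsum_congr fun i => ?_
  simp [mul_comm]

lemma norm_lp_eq (u : lp (fun _ : ι => ℝ) 2) : ‖u‖ = ell2 (u : ι → ℝ) := by
  rw [ell2, eq_comm, Real.sqrt_eq_iff_mul_self_eq (tsum_nonneg fun _ => sq_nonneg _) (norm_nonneg _),
    ← real_inner_self_eq_norm_mul_norm, inner_lp_eq]
  refine tsum_congr fun i => ?_
  ring

/-- A square summable function as an element of `ℓ²`. -/
def toLp {f : ι → ℝ} (hf : Summable fun i => f i ^ 2) : lp (fun _ : ι => ℝ) 2 :=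
  ⟨f, memℓp_two_iff.2 hf⟩

@[simp] lemma toLp_apply {f : ι → ℝ} (hf : Summable fun i => f i ^ 2) (i : ι) :
    toLp hf i = f i := rfl

lemma norm_toLp {f : ι → ℝ} (hf : Summable fun i => f i ^ 2) : ‖toLp hf‖ = ell2 f := norm_lp_eq _

lemma summable_sq_lp (u : lp (fun _ : ι => ℝ) 2) : Summable fun i => u i ^ 2 :=
  memℓp_two_iff.1 u.2

lemma summable_sq_add {f g : ι → ℝ} (hf : Summable fun i => f i ^ 2)
    (hg : Summable fun i => g i ^ 2) : Summable fun i => (f i + g i) ^ 2 :=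
  summable_sq_lp (toLp hf + toLp hg)

lemma summable_sq_sub {f g : ι → ℝ} (hf : Summable fun i => f i ^ 2)
    (hg : Summable fun i => g i ^ 2) : Summable fun i => (f i - g i) ^ 2 :=
  summable_sq_lp (toLp hf - toLp hg)

lemma summable_mul_of_sq {f g : ι → ℝ} (hf : Summable fun i => f i ^ 2)
    (hg : Summable fun i => g i ^ 2) : Summable fun i => f i * g i := by
  refine .of_norm_bounded (hf.add hg) fun i => ?_
  rw [Real.norm_eq_abs, abs_le]
  constructor <;> nlinarith [sq_nonneg (f i + g i), sq_nonneg (f i - g i)]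

lemma ell2_add_le {f g : ι → ℝ} (hf : Summable fun i => f i ^ 2) (hg : Summable fun i => g i ^ 2) :
    ell2 (fun i => f i + g i) ≤ ell2 f + ell2 g := by
  rw [← norm_toLp hf, ← norm_toLp hg, ← norm_toLp (summable_sq_add hf hg)]
  exact norm_add_le (toLp hf) (toLp hg)

lemma abs_tsum_mul_le {f g : ι → ℝ} (hf : Summable fun i => f i ^ 2)
    (hg : Summable fun i => g i ^ 2) : |∑' i, f i * g i| ≤ ell2 f * ell2 g := by
  have := abs_real_inner_le_norm (toLp hf) (toLp hg)
  rwa [inner_lp_eq, norm_toLp, norm_toLp] at this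

lemma abs_sum_mul_le (s : Finset ι) (f g : ι → ℝ) :
    |∑ i ∈ s, f i * g i| ≤ √(∑ i ∈ s, f i ^ 2) * √(∑ i ∈ s, g i ^ 2) := by
  rw [← Real.sqrt_mul (Finset.sum_nonneg fun _ _ => sq_nonneg _)]
  exact Real.abs_le_sqrt (Finset.sum_mul_sq_le_sq_mul_sq s f g)

lemma sqrt_sum_sq_le_ell2 {f : ι → ℝ} (hf : Summable fun i => f i ^ 2) (s : Finset ι) :
    √(∑ i ∈ s, f i ^ 2) ≤ ell2 f :=
  Real.sqrt_le_sqrt (hf.sum_le_tsum s fun _ _ => sq_nonneg _)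

lemma ell2_eq_of_support {f : ι → ℝ} {s : Finset ι} (h : ∀ i ∉ s, f i = 0) :
    ell2 f = √(∑ i ∈ s, f i ^ 2) := by
  rw [ell2, tsum_eq_sum]
  intro i hi
  rw [h i hi, zero_pow two_ne_zero]

lemma summable_sq_of_support {f : ι → ℝ} {s : Finset ι} (h : ∀ i ∉ s, f i = 0) :
    Summable fun i => f i ^ 2 :=
  summable_of_ne_finset_zero (s := s) fun i hi => by rw [h i hi, zero_pow two_ne_zero]

end EllTwo

section JumpKernel

variable {G : Type*} [AddCommGroup G]

/-- A symmetric jump kernel on a group, `q x z` being the rate of the jump from `x` to `x + z`,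
with rates bounded by a summable function of the jump. -/
structure IsJumpKernel (κ : G → ℝ) (q : G → G → ℝ) : Prop where
  summable : Summable κ
  bound : ∀ x z, |q x z| ≤ κ z
  symm : ∀ x z, q (x + z) (-z) = q x z

/-- The generator of a jump kernel. -/
def jumpGenerator (q : G → G → ℝ) (u : G → ℝ) (x : G) : ℝ := ∑' z, q x z * (u (x + z) - u x)

/-- The equivalence `(x, z) ↦ (x + z, z)`. -/
def shiftEquiv (G : Type*) [AddCommGroup G] : G × G ≃ G × G where
  toFun p := (p.1 + p.2, p.2)
  invFun p := (p.1 - p.2, p.2)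
  left_inv p := by simp
  right_inv p := by simp

/-- The involution `(x, z) ↦ (x + z, -z)` that reverses a jump. -/
def reverseEquiv (G : Type*) [AddCommGroup G] : G × G ≃ G × G where
  toFun p := (p.1 + p.2, -p.2)
  invFun p := (p.1 + p.2, -p.2)
  left_inv p := by simp
  right_inv p := by simp

lemma summable_sq_shift {u : G → ℝ} (hu : Summable fun x => u x ^ 2) (c : G) :
    Summable fun x => u (x + c) ^ 2 :=
  ((Equiv.addRight c).summable_iff (f := fun x => u x ^ 2)).2 hu

lemma ell2_shift (u : G → ℝ) (c : G) : ell2 (fun x => u (x + c)) = ell2 u := by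
  rw [ell2, ell2]
  congr 1
  exact (Equiv.addRight c).tsum_eq fun x => u x ^ 2

namespace IsJumpKernel

variable {κ : G → ℝ} {q : G → G → ℝ} (H : IsJumpKernel κ q) {u h : G → ℝ}
  (hu : Summable fun x => u x ^ 2) (hh : Summable fun x => h x ^ 2)

include H

lemma nonneg (z : G) : 0 ≤ κ z := (abs_nonneg _).trans (H.bound 0 z)

include hu

lemma summable_start : Summable fun p : G × G => κ p.2 * u p.1 ^ 2 :=
  (hu.mul_of_nonneg H.summable (fun _ => sq_nonneg _) H.nonneg).congr fun _ => mul_comm _ _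

lemma tsum_start : ∑' p : G × G, κ p.2 * u p.1 ^ 2 = (∑' z, κ z) * ∑' x, u x ^ 2 := by
  rw [mul_comm, hu.tsum_mul_tsum H.summable]
  · exact tsum_congr fun _ => mul_comm _ _
  · exact hu.mul_of_nonneg H.summable (fun _ => sq_nonneg _) H.nonneg

lemma summable_end : Summable fun p : G × G => κ p.2 * u (p.1 + p.2) ^ 2 :=
  (shiftEquiv G).summable_iff.2 (H.summable_start hu)

lemma tsum_end : ∑' p : G × G, κ p.2 * u (p.1 + p.2) ^ 2 = (∑' z, κ z) * ∑' x, u x ^ 2 := by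
  rw [← H.tsum_start hu]
  exact (shiftEquiv G).tsum_eq fun p : G × G => κ p.2 * u p.1 ^ 2

lemma summable_diff_sq : Summable fun p : G × G => κ p.2 * (u (p.1 + p.2) - u p.1) ^ 2 := by
  refine .of_nonneg_of_le (fun p => mul_nonneg (H.nonneg _) (sq_nonneg _)) (fun p => ?_)
    (((H.summable_end hu).add (H.summable_start hu)).mul_left 2)
  nlinarith [mul_nonneg (H.nonneg p.2) (sq_nonneg (u (p.1 + p.2) + u p.1))]

lemma tsum_diff_sq_le : ∑' p : G × G, κ p.2 * (u (p.1 + p.2) - u p.1) ^ 2 ≤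
    4 * (∑' z, κ z) * ∑' x, u x ^ 2 := by
  refine ((H.summable_diff_sq hu).tsum_le_tsum (fun p => ?_)
    (((H.summable_end hu).add (H.summable_start hu)).mul_left 2)).trans ?_
  · nlinarith [mul_nonneg (H.nonneg p.2) (sq_nonneg (u (p.1 + p.2) + u p.1))]
  · rw [tsum_mul_left, (H.summable_end hu).tsum_add (H.summable_start hu), H.tsum_end hu,
      H.tsum_start hu]
    linarith

lemma summable_kap_mul_diff (x : G) : Summable fun z => κ z * (u (x + z) - u x) ^ 2 :=
  (H.summable_diff_sq hu).prod_factor x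

lemma summable_sq_sqrt_mul_diff (x : G) :
    Summable fun z => (√(κ z) * (u (x + z) - u x)) ^ 2 := by
  refine (H.summable_kap_mul_diff hu x).congr fun z => ?_
  rw [mul_pow, Real.sq_sqrt (H.nonneg z)]

omit hu in
lemma summable_sq_sqrt : Summable fun z => √(κ z) ^ 2 :=
  H.summable.congr fun z => (Real.sq_sqrt (H.nonneg z)).symm

lemma summable_generator (x : G) : Summable fun z => q x z * (u (x + z) - u x) := by
  have h1 := summable_mul_of_sq H.summable_sq_sqrt (H.summable_sq_sqrt_mul_diff hu x)
  refine .of_norm_bounded h1.abs fun z => ?_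
  rw [← mul_assoc, Real.mul_self_sqrt (H.nonneg z), norm_mul, abs_mul, abs_of_nonneg (H.nonneg z)]
  exact mul_le_mul_of_nonneg_right (H.bound x z) (abs_nonneg _)

/-- Cauchy-Schwarz in the jump variable, with the kernel split as `√κ * √κ`. -/
lemma jumpGenerator_sq_le (x : G) :
    jumpGenerator q u x ^ 2 ≤ (∑' z, κ z) * ∑' z, κ z * (u (x + z) - u x) ^ 2 := by
  have hs : ∀ z, √(κ z) * |u (x + z) - u x| = |√(κ z) * (u (x + z) - u x)| := fun z => by
    rw [abs_mul, abs_of_nonneg (Real.sqrt_nonneg _)]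
  have h0 : Summable fun z => (√(κ z) * |u (x + z) - u x|) ^ 2 := by
    simpa only [hs, sq_abs] using H.summable_sq_sqrt_mul_diff hu x
  have h1 : |jumpGenerator q u x| ≤ ∑' z, √(κ z) * (√(κ z) * |u (x + z) - u x|) := by
    rw [jumpGenerator, ← Real.norm_eq_abs]
    refine tsum_of_norm_bounded (summable_mul_of_sq H.summable_sq_sqrt h0).hasSum fun z => ?_
    rw [← mul_assoc, Real.mul_self_sqrt (H.nonneg z), norm_mul]
    exact mul_le_mul_of_nonneg_right (H.bound x z) (abs_nonneg _)
  have h2 := (h1.trans (le_abs_self _)).trans (abs_tsum_mul_le H.summable_sq_sqrt h0)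
  rw [← sq_abs]
  refine (pow_le_pow_left₀ (abs_nonneg _) h2 2).trans (le_of_eq ?_)
  rw [mul_pow, ell2_sq, ell2_sq]
  congr 1
  · exact tsum_congr fun z => Real.sq_sqrt (H.nonneg z)
  · refine tsum_congr fun z => ?_
    rw [mul_pow, Real.sq_sqrt (H.nonneg z), sq_abs]

lemma summable_jumpGenerator_sq : Summable fun x => jumpGenerator q u x ^ 2 :=
  .of_nonneg_of_le (fun _ => sq_nonneg _) (H.jumpGenerator_sq_le hu)
    ((H.summable_diff_sq hu).prod.mul_left _)

lemma ell2_jumpGenerator_le : ell2 (jumpGenerator q u) ≤ 2 * (∑' z, κ z) * ell2 u := by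
  have hK : 0 ≤ ∑' z, κ z := tsum_nonneg H.nonneg
  refine (sq_le_sq₀ (ell2_nonneg _) (mul_nonneg (by positivity) (ell2_nonneg _))).1 ?_
  rw [mul_pow, ell2_sq, ell2_sq]
  calc _ ≤ ∑' x, (∑' z, κ z) * ∑' z, κ z * (u (x + z) - u x) ^ 2 :=
        (H.summable_jumpGenerator_sq hu).tsum_le_tsum (H.jumpGenerator_sq_le hu)
          ((H.summable_diff_sq hu).prod.mul_left _)
    _ = (∑' z, κ z) * ∑' p : G × G, κ p.2 * (u (p.1 + p.2) - u p.1) ^ 2 := by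
        rw [tsum_mul_left, (H.summable_diff_sq hu).tsum_prod]
    _ ≤ (∑' z, κ z) * (4 * (∑' z, κ z) * ∑' x, u x ^ 2) :=
        mul_le_mul_of_nonneg_left (H.tsum_diff_sq_le hu) hK
    _ = _ := by ring

include hh

lemma summable_generator_mul :
    Summable fun p : G × G => q p.1 p.2 * (u (p.1 + p.2) - u p.1) * h p.1 := by
  refine .of_norm_bounded ((H.summable_diff_sq hu).add (H.summable_start hh)) fun p => ?_
  rw [Real.norm_eq_abs, mul_assoc, abs_mul, ← mul_add]
  refine mul_le_mul (H.bound _ _) ?_ (abs_nonneg _) (H.nonneg _)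
  set a := u (p.1 + p.2) - u p.1
  rw [abs_le]
  constructor <;> nlinarith [sq_nonneg (a + h p.1), sq_nonneg (a - h p.1)]

lemma summable_form : Summable fun p : G × G =>
    q p.1 p.2 * ((u (p.1 + p.2) - u p.1) * (h (p.1 + p.2) - h p.1)) := by
  refine .of_norm_bounded ((H.summable_diff_sq hu).add (H.summable_diff_sq hh)) fun p => ?_
  rw [Real.norm_eq_abs, abs_mul, ← mul_add]
  refine mul_le_mul (H.bound _ _) ?_ (abs_nonneg _) (H.nonneg _)
  set a := u (p.1 + p.2) - u p.1
  set b := h (p.1 + p.2) - h p.1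
  rw [abs_le]
  constructor <;> nlinarith [sq_nonneg (a + b), sq_nonneg (a - b)]

lemma tsum_jumpGenerator_mul_eq_tsum_prod : ∑' x, jumpGenerator q u x * h x =
    ∑' p : G × G, q p.1 p.2 * (u (p.1 + p.2) - u p.1) * h p.1 := by
  rw [(H.summable_generator_mul hu hh).tsum_prod]
  refine tsum_congr fun x => ?_
  exact tsum_mul_right.symm

/-- Symmetrisation: the generator paired with a function is minus half the Dirichlet form. -/
theorem tsum_jumpGenerator_mul : ∑' x, jumpGenerator q u x * h x =
    -(1 / 2) * ∑' p : G × G, q p.1 p.2 * ((u (p.1 + p.2) - u p.1) * (h (p.1 + p.2) - h p.1)) := by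
  have hF := H.summable_generator_mul hu hh
  have hF' := (reverseEquiv G).summable_iff.2 hF
  have e := (reverseEquiv G).tsum_eq fun p : G × G => q p.1 p.2 * (u (p.1 + p.2) - u p.1) * h p.1
  rw [H.tsum_jumpGenerator_mul_eq_tsum_prod hu hh]
  -- Reversing the jump in the second copy replaces the test value `h x` by `-h (x + z)`, by
  -- symmetry of the rates, so the two copies add up to minus the form.
  have h2 : ∑' p : G × G, q p.1 p.2 * (u (p.1 + p.2) - u p.1) * h p.1 +
      ∑' p : G × G, q p.1 p.2 * (u (p.1 + p.2) - u p.1) * h p.1 =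
      -∑' p : G × G, q p.1 p.2 * ((u (p.1 + p.2) - u p.1) * (h (p.1 + p.2) - h p.1)) := by
    nth_rewrite 2 [← e]
    rw [← tsum_neg]
    refine (hF.tsum_add hF').symm.trans (tsum_congr fun p => ?_)
    simp only [Function.comp, reverseEquiv, Equiv.coe_fn_mk, H.symm, add_neg_cancel_right]
    ring
  linarith

end IsJumpKernel

/-- The generator of a jump kernel as a bounded operator on `ℓ²`. -/
def IsJumpKernel.operator {κ : G → ℝ} {q : G → G → ℝ} (H : IsJumpKernel κ q) :
    lp (fun _ : G => ℝ) 2 →L[ℝ] lp (fun _ : G => ℝ) 2 :=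
  LinearMap.mkContinuous
    { toFun := fun u => toLp (H.summable_jumpGenerator_sq (summable_sq_lp u))
      map_add' := fun u v => by
        ext x
        simp only [toLp_apply, lp.coeFn_add, Pi.add_apply, jumpGenerator]
        rw [← (H.summable_generator (summable_sq_lp u) x).tsum_add
          (H.summable_generator (summable_sq_lp v) x)]
        exact tsum_congr fun z => by ring
      map_smul' := fun c u => by
        ext x
        simp only [toLp_apply, lp.coeFn_smul, Pi.smul_apply, jumpGenerator, RingHom.id_apply,
          smul_eq_mul]
        rw [← tsum_mul_left]
        exact tsum_congr fun z => by ring }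
    (2 * ∑' z, κ z) fun u => by
      rw [LinearMap.coe_mk, AddHom.coe_mk, norm_toLp, norm_lp_eq u]
      exact H.ell2_jumpGenerator_le (summable_sq_lp u)

/-- The energy identity of the resolvent equation. -/
theorem IsJumpKernel.energy_eq {κ : G → ℝ} {q : G → G → ℝ} (H : IsJumpKernel κ q) {lam : ℝ}
    {u f : G → ℝ} (hu : Summable fun x => u x ^ 2)
    (h : ∀ x, lam * u x - jumpGenerator q u x = f x) :
    lam * ∑' x, u x ^ 2 + 1 / 2 * ∑' p : G × G, q p.1 p.2 * (u (p.1 + p.2) - u p.1) ^ 2 =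
      ∑' x, f x * u x := by
  have h1 := summable_mul_of_sq (H.summable_jumpGenerator_sq hu) hu
  have h2 : ∑' x, f x * u x = lam * ∑' x, u x ^ 2 - ∑' x, jumpGenerator q u x * u x := by
    rw [← tsum_mul_left, ← (hu.mul_left lam).tsum_sub h1]
    refine tsum_congr fun x => ?_
    rw [← h x]
    ring
  rw [h2, H.tsum_jumpGenerator_mul hu hu]
  simp only [sq]
  ring

/-- Lax-Milgram: `lam - L` is bounded, and by the energy identity it is coercive with constant `lam`
because the rates are nonnegative. -/
theorem IsJumpKernel.existsUnique_resolvent {κ : G → ℝ} {q : G → G → ℝ} (H : IsJumpKernel κ q)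
    (hq : ∀ x z, 0 ≤ q x z) {lam : ℝ} (hlam : 0 < lam) {f : G → ℝ}
    (hf : Summable fun x => f x ^ 2) :
    ∃! u : G → ℝ, (Summable fun x => u x ^ 2) ∧ ∀ x, lam * u x - jumpGenerator q u x = f x := by
  have hnn : ∀ u : G → ℝ, 0 ≤ ∑' p : G × G, q p.1 p.2 * (u (p.1 + p.2) - u p.1) ^ 2 :=
    fun u => tsum_nonneg fun p => mul_nonneg (hq _ _) (sq_nonneg _)
  set S : lp (fun _ : G => ℝ) 2 →L[ℝ] lp (fun _ : G => ℝ) 2 :=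
    lam • ContinuousLinearMap.id ℝ _ - H.operator with hS
  have hSa : ∀ u x, S u x = lam * u x - jumpGenerator q u x := fun u x => rfl
  have hco : IsCoercive ((innerSL ℝ).comp S) := by
    refine ⟨lam, hlam, fun u => ?_⟩
    rw [ContinuousLinearMap.comp_apply, innerSL_apply_apply, inner_lp_eq,
      ← H.energy_eq (summable_sq_lp u) fun x => (hSa u x).symm, mul_assoc, norm_lp_eq, ← sq,
      ell2_sq]
    linarith [hnn u]
  have hSe : ∀ u, hco.continuousLinearEquivOfBilin u = S u := fun u =>
    (hco.unique_continuousLinearEquivOfBilin fun w => rfl).symm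
  obtain ⟨u, hu⟩ := hco.continuousLinearEquivOfBilin.surjective (toLp hf)
  rw [hSe] at hu
  refine ⟨u, ⟨summable_sq_lp u, fun x => ?_⟩, ?_⟩
  · rw [← hSa, hu, toLp_apply]
  · rintro v ⟨hv, hv'⟩
    have : S (toLp hv) = toLp hf := by
      ext x
      exact hv' x
    rw [← hu, ← hSe, ← hSe] at this
    have := hco.continuousLinearEquivOfBilin.injective this
    rw [← this]
    rfl

end JumpKernel

end JumpForms

/-! ### Smooth compactly supported functions, Taylor expansions, and the limit resolvent. -/

section TestFunctions

/-- Smooth functions with compact support. -/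
structure IsTest (g : Space d → ℝ) : Prop where
  contDiff : ContDiff ℝ (⊤ : ℕ∞) g
  compact : HasCompactSupport g

/-- The partial derivative in the direction of a coordinate. -/
def pderiv (i : Fin d) (g : Space d → ℝ) (x : Space d) : ℝ :=
  fderiv ℝ g x (EuclideanSpace.single i 1)

namespace IsTest

variable {g : Space d → ℝ} (hg : IsTest g)

include hg

lemma differentiable : Differentiable ℝ g := hg.contDiff.differentiable (by norm_num)

lemma continuous : Continuous g := hg.contDiff.continuous

lemma memLp : MemLp g 2 volume := hg.continuous.memLp_of_hasCompactSupport hg.compact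

lemma pderiv (i : Fin d) : IsTest (pderiv i g) where
  contDiff := (hg.contDiff.fderiv_right (m := (⊤ : ℕ∞)) (by norm_num)).clm_apply contDiff_const
  compact := hg.compact.fderiv_apply (𝕜 := ℝ) _

lemma exists_abs_le : ∃ C : ℝ, 0 < C ∧ ∀ x, |g x| ≤ C := by
  obtain ⟨C, hC⟩ := hg.compact.exists_bound_of_continuous hg.continuous
  exact ⟨max C 1, lt_max_of_lt_right one_pos, fun x => (hC x).trans (le_max_left _ _)⟩

lemma exists_lipschitz : ∃ C : ℝ, 0 < C ∧ ∀ x v, |g (x + v) - g x| ≤ C * ‖v‖ := by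
  obtain ⟨C, hC⟩ := hg.contDiff.lipschitzWith_of_hasCompactSupport hg.compact (by norm_num)
  refine ⟨C + 1, by positivity, fun x v => ?_⟩
  have := hC.dist_le_mul (x + v) x
  rw [Real.dist_eq, dist_eq_norm, add_sub_cancel_left] at this
  nlinarith [norm_nonneg v]

lemma hasDerivAt_line (x v : Space d) (t : ℝ) :
    HasDerivAt (fun t : ℝ => g (x + t • v)) (∑ i, v i * CriticalWalk.pderiv i g (x + t • v)) t := by
  have h1 : HasDerivAt (fun t : ℝ => x + t • v) v t := by
    simpa using ((hasDerivAt_id t).smul_const v).const_add x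
  have h2 := (hg.differentiable (x + t • v)).hasFDerivAt.comp_hasDerivAt t h1
  convert! h2 using 1
  have h3 := congrArg (fderiv ℝ g (x + t • v)) ((EuclideanSpace.basisFun (Fin d) ℝ).sum_repr v)
  rw [← h3]
  simp [CriticalWalk.pderiv]

/-- Mean value inequality on the segment from `x` to `x + v`, the derivative being controlled by the
Lipschitz constants of the partial derivatives. -/
lemma exists_taylor_two : ∃ C : ℝ, 0 < C ∧ ∀ x v,
    |g (x + v) - g x - ∑ i, v i * CriticalWalk.pderiv i g x| ≤ C * ‖v‖ ^ 2 := by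
  choose C hC hC' using fun i => (hg.pderiv i).exists_lipschitz
  refine ⟨∑ i, C i + 1, by
    have := Finset.sum_nonneg fun i (_ : i ∈ Finset.univ) => (hC i).le
    positivity,
    fun x v => ?_⟩
  have hd : ∀ t ∈ Set.Icc (0 : ℝ) 1, HasDerivWithinAt
      (fun t : ℝ => g (x + t • v) - t * ∑ i, v i * CriticalWalk.pderiv i g x)
      (∑ i, v i * CriticalWalk.pderiv i g (x + t • v) - ∑ i, v i * CriticalWalk.pderiv i g x)
      (Set.Icc 0 1) t := fun t _ => by
    have h := ((hg.hasDerivAt_line x v t).sub ((hasDerivAt_id t).mul_const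
      (∑ i, v i * CriticalWalk.pderiv i g x))).hasDerivWithinAt (s := Set.Icc 0 1)
    convert! h using 1
    simp
  have := norm_image_sub_le_of_norm_deriv_le_segment_01' (C := (∑ i, C i + 1) * ‖v‖ ^ 2) hd
    fun t ht => ?_
  · simpa [sub_right_comm] using this
  · rw [← Finset.sum_sub_distrib, Real.norm_eq_abs]
    calc _ ≤ ∑ i, |v i * CriticalWalk.pderiv i g (x + t • v) - v i * CriticalWalk.pderiv i g x| :=
          Finset.abs_sum_le_sum_abs _ _
      _ ≤ ∑ i, C i * ‖v‖ ^ 2 := by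
          refine Finset.sum_le_sum fun i _ => ?_
          rw [← mul_sub, abs_mul]
          have h1 : |v i| ≤ ‖v‖ := PiLp.norm_apply_le v i
          have h2 := hC' i x (t • v)
          have h3 : ‖t • v‖ ≤ ‖v‖ := by
            rw [norm_smul, Real.norm_of_nonneg ht.1]
            exact mul_le_of_le_one_left (norm_nonneg v) ht.2.le
          have h4 := h2.trans (mul_le_mul_of_nonneg_left h3 (hC i).le)
          calc _ ≤ ‖v‖ * (C i * ‖v‖) := mul_le_mul h1 h4 (abs_nonneg _) (norm_nonneg _)
            _ = _ := by ring
      _ ≤ _ := by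
          rw [← Finset.sum_mul]
          gcongr
          linarith

theorem exists_taylor_three : ∃ C : ℝ, 0 < C ∧ ∀ x v,
    |g (x + v) - g x - ∑ i, v i * CriticalWalk.pderiv i g x -
      1 / 2 * ∑ i, ∑ j, v i * v j * CriticalWalk.pderiv j (CriticalWalk.pderiv i g) x| ≤
      C * ‖v‖ ^ 3 := by
  choose C hC hC' using fun i => (hg.pderiv i).exists_taylor_two
  refine ⟨∑ i, C i + 1, by
    have := Finset.sum_nonneg fun i (_ : i ∈ Finset.univ) => (hC i).le
    positivity,
    fun x v => ?_⟩
  set A := ∑ i, v i * CriticalWalk.pderiv i g x with hA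
  set B := ∑ i, ∑ j, v i * v j * CriticalWalk.pderiv j (CriticalWalk.pderiv i g) x with hB
  have hd : ∀ t ∈ Set.Icc (0 : ℝ) 1, HasDerivWithinAt
      (fun t : ℝ => g (x + t • v) - t * A - t ^ 2 * (1 / 2 * B))
      (∑ i, v i * CriticalWalk.pderiv i g (x + t • v) - A - t * B)
      (Set.Icc 0 1) t := fun t _ => by
    have h := (((hg.hasDerivAt_line x v t).sub ((hasDerivAt_id t).mul_const A)).sub
      ((hasDerivAt_pow 2 t).mul_const (1 / 2 * B))).hasDerivWithinAt (s := Set.Icc 0 1)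
    convert! h using 1
    simp
    ring
  have := norm_image_sub_le_of_norm_deriv_le_segment_01' (C := (∑ i, C i + 1) * ‖v‖ ^ 3) hd
    fun t ht => ?_
  · simpa [sub_right_comm] using this
  -- The derivative along the segment is a combination of first order Taylor remainders of the
  -- partial derivatives, so the preceding lemma applies to each of them.
  · have e : ∑ i, v i * CriticalWalk.pderiv i g (x + t • v) - A - t * B =
        ∑ i, v i * (CriticalWalk.pderiv i g (x + t • v) - CriticalWalk.pderiv i g x -
          ∑ j, (t • v) j * CriticalWalk.pderiv j (CriticalWalk.pderiv i g) x) := by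
      simp only [hA, hB, Finset.mul_sum, ← Finset.sum_sub_distrib, mul_sub]
      refine Finset.sum_congr rfl fun i _ => ?_
      congr 1
      refine Finset.sum_congr rfl fun j _ => ?_
      simp
      ring
    rw [e, Real.norm_eq_abs]
    refine (Finset.abs_sum_le_sum_abs _ _).trans ?_
    calc _ ≤ ∑ i, C i * ‖v‖ ^ 3 := by
          refine Finset.sum_le_sum fun i _ => ?_
          rw [abs_mul]
          have h1 : |v i| ≤ ‖v‖ := PiLp.norm_apply_le v i
          have h2 := hC' i x (t • v)
          have h3 : ‖t • v‖ ≤ ‖v‖ := by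
            rw [norm_smul, Real.norm_of_nonneg ht.1]
            exact mul_le_of_le_one_left (norm_nonneg v) ht.2.le
          have h4 := h2.trans (mul_le_mul_of_nonneg_left
            (pow_le_pow_left₀ (norm_nonneg _) h3 2) (hC i).le)
          calc _ ≤ ‖v‖ * (C i * ‖v‖ ^ 2) := mul_le_mul h1 h4 (abs_nonneg _) (norm_nonneg _)
            _ = _ := by ring
      _ ≤ _ := by
          rw [← Finset.sum_mul]
          gcongr
          linarith

lemma laplacian_eq (x : Space d) :
    Laplacian.laplacian g x = ∑ i, CriticalWalk.pderiv i (CriticalWalk.pderiv i g) x := by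
  rw [InnerProductSpace.laplacian_eq_iteratedFDeriv_orthonormalBasis g
    (EuclideanSpace.basisFun (Fin d) ℝ)]
  refine Finset.sum_congr rfl fun i _ => ?_
  rw [iteratedFDeriv_two_apply]
  have h1 : DifferentiableAt ℝ (fderiv ℝ g) x :=
    (hg.contDiff.fderiv_right (m := (⊤ : ℕ∞)) (by norm_num)).differentiable (by norm_num) x
  simp only [CriticalWalk.pderiv, EuclideanSpace.basisFun_apply, Matrix.cons_val_zero,
    Matrix.cons_val_one]
  have h2 := h1.hasFDerivAt.clm_apply (hasFDerivAt_const (EuclideanSpace.single i (1 : ℝ)) x)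
  change _ = fderiv ℝ (fun y => fderiv ℝ g y (EuclideanSpace.single i 1)) x _
  rw [h2.fderiv]
  simp

end IsTest

/-- The gradient of a function. -/
def grad (g : Space d → ℝ) (x : Space d) : Space d := WithLp.toLp 2 fun i => pderiv i g x

lemma IsTest.continuous_grad {g : Space d → ℝ} (hg : IsTest g) : Continuous (grad g) :=
  (PiLp.continuous_toLp 2 _).comp (continuous_pi fun i => (hg.pderiv i).continuous)

lemma integrable_mul_of_memLp {u v : Space d → ℝ} (hu : MemLp u 2 volume) (hv : MemLp v 2 volume) :
    Integrable fun x => u x * v x :=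
  hu.integrable_mul hv

lemma IsTest.isSobolev {g : Space d → ℝ} (hg : IsTest g) : IsSobolev g (grad g) := by
  refine ⟨hg.memLp, hg.continuous_grad.memLp_of_hasCompactSupport ?_, fun φ hφ hφ' i => ?_⟩
  · refine hg.compact.fderiv (𝕜 := ℝ) |>.mono fun x hx => ?_
    contrapose! hx
    rw [Function.mem_support, not_not] at hx ⊢
    ext i
    simp [grad, CriticalWalk.pderiv, hx]
  · have hφt : IsTest φ := ⟨hφ, hφ'⟩
    exact integral_mul_fderiv_eq_neg_fderiv_mul_of_integrable
      (integrable_mul_of_memLp (hg.pderiv i).memLp hφt.memLp)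
      (integrable_mul_of_memLp hg.memLp (hφt.pderiv i).memLp)
      (integrable_mul_of_memLp hg.memLp hφt.memLp)
      (fun x _ => hg.differentiable x) (fun x _ => hφt.differentiable x)

lemma memLp_coord {G : Space d → Space d} (hG : MemLp G 2 volume) (i : Fin d) :
    MemLp (fun x => G x i) 2 volume :=
  (EuclideanSpace.proj (𝕜 := ℝ) i).comp_memLp' hG

lemma inner_eq_sum (x y : Space d) : ⟪x, y⟫_ℝ = ∑ i, x i * y i := by
  rw [PiLp.inner_apply]
  refine Finset.sum_congr rfl fun i _ => ?_
  simp [mul_comm]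

lemma integrable_inner_of_memLp {G H : Space d → Space d} (hG : MemLp G 2 volume)
    (hH : MemLp H 2 volume) : Integrable fun x => ⟪G x, H x⟫_ℝ := by
  simp only [inner_eq_sum]
  exact integrable_finsetSum _ fun i _ => integrable_mul_of_memLp (memLp_coord hG i) (memLp_coord hH i)

lemma IsSobolev.sub {u v : Space d → ℝ} {G H : Space d → Space d} (hu : IsSobolev u G)
    (hv : IsSobolev v H) : IsSobolev (fun x => u x - v x) fun x => G x - H x := by
  refine ⟨hu.1.sub hv.1, hu.2.1.sub hv.2.1, fun φ hφ hφ' i => ?_⟩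
  have hφt : IsTest φ := ⟨hφ, hφ'⟩
  have hm := (hφt.pderiv i).memLp
  have e1 : ∀ x, (u x - v x) * fderiv ℝ φ x (EuclideanSpace.single i 1) =
      u x * pderiv i φ x - v x * pderiv i φ x := fun x => sub_mul _ _ _
  have e2 : ∀ x, (G x - H x) i * φ x = G x i * φ x - H x i * φ x := fun x => sub_mul _ _ _
  simp only [e1, e2]
  rw [integral_sub (integrable_mul_of_memLp hu.1 hm) (integrable_mul_of_memLp hv.1 hm),
    integral_sub (integrable_mul_of_memLp (memLp_coord hu.2.1 i) hφt.memLp)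
      (integrable_mul_of_memLp (memLp_coord hv.2.1 i) hφt.memLp)]
  have h1 : ∫ x, u x * pderiv i φ x = _ := hu.2.2 φ hφ hφ' i
  have h2 : ∫ x, v x * pderiv i φ x = _ := hv.2.2 φ hφ hφ' i
  rw [h1, h2]
  ring

lemma IsTest.laplacian_memLp {g : Space d → ℝ} (hg : IsTest g) :
    MemLp (fun x => Laplacian.laplacian g x) 2 volume := by
  simp only [hg.laplacian_eq]
  exact memLp_finsetSum _ fun i _ => ((hg.pderiv i).pderiv i).memLp

/-- Integration by parts against `H¹` functions is the definition of the weak gradient of `φ`,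
applied to the test functions `pderiv i g`. Hence for data of this class the limit resolvent is
known explicitly. -/
theorem IsTest.isLimitResolvent {g : Space d → ℝ} (hg : IsTest g) (a lam : ℝ) :
    IsLimitResolvent a lam (fun x => lam * g x - a * Laplacian.laplacian g x) g := by
  refine ⟨grad g, hg.isSobolev, fun φ H hφ => ?_⟩
  have hL := hg.laplacian_memLp
  have e1 : ∀ x, (lam * g x - a * Laplacian.laplacian g x) * φ x =
      lam * (g x * φ x) - a * (Laplacian.laplacian g x * φ x) := fun x => by ring
  simp only [e1]
  rw [integral_sub ((integrable_mul_of_memLp hg.memLp hφ.1).const_mul lam)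
    ((integrable_mul_of_memLp hL hφ.1).const_mul a), integral_const_mul, integral_const_mul, sub_eq_add_neg,
    ← mul_neg]
  congr 2
  simp only [inner_eq_sum, hg.laplacian_eq, Finset.sum_mul]
  rw [integral_finsetSum _ fun i _ =>
      integrable_mul_of_memLp (memLp_coord hg.isSobolev.2.1 i) (memLp_coord hφ.2.1 i),
    integral_finsetSum _ fun i _ => integrable_mul_of_memLp ((hg.pderiv i).pderiv i).memLp hφ.1,
    ← Finset.sum_neg_distrib]
  refine Finset.sum_congr rfl fun i _ => ?_
  have h := hφ.2.2 (CriticalWalk.pderiv i g) (hg.pderiv i).contDiff (hg.pderiv i).compact i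
  rw [eq_neg_iff_add_eq_zero, add_comm, ← eq_neg_iff_add_eq_zero]
  calc _ = ∫ x, φ x * fderiv ℝ (CriticalWalk.pderiv i g) x (EuclideanSpace.single i 1) :=
        integral_congr_ae (.of_forall fun x => mul_comm _ _)
    _ = _ := h
    _ = _ := by
        congr 1
        exact integral_congr_ae (.of_forall fun x => mul_comm _ _)

/-- Both equations are tested with the difference `v' - v`: a sum of two nonnegative terms, one of
them `lam` times the squared norm, vanishes. -/
theorem IsLimitResolvent.ae_eq {a lam : ℝ} (ha : 0 < a) (hlam : 0 < lam) {f v v' : Space d → ℝ}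
    (hv : IsLimitResolvent a lam f v) (hv' : IsLimitResolvent a lam f v') :
    v' =ᵐ[volume] v := by
  obtain ⟨G, hG, h⟩ := hv
  obtain ⟨G', hG', h'⟩ := hv'
  have hD := hG'.sub hG
  have h1 := (h' _ _ hD).trans (h _ _ hD).symm
  have e1 : ∫ x, v' x * (v' x - v x) = (∫ x, v x * (v' x - v x)) + ∫ x, (v' x - v x) ^ 2 := by
    have hsq : Integrable fun x => (v' x - v x) ^ 2 := hD.1.integrable_sq
    rw [← integral_add (integrable_mul_of_memLp hG.1 hD.1) hsq]
    refine integral_congr_ae (.of_forall fun x => ?_)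
    ring
  have e2 : ∫ x, ⟪G' x, G' x - G x⟫_ℝ =
      (∫ x, ⟪G x, G' x - G x⟫_ℝ) + ∫ x, ⟪G' x - G x, G' x - G x⟫_ℝ := by
    rw [← integral_add (integrable_inner_of_memLp hG.2.1 hD.2.1)
      (integrable_inner_of_memLp hD.2.1 hD.2.1)]
    refine integral_congr_ae (.of_forall fun x => ?_)
    simp only [← inner_add_left]
    congr 1
    abel
  rw [e1, e2] at h1
  have h2 : 0 ≤ ∫ x, ⟪G' x - G x, G' x - G x⟫_ℝ := integral_nonneg fun x => real_inner_self_nonneg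
  have h3 : 0 ≤ ∫ x, (v' x - v x) ^ 2 := integral_nonneg fun x => sq_nonneg _
  have h4 : ∫ x, (v' x - v x) ^ 2 = 0 := by nlinarith [mul_nonneg ha.le h2, mul_nonneg hlam.le h3]
  rw [integral_eq_zero_iff_of_nonneg (fun x => sq_nonneg _) hD.1.integrable_sq] at h4
  filter_upwards [h4] with x hx
  exact sub_eq_zero.1 (pow_eq_zero_iff two_ne_zero |>.1 hx)

end TestFunctions

/-! ### The scaled resolvents and the energy inequality. -/

section Resolvents

/-- The jump rates `w (x, x + z) / |z| ^ (d + 2)`. -/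
def rate (w : Sym2 (Lattice d) → ℝ) (x z : Lattice d) : ℝ := w s(x, x + z) * kap z

/-- The diffusive scaling factor with logarithmic correction. -/
def speed (k : ℕ) : ℝ := (k : ℝ) ^ 2 / Real.log k

lemma log_pos_of_two_le {k : ℕ} (hk : 2 ≤ k) : 0 < Real.log k :=
  Real.log_pos (by exact_mod_cast hk)

lemma speed_pos {k : ℕ} (hk : 2 ≤ k) : 0 < speed k := by
  have := log_pos_of_two_le hk
  have : (0 : ℝ) < k := by exact_mod_cast (by omega : 0 < k)
  unfold speed
  positivity

lemma scaledGenerator_eq {k : ℕ} (hk : 2 ≤ k) (w : Sym2 (Lattice d) → ℝ) (u : Lattice d → ℝ)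
    (x : Lattice d) : scaledGenerator w k u x = speed k * jumpGenerator (rate w) u x := by
  have hk' : (0 : ℝ) < k := by exact_mod_cast (by omega : 0 < k)
  rw [scaledGenerator, jumpGenerator, ← (Equiv.addLeft x).tsum_eq, ← tsum_mul_left, ← tsum_mul_left]
  refine tsum_congr fun z => ?_
  rw [Equiv.coe_addLeft, ← point_sub, add_sub_cancel_left, norm_point, rate, kap, speed, div_pow]
  have : (k : ℝ) ^ (d + 2) = k ^ d * k ^ 2 := pow_add _ _ _
  rw [this]
  by_cases hz : z = 0
  · simp [hz]
  have := nrm_pos_iff.2 hz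
  field_simp

lemma not_isDiag_add {x z : Lattice d} (hz : z ≠ 0) : ¬ (s(x, x + z)).IsDiag := by
  simpa [Sym2.mk_isDiag_iff] using hz

/-- Bounded symmetric weights times a summable even function of the jump form a jump kernel. -/
lemma isJumpKernel_weight {κ ρ : Lattice d → ℝ} (hκ : Summable κ) (hρ : ∀ z, |ρ z| ≤ κ z)
    (hρ0 : ρ 0 = 0) (hρn : ∀ z, ρ (-z) = ρ z) {a : Sym2 (Lattice d) → ℝ} {K : ℝ} (hK : 0 ≤ K)
    (ha : ∀ e : Sym2 (Lattice d), ¬ e.IsDiag → |a e| ≤ K) :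
    IsJumpKernel (fun z => K * κ z) fun x z => a s(x, x + z) * ρ z where
  summable := hκ.mul_left K
  bound x z := by
    by_cases hz : z = 0
    · rw [hz, hρ0, mul_zero, abs_zero]
      exact mul_nonneg hK ((abs_nonneg _).trans (hρ 0))
    · rw [abs_mul]
      exact mul_le_mul (ha _ (not_isDiag_add hz)) (hρ z) (abs_nonneg _) hK
  symm x z := by rw [add_neg_cancel_right, hρn, Sym2.eq_swap]

section Bounds

variable {C₁ C₂ : ℝ} {w : Sym2 (Lattice d) → ℝ}

lemma abs_le_of_bounds (hC₁ : 0 < C₁)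
    (hw : ∀ e : Sym2 (Lattice d), ¬ e.IsDiag → C₁ ≤ w e ∧ w e ≤ C₂) (e : Sym2 (Lattice d))
    (he : ¬ e.IsDiag) : |w e| ≤ C₂ + 1 := by
  obtain ⟨h1, h2⟩ := hw e he
  rw [abs_le]
  constructor <;> linarith

lemma abs_sub_one_le_of_bounds (hC₁ : 0 < C₁)
    (hw : ∀ e : Sym2 (Lattice d), ¬ e.IsDiag → C₁ ≤ w e ∧ w e ≤ C₂) (e : Sym2 (Lattice d))
    (he : ¬ e.IsDiag) : |w e - 1| ≤ C₂ + 1 := by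
  obtain ⟨h1, h2⟩ := hw e he
  rw [abs_le]
  constructor <;> linarith

lemma rate_nonneg (hC₁ : 0 < C₁)
    (hw : ∀ e : Sym2 (Lattice d), ¬ e.IsDiag → C₁ ≤ w e ∧ w e ≤ C₂) (x z : Lattice d) :
    C₁ * kap z ≤ rate w x z ∧ 0 ≤ rate w x z := by
  by_cases hz : z = 0
  · simp [rate, hz]
  · have h1 := mul_le_mul_of_nonneg_right (hw _ (not_isDiag_add (x := x) hz)).1 (kap_nonneg z)
    exact ⟨h1, (mul_nonneg hC₁.le (kap_nonneg z)).trans h1⟩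

lemma isJumpKernel_rate (hd : 0 < d) (hC₁ : 0 < C₁) (hC₂ : 0 < C₂)
    (hw : ∀ e : Sym2 (Lattice d), ¬ e.IsDiag → C₁ ≤ w e ∧ w e ≤ C₂) :
    IsJumpKernel (fun z => (C₂ + 1) * kap z) (rate w) :=
  isJumpKernel_weight (summable_kap hd) (fun z => (abs_of_nonneg (kap_nonneg z)).le) kap_zero
    kap_neg (by linarith) (abs_le_of_bounds hC₁ hw)

lemma IsJumpKernel.const_mul {κ : Lattice d → ℝ} {q : Lattice d → Lattice d → ℝ}
    (H : IsJumpKernel κ q) {c : ℝ} (hc : 0 ≤ c) :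
    IsJumpKernel (fun z => c * κ z) fun x z => c * q x z where
  summable := H.summable.mul_left c
  bound x z := by
    rw [abs_mul, abs_of_nonneg hc]
    exact mul_le_mul_of_nonneg_left (H.bound x z) hc
  symm x z := by rw [H.symm]

lemma jumpGenerator_const_mul (c : ℝ) (q : Lattice d → Lattice d → ℝ) (u : Lattice d → ℝ)
    (x : Lattice d) : jumpGenerator (fun x z => c * q x z) u x = c * jumpGenerator q u x := by
  rw [jumpGenerator, jumpGenerator, ← tsum_mul_left]
  exact tsum_congr fun z => mul_assoc _ _ _

theorem existsUnique_isScaledResolvent (hd : 0 < d) (hC₁ : 0 < C₁) (hC₂ : 0 < C₂)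
    (hw : ∀ e : Sym2 (Lattice d), ¬ e.IsDiag → C₁ ≤ w e ∧ w e ≤ C₂) {k : ℕ} (hk : 2 ≤ k)
    {lam : ℝ} (hlam : 0 < lam) {f : Space d → ℝ} (hf : Summable fun x => f (point k x) ^ 2) :
    ∃! u, IsScaledResolvent w k lam f u := by
  have H := (isJumpKernel_rate hd hC₁ hC₂ hw).const_mul (speed_pos hk).le
  have h := H.existsUnique_resolvent
    (fun x z => mul_nonneg (speed_pos hk).le (rate_nonneg hC₁ hw x z).2) hlam hf
  simpa only [IsScaledResolvent, scaledGenerator_eq hk, memℓp_two_iff, jumpGenerator_const_mul]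
    using h

/-- The Dirichlet form of the jump kernel `|z| ^ (-d - 2)`, without the factor one half. -/
def energy (h : Lattice d → ℝ) : ℝ :=
  ∑' p : Lattice d × Lattice d, kap p.2 * (h (p.1 + p.2) - h p.1) ^ 2

lemma energy_nonneg (h : Lattice d → ℝ) : 0 ≤ energy h :=
  tsum_nonneg fun _ => mul_nonneg (kap_nonneg _) (sq_nonneg _)

lemma isJumpKernel_kap (hd : 0 < d) : IsJumpKernel (kap (d := d)) fun _ z => kap z where
  summable := summable_kap hd
  bound _ z := (abs_of_nonneg (kap_nonneg z)).le
  symm _ z := kap_neg z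

/-- The difference `u - v` solves the resolvent equation with right-hand side the consistency error
of `v`. The lower bound `C₁` on the conductances turns the random form into the deterministic
`energy`, and linearity lets `v` be the restriction of a test function. -/
lemma IsScaledResolvent.energy_le (hd : 0 < d) (hC₁ : 0 < C₁) (hC₂ : 0 < C₂)
    (hw : ∀ e : Sym2 (Lattice d), ¬ e.IsDiag → C₁ ≤ w e ∧ w e ≤ C₂) {k : ℕ} (hk : 2 ≤ k)
    {lam : ℝ} {f : Space d → ℝ} {u v : Lattice d → ℝ}
    (hu : IsScaledResolvent w k lam f u) (hv : Summable fun x => v x ^ 2) :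
    lam * ell2 (fun x => u x - v x) ^ 2 + speed k * C₁ / 2 * energy (fun x => u x - v x) ≤
      ∑' x, (f (point k x) - lam * v x + speed k * jumpGenerator (rate w) v x) * (u x - v x) := by
  have H := (isJumpKernel_rate hd hC₁ hC₂ hw).const_mul (speed_pos hk).le
  have hu2 := memℓp_two_iff.1 hu.1
  have hh := summable_sq_sub hu2 hv
  rw [← H.energy_eq (lam := lam) hh, ell2_sq]
  · refine add_le_add le_rfl ?_
    have h1 := (isJumpKernel_kap hd).summable_diff_sq hh
    have h2 := H.summable_form hh hh
    simp only [← sq] at h2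
    have h3 : speed k * C₁ * energy (fun x => u x - v x) ≤
        ∑' p : Lattice d × Lattice d, speed k * rate w p.1 p.2 *
          ((u (p.1 + p.2) - v (p.1 + p.2)) - (u p.1 - v p.1)) ^ 2 := by
      rw [energy, ← tsum_mul_left]
      refine (h1.mul_left _).tsum_le_tsum (fun p => ?_) h2
      rw [← mul_assoc, mul_assoc (speed k)]
      gcongr
      · exact (speed_pos hk).le
      · exact (rate_nonneg hC₁ hw _ _).1
    linarith
  · intro x
    rw [← hu.2 x, scaledGenerator_eq hk, jumpGenerator_const_mul]
    have : jumpGenerator (rate w) (fun x => u x - v x) x =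
        jumpGenerator (rate w) u x - jumpGenerator (rate w) v x := by
      rw [jumpGenerator, jumpGenerator, jumpGenerator,
        ← ((isJumpKernel_rate hd hC₁ hC₂ hw).summable_generator hu2 x).tsum_sub
        ((isJumpKernel_rate hd hC₁ hC₂ hw).summable_generator hv x)]
      exact tsum_congr fun z => by ring
    rw [this]
    ring

end Bounds

/-! ### Supports and sizes of restrictions to the scaled lattice. -/

section Support

variable {g : Space d → ℝ}

lemma IsTest.exists_radius (hg : IsTest g) : ∃ B : ℕ, ∀ y, (B : ℝ) < ‖y‖ → g y = 0 := by
  obtain ⟨R, hR⟩ := hg.compact.isCompact.isBounded.subset_closedBall 0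
  obtain ⟨B, hB⟩ := exists_nat_ge R
  refine ⟨B, fun y hy => image_eq_zero_of_notMem_tsupport fun h => ?_⟩
  have := hR h
  rw [mem_closedBall_zero_iff] at this
  linarith

lemma pderiv_eq_zero {B : ℕ} (hB : ∀ y, (B : ℝ) < ‖y‖ → g y = 0) (i : Fin d) (y : Space d)
    (hy : (B : ℝ) < ‖y‖) : pderiv i g y = 0 := by
  have h : g =ᶠ[𝓝 y] fun _ => 0 := by
    filter_upwards [(isOpen_lt continuous_const continuous_norm).mem_nhds hy] with x hx
    exact hB x hx
  rw [pderiv, h.fderiv_eq]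
  simp

lemma eq_zero_of_notMem_box {B : ℕ} (hB : ∀ y, (B : ℝ) < ‖y‖ → g y = 0) {k : ℕ} (hk : 0 < k)
    {x : Lattice d} (hx : x ∉ box d (B * k)) : g (point k x) = 0 := by
  apply hB
  rw [mem_box] at hx
  push Not at hx
  obtain ⟨i, hi⟩ := hx
  have hk' : (0 : ℝ) < k := by exact_mod_cast hk
  rw [norm_point, lt_div_iff₀ hk']
  refine lt_of_lt_of_le ?_ (abs_le_nrm x i)
  exact_mod_cast hi

lemma summable_sq_point (hg : HasCompactSupport g) {k : ℕ} (hk : 0 < k) :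
    Summable fun x => g (point k x) ^ 2 := by
  obtain ⟨R, hR⟩ := hg.isCompact.isBounded.subset_closedBall 0
  obtain ⟨B, hB⟩ := exists_nat_ge R
  refine summable_sq_of_support (s := box d (B * k)) fun x hx => ?_
  refine eq_zero_of_notMem_box (g := g) (fun y hy => image_eq_zero_of_notMem_tsupport fun h => ?_) hk hx
  have := hR h
  rw [mem_closedBall_zero_iff] at this
  linarith

/-- The box that contains the support of a function of `x / k` with radius `B`, together with its
`2 ^ n` neighbourhood, where `2 ^ n ≤ k < 2 ^ (n + 1)`. -/
def bigBox (d B n : ℕ) : Finset (Lattice d) := box d (2 * (B + 1) * 2 ^ n)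

lemma box_subset_bigBox {B k n : ℕ} (hn : k < 2 ^ (n + 1)) :
    box d (B * k + 2 ^ n) ⊆ bigBox d B n := by
  intro x hx
  rw [bigBox, mem_box]
  rw [mem_box] at hx
  have : B * k + 2 ^ n ≤ 2 * (B + 1) * 2 ^ n := by
    have := Nat.mul_le_mul_left B hn.le
    rw [pow_succ] at this
    calc B * k + 2 ^ n ≤ B * (2 ^ n * 2) + 2 * 2 ^ n := by omega
      _ = _ := by ring
  exact fun i => (hx i).trans (by exact_mod_cast this)

lemma eq_zero_of_notMem_bigBox {B k n : ℕ} (hk : 0 < k) (hn : k < 2 ^ (n + 1))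
    (hB : ∀ y, (B : ℝ) < ‖y‖ → g y = 0) {x : Lattice d} (hx : x ∉ bigBox d B n) :
    g (point k x) = 0 := by
  refine eq_zero_of_notMem_box hB hk fun h => hx (box_subset_bigBox hn ?_)
  rw [mem_box] at h ⊢
  intro i
  have := h i
  push_cast at this ⊢
  have h2 : (0 : ℤ) < 2 ^ n := by positivity
  linarith

lemma eq_zero_of_add_notMem_bigBox {B k n : ℕ} (hk : 0 < k) (hn : k < 2 ^ (n + 1))
    (hB : ∀ y, (B : ℝ) < ‖y‖ → g y = 0) {x z : Lattice d} (hx : x ∉ bigBox d B n)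
    (hz : z ∈ box d (2 ^ n)) : g (point k (x + z)) = 0 := by
  refine eq_zero_of_notMem_box hB hk fun h => hx (box_subset_bigBox hn ?_)
  rw [mem_box] at h hz ⊢
  intro i
  have h1 := abs_le.1 (h i)
  have h2 := abs_le.1 (hz i)
  rw [Pi.add_apply] at h1
  push_cast at h1 h2 ⊢
  rw [abs_le]
  constructor <;> linarith [h1.1, h1.2, h2.1, h2.2]

/-- The normalisation `k ^ (d / 2)` of `ℓ²` norms at scale `k`. -/
def scaleFactor (d k : ℕ) : ℝ := √((k : ℝ) ^ d)

lemma scaleFactor_nonneg (d k : ℕ) : 0 ≤ scaleFactor d k := Real.sqrt_nonneg _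

lemma sqrt_card_bigBox_le {B k n : ℕ} (hn : 2 ^ n ≤ k) :
    √((bigBox d B n).card : ℝ) ≤ √((6 * (B + 1) : ℝ) ^ d) * scaleFactor d k := by
  rw [scaleFactor, ← Real.sqrt_mul (by positivity), ← mul_pow]
  apply Real.sqrt_le_sqrt
  rw [bigBox, card_box]
  have : 2 * (2 * (B + 1) * 2 ^ n) + 1 ≤ 6 * (B + 1) * k := by
    have := Nat.one_le_two_pow (n := n)
    nlinarith
  exact_mod_cast Nat.pow_le_pow_left this d

lemma sqrt_sum_sq_le_of_abs_le {ι : Type*} (s : Finset ι) {φ : ι → ℝ} {M : ℝ} (hM : 0 ≤ M)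
    (h : ∀ x ∈ s, |φ x| ≤ M) : √(∑ x ∈ s, φ x ^ 2) ≤ M * √(s.card : ℝ) := by
  calc √(∑ x ∈ s, φ x ^ 2) ≤ √(∑ _x ∈ s, M ^ 2) := by
        apply Real.sqrt_le_sqrt
        refine Finset.sum_le_sum fun x hx => ?_
        exact sq_le_sq' (by linarith [(abs_le.1 (h x hx)).1]) (abs_le.1 (h x hx)).2
    _ = _ := by
        rw [Finset.sum_const, nsmul_eq_mul, mul_comm, Real.sqrt_mul (sq_nonneg M), Real.sqrt_sq hM]

lemma ell2_point_le {B k n : ℕ} (hk : 0 < k) (hn : 2 ^ n ≤ k) (hn' : k < 2 ^ (n + 1))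
    (hB : ∀ y, (B : ℝ) < ‖y‖ → g y = 0) {M : ℝ} (hM : 0 ≤ M) (hg : ∀ y, |g y| ≤ M) :
    ell2 (fun x => g (point k x)) ≤ M * √((6 * (B + 1) : ℝ) ^ d) * scaleFactor d k := by
  rw [ell2_eq_of_support fun x hx => eq_zero_of_notMem_bigBox hk hn' hB hx, mul_assoc]
  refine (sqrt_sum_sq_le_of_abs_le _ hM fun x _ => hg _).trans ?_
  exact mul_le_mul_of_nonneg_left (sqrt_card_bigBox_le hn) hM

end Support

end Resolvents

/-! ### Multiscale estimate of a pairing by cube averages. -/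

section Multiscale

/-- The lattice points in the cube `[0, 2 ^ j) ^ d`. -/
def cube (d j : ℕ) : Finset (Lattice d) := Finset.Icc 0 fun _ => 2 ^ j - 1

lemma mem_cube {j : ℕ} {c : Lattice d} : c ∈ cube d j ↔ ∀ i, 0 ≤ c i ∧ c i < 2 ^ j := by
  simp [cube, Pi.le_def, forall_and]

lemma card_cube (d j : ℕ) : (cube d j).card = (2 ^ j) ^ d := by
  rw [cube, Pi.card_Icc]
  simp only [Int.card_Icc, Finset.prod_const, Finset.card_univ, Fintype.card_fin, Pi.zero_apply]
  congr 1
  simp only [sub_add_cancel, sub_zero]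
  exact_mod_cast Int.toNat_natCast (2 ^ j)

/-- The average over the cube of side `2 ^ j` with lower corner at the given point. -/
def cubeAvg (j : ℕ) (φ : Lattice d → ℝ) (x : Lattice d) : ℝ :=
  ((2 ^ j : ℝ) ^ d)⁻¹ * ∑ c ∈ cube d j, φ (x + c)

/-- The average over the cube of side `2 ^ j` with upper corner at the given point. -/
def cubeAvgAdj (j : ℕ) (V : Lattice d → ℝ) (x : Lattice d) : ℝ :=
  ((2 ^ j : ℝ) ^ d)⁻¹ * ∑ c ∈ cube d j, V (x - c)

lemma inv_card_mul_card_cube (d j : ℕ) : ((2 ^ j : ℝ) ^ d)⁻¹ * ((cube d j).card : ℝ) = 1 := by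
  rw [card_cube]
  push_cast
  exact inv_mul_cancel₀ (by positivity)

lemma cubeAvg_zero (φ : Lattice d → ℝ) : cubeAvg 0 φ = φ := by
  have : cube d 0 = {0} := by
    rw [cube]
    simp only [pow_zero, sub_self]
    exact Finset.Icc_self 0
  ext x
  simp [cubeAvg, this]

lemma cubeAvg_comm (i j : ℕ) (φ : Lattice d → ℝ) :
    cubeAvg i (cubeAvg j φ) = cubeAvg j (cubeAvg i φ) := by
  ext x
  simp only [cubeAvg, Finset.mul_sum]
  rw [Finset.sum_comm]
  refine Finset.sum_congr rfl fun c _ => Finset.sum_congr rfl fun c' _ => ?_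
  rw [add_right_comm]
  ring

lemma cubeAvg_sub (j : ℕ) (φ ψ : Lattice d → ℝ) :
    cubeAvg j (fun x => φ x - ψ x) = fun x => cubeAvg j φ x - cubeAvg j ψ x := by
  ext x
  simp only [cubeAvg, Finset.sum_sub_distrib, mul_sub]

lemma finite_support_shift {φ : Lattice d → ℝ} (hφ : φ.support.Finite) (c : Lattice d) :
    (Function.support fun x => φ (x + c)).Finite :=
  hφ.preimage (add_left_injective c).injOn

lemma finite_support_cubeAvg {φ : Lattice d → ℝ} (hφ : φ.support.Finite) (j : ℕ) :
    (cubeAvg j φ).support.Finite := by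
  refine Set.Finite.subset (Set.Finite.biUnion (cube d j).finite_toSet
    fun c _ => finite_support_shift hφ c) fun x hx => ?_
  by_contra h
  simp only [Set.mem_iUnion, Function.mem_support, not_exists, not_not] at h
  apply hx
  rw [cubeAvg, Finset.sum_eq_zero fun c hc => h c hc, mul_zero]

lemma summable_mul_of_finite_support (V : Lattice d → ℝ) {φ : Lattice d → ℝ}
    (hφ : φ.support.Finite) : Summable fun x => V x * φ x :=
  summable_of_hasFiniteSupport (hφ.subset fun x hx h => hx (by simp [h]))

lemma tsum_mul_cubeAvg (V : Lattice d → ℝ) {φ : Lattice d → ℝ} (hφ : φ.support.Finite) (j : ℕ) :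
    ∑' x, V x * cubeAvg j φ x = ∑' x, cubeAvgAdj j V x * φ x := by
  simp only [cubeAvg, cubeAvgAdj, Finset.mul_sum, Finset.sum_mul]
  rw [Summable.tsum_finsetSum fun c _ => ?_, Summable.tsum_finsetSum fun c _ => ?_]
  · refine Finset.sum_congr rfl fun c _ => ?_
    rw [← (Equiv.subRight c).tsum_eq]
    refine tsum_congr fun x => ?_
    simp only [Equiv.subRight_apply, sub_add_cancel]
    ring
  · exact summable_mul_of_finite_support _ hφ
  · refine (summable_mul_of_finite_support (fun x => V x * ((2 ^ j : ℝ) ^ d)⁻¹)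
      (finite_support_shift hφ c)).congr fun x => by ring

/-- The multiscale decomposition of a pairing, in terms of cube averages of one factor and of
fluctuations at the same scale of the other factor. -/
theorem tsum_mul_eq_multiscale (V : Lattice d → ℝ) {φ : Lattice d → ℝ} (hφ : φ.support.Finite)
    (n : ℕ) : ∑' x, V x * φ x =
      ∑ j ∈ Finset.range n, (∑' x, cubeAvgAdj j V x * (φ x - cubeAvg (j + 1) φ x) -
        ∑' x, cubeAvgAdj (j + 1) V x * (φ x - cubeAvg j φ x)) +
      ∑' x, cubeAvgAdj n V x * φ x := by
  have hsub : ∀ j, (Function.support fun x => φ x - cubeAvg j φ x).Finite := fun j =>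
    (hφ.union (finite_support_cubeAvg hφ j)).subset (Function.support_sub _ _)
  -- With `A_j` for averaging at scale `j`, the commutation of averages gives `A_j φ - A_{j+1} φ =
  -- A_j (φ - A_{j+1} φ) - A_{j+1} (φ - A_j φ)`. Moving the outer averages onto `V` leaves terms in
  -- which averages of `V` meet fluctuations of `φ` at comparable scales, and the sum over `j`
  -- telescopes.
  have step : ∀ j, ∑' x, cubeAvgAdj j V x * (φ x - cubeAvg (j + 1) φ x) -
      ∑' x, cubeAvgAdj (j + 1) V x * (φ x - cubeAvg j φ x) =
      ∑' x, V x * cubeAvg j φ x - ∑' x, V x * cubeAvg (j + 1) φ x := by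
    intro j
    rw [← tsum_mul_cubeAvg V (hsub (j + 1)), ← tsum_mul_cubeAvg V (hsub j),
      ← (summable_mul_of_finite_support V (finite_support_cubeAvg (hsub (j + 1)) j)).tsum_sub
        (summable_mul_of_finite_support V (finite_support_cubeAvg (hsub j) (j + 1))),
      ← (summable_mul_of_finite_support V (finite_support_cubeAvg hφ j)).tsum_sub
        (summable_mul_of_finite_support V (finite_support_cubeAvg hφ (j + 1)))]
    refine tsum_congr fun x => ?_
    have h1 := congrFun (cubeAvg_sub j φ (cubeAvg (j + 1) φ)) x
    have h2 := congrFun (cubeAvg_sub (j + 1) φ (cubeAvg j φ)) x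
    have h3 := congrFun (cubeAvg_comm j (j + 1) φ) x
    rw [h1, h2, h3]
    ring
  simp only [step]
  rw [Finset.sum_range_sub', ← tsum_mul_cubeAvg V hφ, cubeAvg_zero]
  ring

section Shift

variable {φ : Lattice d → ℝ} (hφ : Summable fun x => φ x ^ 2)

include hφ

lemma ell2_shift_sub_add_le (c c' : Lattice d) : ell2 (fun x => φ (x + (c + c')) - φ x) ≤
    ell2 (fun x => φ (x + c) - φ x) + ell2 fun x => φ (x + c') - φ x := by
  have h1 : Summable fun x => (φ (x + c) - φ x) ^ 2 :=
    summable_sq_sub (summable_sq_shift hφ c) hφ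
  have h2 : Summable fun x => (φ (x + c') - φ x) ^ 2 :=
    summable_sq_sub (summable_sq_shift hφ c') hφ
  rw [← ell2_shift (fun x => φ (x + c) - φ x) c']
  refine le_trans (le_of_eq ?_) (ell2_add_le (summable_sq_shift h1 c') h2)
  congr 1
  ext x
  rw [add_assoc, add_comm c' c]
  ring

variable {D : ℝ} (hD : ∀ i, ell2 (fun x => φ (x + Pi.single i 1) - φ x) ≤ D)

include hD

/-- A shift by `c` is a path of unit steps along the axes, each of which costs `D` by translation
invariance of the norm. -/
lemma ell2_shift_sub_le {c : Lattice d} (hc : ∀ i, 0 ≤ c i) :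
    ell2 (fun x => φ (x + c) - φ x) ≤ ∑ i, (c i : ℝ) * D := by
  have h0 : ell2 (fun x : Lattice d => φ (x + 0) - φ x) = 0 := by simp [ell2]
  have hm : ∀ (i : Fin d) (m : ℕ),
      ell2 (fun x => φ (x + m • Pi.single i 1) - φ x) ≤ m * D := by
    intro i m
    induction m with
    | zero => simpa using h0.le
    | succ m ih =>
      rw [succ_nsmul]
      push_cast
      linarith [ell2_shift_sub_add_le hφ (m • Pi.single i 1) (Pi.single i 1), hD i]
  have hs : ∀ s : Finset (Fin d),
      ell2 (fun x => φ (x + ∑ i ∈ s, (c i).toNat • Pi.single i 1) - φ x) ≤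
        ∑ i ∈ s, (c i : ℝ) * D := by
    intro s
    induction s using Finset.cons_induction with
    | empty => simpa using h0.le
    | cons i s his ih =>
      rw [Finset.sum_cons, Finset.sum_cons]
      have h1 := hm i (c i).toNat
      have h2 : ((c i).toNat : ℝ) = c i := by exact_mod_cast Int.toNat_of_nonneg (hc i)
      rw [h2] at h1
      exact (ell2_shift_sub_add_le hφ _ _).trans (add_le_add h1 ih)
  have e : ∑ i, (c i).toNat • Pi.single i 1 = c := by
    ext l
    simp [Finset.sum_apply, Pi.single_apply, hc l]
  have := hs Finset.univ
  rwa [e] at this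

/-- A discrete Poincaré inequality: by Cauchy-Schwarz the square of the averaged difference is at
most the average of the squared differences, and each shift in the cube costs at most `d * 2 ^ j *
D`. -/
lemma ell2_sub_cubeAvg_le (hD0 : 0 ≤ D) (j : ℕ) :
    ell2 (fun x => φ x - cubeAvg j φ x) ≤ d * 2 ^ j * D := by
  have hshift : ∀ c ∈ cube d j, ∑' x, (φ (x + c) - φ x) ^ 2 ≤ (d * 2 ^ j * D) ^ 2 := by
    intro c hc
    rw [mem_cube] at hc
    rw [← ell2_sq]
    refine pow_le_pow_left₀ (ell2_nonneg _) ((ell2_shift_sub_le hφ hD fun i => (hc i).1).trans ?_) 2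
    calc ∑ i, (c i : ℝ) * D ≤ ∑ _i : Fin d, 2 ^ j * D := by
          refine Finset.sum_le_sum fun i _ => ?_
          have : (c i : ℝ) ≤ 2 ^ j := by exact_mod_cast (hc i).2.le
          gcongr
      _ = _ := by simp [mul_assoc]
  have hsum : ∀ c, Summable fun x => (φ (x + c) - φ x) ^ 2 := fun c =>
    summable_sq_sub (summable_sq_shift hφ c) hφ
  have hS : Summable fun x => ∑ c ∈ cube d j, (φ (x + c) - φ x) ^ 2 :=
    summable_sum fun c _ => hsum c
  have hpt : ∀ x, (φ x - cubeAvg j φ x) ^ 2 ≤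
      ((2 ^ j : ℝ) ^ d)⁻¹ * ∑ c ∈ cube d j, (φ (x + c) - φ x) ^ 2 := by
    intro x
    have e : φ x - cubeAvg j φ x = -(((2 ^ j : ℝ) ^ d)⁻¹ * ∑ c ∈ cube d j, (φ (x + c) - φ x)) := by
      rw [Finset.sum_sub_distrib, Finset.sum_const, nsmul_eq_mul, mul_sub, ← mul_assoc,
        inv_card_mul_card_cube, one_mul, cubeAvg]
      ring
    rw [e, neg_sq, mul_pow]
    have h1 := sq_sum_le_card_mul_sum_sq (s := cube d j) (f := fun c => φ (x + c) - φ x)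
    calc _ ≤ (((2 ^ j : ℝ) ^ d)⁻¹) ^ 2 *
          (((cube d j).card : ℝ) * ∑ c ∈ cube d j, (φ (x + c) - φ x) ^ 2) :=
          mul_le_mul_of_nonneg_left h1 (by positivity)
      _ = (((2 ^ j : ℝ) ^ d)⁻¹ * ((cube d j).card : ℝ)) * (((2 ^ j : ℝ) ^ d)⁻¹ *
          ∑ c ∈ cube d j, (φ (x + c) - φ x) ^ 2) := by ring
      _ = _ := by rw [inv_card_mul_card_cube, one_mul]
  have hS' : Summable fun x => (φ x - cubeAvg j φ x) ^ 2 :=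
    .of_nonneg_of_le (fun _ => sq_nonneg _) hpt (hS.mul_left _)
  refine Real.sqrt_le_iff.2 ⟨by positivity, ?_⟩
  calc _ ≤ ∑' x, ((2 ^ j : ℝ) ^ d)⁻¹ * ∑ c ∈ cube d j, (φ (x + c) - φ x) ^ 2 :=
        hS'.tsum_le_tsum hpt (hS.mul_left _)
    _ = ((2 ^ j : ℝ) ^ d)⁻¹ * ∑ c ∈ cube d j, ∑' x, (φ (x + c) - φ x) ^ 2 := by
        rw [tsum_mul_left, Summable.tsum_finsetSum fun c _ => hsum c]
    _ ≤ ((2 ^ j : ℝ) ^ d)⁻¹ * ∑ c ∈ cube d j, (d * 2 ^ j * D) ^ 2 :=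
        mul_le_mul_of_nonneg_left (Finset.sum_le_sum hshift) (by positivity)
    _ = _ := by
        rw [Finset.sum_const, nsmul_eq_mul, ← mul_assoc, inv_card_mul_card_cube, one_mul]

end Shift

lemma abs_tsum_mul_le_of_support (V : Lattice d → ℝ) {ψ : Lattice d → ℝ} {Q : Finset (Lattice d)}
    (hψ : ∀ x ∉ Q, ψ x = 0) : |∑' x, V x * ψ x| ≤ √(∑ x ∈ Q, V x ^ 2) * ell2 ψ := by
  rw [tsum_eq_sum (s := Q) fun x hx => by rw [hψ x hx, mul_zero], ell2_eq_of_support hψ]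
  exact abs_sum_mul_le _ _ _

lemma sub_cubeAvg_eq_zero {φ : Lattice d → ℝ} {M j n : ℕ} (hφ : ∀ x ∉ box d M, φ x = 0)
    (hj : j ≤ n) {x : Lattice d} (hx : x ∉ box d (M + 2 ^ n)) : φ x - cubeAvg j φ x = 0 := by
  have h1 : φ x = 0 := by
    refine hφ x fun h => hx ?_
    rw [mem_box] at h ⊢
    intro i
    push_cast
    linarith [h i, show (0 : ℤ) < 2 ^ n by positivity]
  have h2 : ∀ c ∈ cube d j, φ (x + c) = 0 := by
    intro c hc
    refine hφ _ fun h => hx ?_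
    rw [mem_box] at h ⊢
    rw [mem_cube] at hc
    intro i
    have h3 := abs_le.1 (h i)
    have h4 := hc i
    have h5 : (2 : ℤ) ^ j ≤ 2 ^ n := pow_le_pow_right₀ (by norm_num) hj
    rw [Pi.add_apply] at h3
    push_cast
    rw [abs_le]
    constructor <;> linarith [h3.1, h3.2, h4.1, h4.2]
  rw [h1, cubeAvg, Finset.sum_eq_zero h2, mul_zero, sub_zero]

/-- The decay `Γ / 2 ^ j` of the averages of `V` cancels the growth `2 ^ j` of the fluctuations of
`φ`, so every scale contributes a multiple of `Γ * D`. The two terms at scale `j` carry the factors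
`2` and `1 / 2`, whose sum is bounded by `3`. -/
theorem abs_tsum_mul_le_multiscale (V : Lattice d → ℝ) {φ : Lattice d → ℝ} {M n : ℕ}
    (hφ : ∀ x ∉ box d M, φ x = 0) {Q : Finset (Lattice d)} (hQ : box d (M + 2 ^ n) ⊆ Q)
    {D Γ : ℝ} (hD0 : 0 ≤ D) (hΓ : 0 ≤ Γ)
    (hD : ∀ i, ell2 (fun x => φ (x + Pi.single i 1) - φ x) ≤ D)
    (hV : ∀ j ≤ n, √(∑ x ∈ Q, cubeAvgAdj j V x ^ 2) ≤ Γ / 2 ^ j) :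
    |∑' x, V x * φ x| ≤ Γ * (3 * d * n * D + ell2 φ / 2 ^ n) := by
  have hfin : φ.support.Finite :=
    (box d M).finite_toSet.subset fun x hx => by
      by_contra h
      exact hx (hφ x h)
  have hφ2 : Summable fun x => φ x ^ 2 := summable_sq_of_support hφ
  have key : ∀ i ≤ n, ∀ j ≤ n, |∑' x, cubeAvgAdj i V x * (φ x - cubeAvg j φ x)| ≤
      Γ / 2 ^ i * (d * 2 ^ j * D) := by
    intro i hi j hj
    refine (abs_tsum_mul_le_of_support _ fun x hx =>
      sub_cubeAvg_eq_zero hφ hj fun h => hx (hQ h)).trans ?_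
    exact mul_le_mul (hV i hi) (ell2_sub_cubeAvg_le hφ2 hD hD0 j) (ell2_nonneg _) (by positivity)
  have hlast : |∑' x, cubeAvgAdj n V x * φ x| ≤ Γ / 2 ^ n * ell2 φ := by
    refine (abs_tsum_mul_le_of_support (Q := Q) _ fun x hx => hφ x fun h => hx (hQ ?_)).trans ?_
    · rw [mem_box] at h ⊢
      intro i
      push_cast
      linarith [h i, show (0 : ℤ) < 2 ^ n by positivity]
    · exact mul_le_mul_of_nonneg_right (hV n le_rfl) (ell2_nonneg _)
  rw [tsum_mul_eq_multiscale V hfin n]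
  have hterm : ∀ j ∈ Finset.range n, |∑' x, cubeAvgAdj j V x * (φ x - cubeAvg (j + 1) φ x) -
      ∑' x, cubeAvgAdj (j + 1) V x * (φ x - cubeAvg j φ x)| ≤ 3 * d * Γ * D := by
    intro j hj
    have hj' := Finset.mem_range.1 hj
    have h1 := key j hj'.le (j + 1) hj'
    have h2 := key (j + 1) hj' j hj'.le
    have e1 : Γ / 2 ^ j * (d * 2 ^ (j + 1) * D) = 2 * (d * Γ * D) := by
      rw [pow_succ]
      field_simp
    have e2 : Γ / 2 ^ (j + 1) * (d * 2 ^ j * D) = 1 / 2 * (d * Γ * D) := by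
      rw [pow_succ]
      field_simp
    rw [e1] at h1
    rw [e2] at h2
    have h3 : 0 ≤ d * Γ * D := by positivity
    refine (abs_sub _ _).trans ?_
    linarith
  calc _ ≤ _ := abs_add_le _ _
    _ ≤ ∑ j ∈ Finset.range n, 3 * d * Γ * D + Γ / 2 ^ n * ell2 φ :=
        add_le_add ((Finset.abs_sum_le_sum_abs _ _).trans (Finset.sum_le_sum hterm)) hlast
    _ = _ := by
        rw [Finset.sum_const, Finset.card_range, nsmul_eq_mul]
        ring

end Multiscale

/-! ### Taylor expansion of finite range generators and consistency of the mean generator. -/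

section Expansion

section Moments

/-- The weighted first moment of a set of jumps. -/
def moment (θ : Lattice d → ℝ) (s : Finset (Lattice d)) (i : Fin d) : ℝ :=
  ∑ z ∈ s, θ z * kap z * (z i : ℝ)

/-- The weighted second moment of a set of jumps. -/
def moment₂ (θ : Lattice d → ℝ) (s : Finset (Lattice d)) (i j : Fin d) : ℝ :=
  ∑ z ∈ s, θ z * kap z * ((z i : ℝ) * z j)

lemma point_apply (k : ℕ) (z : Lattice d) (i : Fin d) : point k z i = (z i : ℝ) / k := rfl

/-- Second order expansion of a finite range generator. -/
lemma abs_generator_sub_moments_le {g : Space d → ℝ} {C K : ℝ} (hK : 0 ≤ K)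
    (hC : ∀ x v, |g (x + v) - g x - ∑ i, v i * pderiv i g x -
      1 / 2 * ∑ i, ∑ j, v i * v j * pderiv j (pderiv i g) x| ≤ C * ‖v‖ ^ 3)
    (k : ℕ) {θ : Lattice d → ℝ} {s : Finset (Lattice d)} (hθ : ∀ z ∈ s, |θ z| ≤ K)
    (x : Lattice d) :
    |∑ z ∈ s, θ z * kap z * (g (point k (x + z)) - g (point k x)) -
      1 / k * ∑ i, moment θ s i * pderiv i g (point k x) -
      1 / (2 * k ^ 2) * ∑ i, ∑ j, moment₂ θ s i j * pderiv j (pderiv i g) (point k x)| ≤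
      K * C / k ^ 3 * ∑ z ∈ s, kap z * nrm z ^ 3 := by
  have e : ∑ z ∈ s, θ z * kap z * (g (point k (x + z)) - g (point k x)) -
      1 / k * ∑ i, moment θ s i * pderiv i g (point k x) -
      1 / (2 * k ^ 2) * ∑ i, ∑ j, moment₂ θ s i j * pderiv j (pderiv i g) (point k x) =
      ∑ z ∈ s, θ z * kap z * (g (point k x + point k z) - g (point k x) -
        ∑ i, point k z i * pderiv i g (point k x) -
        1 / 2 * ∑ i, ∑ j, point k z i * point k z j * pderiv j (pderiv i g) (point k x)) := by
    simp only [moment, moment₂, Finset.mul_sum, Finset.sum_mul, mul_sub, Finset.sum_sub_distrib,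
      point_add]
    congr 1
    · congr 1
      rw [Finset.sum_comm]
      refine Finset.sum_congr rfl fun z _ => Finset.sum_congr rfl fun i _ => ?_
      rw [point_apply]
      ring
    · conv_rhs => rw [Finset.sum_comm]
      refine Finset.sum_congr rfl fun i _ => ?_
      rw [Finset.sum_comm]
      refine Finset.sum_congr rfl fun z _ => Finset.sum_congr rfl fun j _ => ?_
      rw [point_apply, point_apply]
      ring
  rw [e, Finset.mul_sum]
  refine (Finset.abs_sum_le_sum_abs _ _).trans (Finset.sum_le_sum fun z hz => ?_)
  have h1 := hC (point k x) (point k z)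
  rw [norm_point] at h1
  rw [abs_mul, abs_mul, abs_of_nonneg (kap_nonneg z)]
  calc _ ≤ K * kap z * (C * (nrm z / k) ^ 3) :=
        mul_le_mul (mul_le_mul_of_nonneg_right (hθ z hz) (kap_nonneg z)) h1 (abs_nonneg _)
          (mul_nonneg hK (kap_nonneg z))
    _ = _ := by ring

lemma moment_one_shell (r R : ℕ) (i : Fin d) : moment (fun _ => 1) (shell d r R) i = 0 := by
  rw [moment, ← sum_shell_radial_mul_coord (fun t => (t ^ (d + 2))⁻¹) i]
  exact Finset.sum_congr rfl fun z _ => by rw [kap, one_mul]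

lemma moment₂_one_shell_of_ne (r R : ℕ) {i j : Fin d} (hij : i ≠ j) :
    moment₂ (fun _ => 1) (shell d r R) i j = 0 := by
  rw [moment₂, ← sum_shell_radial_mul_coord_mul_coord (fun t => (t ^ (d + 2))⁻¹) hij]
  exact Finset.sum_congr rfl fun z _ => by rw [kap, one_mul]

lemma moment₂_one_shell_self (r R : ℕ) (i : Fin d) :
    d * moment₂ (fun _ => 1) (shell d r R) i i = ∑ z ∈ shell d r R, (nrm z ^ d)⁻¹ := by
  have h := sum_shell_radial_mul_coord_sq (r := r) (R := R) (fun t => (t ^ (d + 2))⁻¹) i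
  have h1 : ∑ z ∈ shell d r R, (nrm z ^ (d + 2))⁻¹ * nrm z ^ 2 =
      ∑ z ∈ shell d r R, (nrm z ^ d)⁻¹ :=
    Finset.sum_congr rfl fun z hz => kap_mul_nrm_sq (ne_zero_of_mem_shell hz)
  rw [h1] at h
  rw [← h, moment₂]
  congr 1
  exact Finset.sum_congr rfl fun z _ => by rw [kap, one_mul, sq]

end Moments

/-- `2 ^ n` is the largest power of two that is at most `k`, and `k` is at least two. -/
structure IsLogScale (k n : ℕ) : Prop where
  two_le : 2 ≤ k
  le : 2 ^ n ≤ k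
  lt : k < 2 ^ (n + 1)

namespace IsLogScale

variable {k n : ℕ} (hs : IsLogScale k n)

include hs

lemma pos : 0 < k := by have := hs.two_le; omega

lemma cast_pos : (0 : ℝ) < k := by exact_mod_cast hs.pos

lemma cast_le : (2 : ℝ) ^ n ≤ k := by exact_mod_cast hs.le

lemma cast_le' : (k : ℝ) ≤ 2 * 2 ^ n := by
  have := hs.lt.le
  rw [pow_succ] at this
  exact_mod_cast this.trans (by omega)

lemma log_pos : 0 < Real.log k := log_pos_of_two_le hs.two_le

lemma log_two_le : Real.log 2 ≤ Real.log k :=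
  Real.log_le_log two_pos (by exact_mod_cast hs.two_le)

lemma mul_log_two_le : n * Real.log 2 ≤ Real.log k := by
  rw [← Real.log_pow]
  exact Real.log_le_log (by positivity) hs.cast_le

lemma log_le : Real.log k ≤ n * Real.log 2 + Real.log 2 := by
  have := Real.log_le_log hs.cast_pos hs.cast_le'
  rw [Real.log_mul two_ne_zero (by positivity), Real.log_pow] at this
  linarith

end IsLogScale

lemma speed_div_sq {k : ℕ} (hk : 2 ≤ k) : speed k * (1 / (2 * (k : ℝ) ^ 2)) = 1 / (2 * Real.log k) := by
  have := log_pos_of_two_le hk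
  have : (0 : ℝ) < k := by exact_mod_cast (by omega : 0 < k)
  unfold speed
  field_simp

lemma speed_div_self {k : ℕ} (hk : 2 ≤ k) : speed k * (1 / (k : ℝ)) = k / Real.log k := by
  have := log_pos_of_two_le hk
  have : (0 : ℝ) < k := by exact_mod_cast (by omega : 0 < k)
  unfold speed
  field_simp

lemma IsTest.exists_laplacian_le {g : Space d → ℝ} (hg : IsTest g) :
    ∃ C : ℝ, 0 < C ∧ ∀ x, |Laplacian.laplacian g x| ≤ C := by
  choose C hC hC' using fun i => ((hg.pderiv i).pderiv i).exists_abs_le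
  refine ⟨∑ i, C i + 1, ?_, fun x => ?_⟩
  · have := Finset.sum_nonneg fun i (_ : i ∈ Finset.univ) => (hC i).le
    positivity
  · rw [hg.laplacian_eq]
    have := (Finset.abs_sum_le_sum_abs (fun i => CriticalWalk.pderiv i (CriticalWalk.pderiv i g) x)
      Finset.univ).trans (Finset.sum_le_sum fun i _ => hC' i x)
    linarith

/-- Consistency of the mean generator with jumps up to `2 ^ n`. -/
theorem exists_consistency (hd : 0 < d) {g : Space d → ℝ} (hg : IsTest g) :
    ∃ C : ℝ, 0 < C ∧ ∀ k n : ℕ, IsLogScale k n → ∀ x : Lattice d,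
      |speed k * ∑ z ∈ shell d 0 (2 ^ n), kap z * (g (point k (x + z)) - g (point k x)) -
        limitCoefficient d * Laplacian.laplacian g (point k x)| ≤ C / Real.log k := by
  obtain ⟨C₃, hC₃, h3⟩ := hg.exists_taylor_three
  obtain ⟨C₁, hC₁, h1⟩ := exists_sum_kap_mul_nrm_cube_le hd
  obtain ⟨C₂, hC₂, h2⟩ := exists_shell_sum_sub_log_le hd
  obtain ⟨C₄, hC₄, h4⟩ := hg.exists_laplacian_le
  have ha := limitCoefficient_pos d
  set a := limitCoefficient d
  have hl2 : 0 < Real.log 2 := Real.log_pos one_lt_two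
  have hd' : (0 : ℝ) < d := by exact_mod_cast hd
  refine ⟨C₃ * C₁ + (C₂ + 2 * d * a * Real.log 2) / (2 * d) * C₄, by positivity,
    fun k n hs x => ?_⟩
  have hk := hs.cast_pos
  have hl := hs.log_pos
  set S := ∑ z ∈ shell d 0 (2 ^ n), (nrm z ^ d)⁻¹ with hS
  set L := Laplacian.laplacian g (point k x) with hL
  have hT := abs_generator_sub_moments_le zero_le_one h3 k (θ := fun _ => 1)
    (s := shell d 0 (2 ^ n)) (fun z _ => by simp) x
  -- The matrix of second moments is `S / d` times the identity, which produces the Laplacian.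
  have hm2 : ∀ i, ∑ j, moment₂ (fun _ => 1) (shell d 0 (2 ^ n)) i j *
      pderiv j (pderiv i g) (point k x) = S / d * pderiv i (pderiv i g) (point k x) := by
    intro i
    rw [Finset.sum_eq_single i]
    · congr 1
      rw [eq_div_iff hd'.ne', mul_comm]
      exact moment₂_one_shell_self _ _ i
    · intro j _ hj
      rw [moment₂_one_shell_of_ne _ _ hj.symm, zero_mul]
    · simp
  simp only [moment_one_shell, zero_mul, Finset.sum_const_zero, mul_zero, sub_zero, hm2,
    ← Finset.mul_sum, ← hg.laplacian_eq, one_mul] at hT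
  rw [← hL] at hT
  set A := ∑ z ∈ shell d 0 (2 ^ n), kap z * (g (point k (x + z)) - g (point k x))
  have hE : |speed k * A - S / (2 * d * Real.log k) * L| ≤ C₃ * C₁ / Real.log k := by
    have e : speed k * A - S / (2 * d * Real.log k) * L =
        speed k * (A - 1 / (2 * k ^ 2) * (S / d * L)) := by
      rw [mul_sub, ← mul_assoc (speed k), speed_div_sq hs.two_le]
      field_simp
    rw [e, abs_mul, abs_of_pos (speed_pos hs.two_le)]
    calc _ ≤ speed k * (C₃ / k ^ 3 * (C₁ * 2 ^ n)) := by
          refine mul_le_mul_of_nonneg_left (hT.trans ?_) (speed_pos hs.two_le).le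
          exact mul_le_mul_of_nonneg_left (h1 n) (by positivity)
      _ ≤ speed k * (C₃ / k ^ 3 * (C₁ * k)) := by
          have := (speed_pos hs.two_le).le
          have := hs.cast_le
          gcongr
      _ = _ := by
          unfold speed
          field_simp
  -- The sum has radius `2^n` rather than `k`; since `log k` and `n log 2` differ by at most `log
  -- 2`, this only changes the numerator by a constant.
  have hF : |S / (2 * d * Real.log k) - a| ≤
      (C₂ + 2 * d * a * Real.log 2) / (2 * d) / Real.log k := by
    have e : S / (2 * d * Real.log k) - a = (S - 2 * d * a * Real.log k) / (2 * d) / Real.log k := by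
      field_simp
    rw [e, abs_div, abs_div, abs_of_pos hl, abs_of_pos (show (0 : ℝ) < 2 * d by positivity)]
    gcongr
    have h5 := h2 (2 ^ n) Nat.one_le_two_pow
    push_cast at h5
    rw [Real.log_pow] at h5
    have h6 := hs.log_le
    have h7 := hs.mul_log_two_le
    have h8 : 0 < 2 * d * a := by positivity
    obtain ⟨h9, h10⟩ := abs_le.1 h5
    rw [abs_le]
    constructor <;> nlinarith
  calc |speed k * A - a * L| = |(speed k * A - S / (2 * d * Real.log k) * L) +
        (S / (2 * d * Real.log k) - a) * L| := by ring_nf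
    _ ≤ _ := abs_add_le _ _
    _ ≤ C₃ * C₁ / Real.log k + (C₂ + 2 * d * a * Real.log 2) / (2 * d) / Real.log k * C₄ := by
        rw [abs_mul]
        exact add_le_add hE (mul_le_mul hF (h4 _) (abs_nonneg _) (by positivity))
    _ = _ := by ring

end Expansion

/-! ### Short and long jumps. -/

section Ranges

open Classical in
/-- The part of the jump kernel with jumps in a shell. -/
def shellKap (d r R : ℕ) (z : Lattice d) : ℝ := if z ∈ shell d r R then kap z else 0

lemma shellKap_nonneg (r R : ℕ) (z : Lattice d) : 0 ≤ shellKap d r R z := by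
  unfold shellKap
  split_ifs
  · exact kap_nonneg z
  · exact le_rfl

lemma shellKap_le (r R : ℕ) (z : Lattice d) : shellKap d r R z ≤ kap z := by
  unfold shellKap
  split_ifs
  · exact le_rfl
  · exact kap_nonneg z

lemma abs_shellKap_le (r R : ℕ) (z : Lattice d) : |shellKap d r R z| ≤ kap z := by
  rw [abs_of_nonneg (shellKap_nonneg r R z)]
  exact shellKap_le r R z

lemma shellKap_zero (r R : ℕ) : shellKap d r R 0 = 0 :=
  if_neg fun h => ne_zero_of_mem_shell h rfl

lemma shellKap_neg (r R : ℕ) (z : Lattice d) : shellKap d r R (-z) = shellKap d r R z := by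
  unfold shellKap
  simp only [neg_mem_shell, kap_neg]

lemma jumpGenerator_shellKap (a : Lattice d → Lattice d → ℝ) (r R : ℕ) (v : Lattice d → ℝ)
    (x : Lattice d) : jumpGenerator (fun x z => a x z * shellKap d r R z) v x =
      ∑ z ∈ shell d r R, a x z * kap z * (v (x + z) - v x) := by
  rw [jumpGenerator, tsum_eq_sum (s := shell d r R)]
  · refine Finset.sum_congr rfl fun z hz => ?_
    rw [shellKap, if_pos hz]
  · intro z hz
    rw [shellKap, if_neg hz, mul_zero, zero_mul]

/-- The difference vanishes unless `x` or `x + z` lies in `Q`, which explains the factor `2`. -/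
lemma tsum_shift_sub_sq_le {v : Lattice d → ℝ} {Q : Finset (Lattice d)} (hv : ∀ x ∉ Q, v x = 0)
    {z : Lattice d} {M : ℝ} (hM : ∀ x, |v (x + z) - v x| ≤ M) :
    ∑' x, (v (x + z) - v x) ^ 2 ≤ 2 * Q.card * M ^ 2 := by
  classical
  have hs : Summable fun x => if x ∈ Q then M ^ 2 else 0 :=
    summable_of_ne_finset_zero (s := Q) fun x hx => if_neg hx
  have e1 : ∑' x, (if x ∈ Q then M ^ 2 else 0) = Q.card * M ^ 2 := by
    rw [tsum_eq_sum (s := Q) fun x hx => if_neg hx, Finset.sum_congr rfl fun x hx => if_pos hx,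
      Finset.sum_const, nsmul_eq_mul]
  have hs2 : Summable fun x => if x + z ∈ Q then M ^ 2 else 0 :=
    ((Equiv.addRight z).summable_iff (f := fun x => if x ∈ Q then M ^ 2 else 0)).2 hs
  have e2 : ∑' x, (if x + z ∈ Q then M ^ 2 else 0) = Q.card * M ^ 2 := by
    rw [← e1]
    exact (Equiv.addRight z).tsum_eq fun x => if x ∈ Q then M ^ 2 else 0
  have hv2 : Summable fun x => v x ^ 2 := summable_sq_of_support hv
  calc _ ≤ ∑' x, ((if x ∈ Q then M ^ 2 else 0) + if x + z ∈ Q then M ^ 2 else 0) := by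
        refine (summable_sq_sub (summable_sq_shift hv2 z) hv2).tsum_le_tsum (fun x => ?_)
          (hs.add hs2)
        have h1 : (v (x + z) - v x) ^ 2 ≤ M ^ 2 :=
          sq_le_sq' (by linarith [(abs_le.1 (hM x)).1]) (abs_le.1 (hM x)).2
        by_cases h : x ∈ Q
        · rw [if_pos h]
          have : (0 : ℝ) ≤ if x + z ∈ Q then M ^ 2 else 0 := by split_ifs <;> positivity
          linarith
        · by_cases h' : x + z ∈ Q
          · rw [if_neg h, if_pos h', zero_add]
            exact h1
          · rw [if_neg h, if_neg h', hv _ h, hv _ h']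
            simp
    _ = _ := by
        rw [hs.tsum_add hs2, e1, e2]
        ring

lemma tsum_shellKap_mul_diff_sq_le (hd : 0 < d) {v : Lattice d → ℝ} {Q : Finset (Lattice d)}
    (hv : ∀ x ∉ Q, v x = 0) {M : ℝ} (hM : ∀ x z, |v (x + z) - v x| ≤ M * nrm z) (r R : ℕ) :
    ∑' p : Lattice d × Lattice d, shellKap d r R p.2 * (v (p.1 + p.2) - v p.1) ^ 2 ≤
      2 * Q.card * M ^ 2 * ∑ z ∈ shell d r R, (nrm z ^ d)⁻¹ := by
  have hv2 : Summable fun x => v x ^ 2 := summable_sq_of_support hv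
  have hS : Summable fun p : Lattice d × Lattice d =>
      shellKap d r R p.2 * (v (p.1 + p.2) - v p.1) ^ 2 := by
    refine .of_nonneg_of_le (fun p => mul_nonneg (shellKap_nonneg _ _ _) (sq_nonneg _)) (fun p => ?_)
      ((isJumpKernel_kap hd).summable_diff_sq hv2)
    exact mul_le_mul_of_nonneg_right (shellKap_le _ _ _) (sq_nonneg _)
  rw [← (Equiv.prodComm _ _).tsum_eq]
  have hS' := (Equiv.prodComm (Lattice d) (Lattice d)).summable_iff.2 hS
  refine (hS'.tsum_prod).trans_le ?_
  simp only [Function.comp, Equiv.prodComm_apply, Prod.fst_swap, Prod.snd_swap]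
  rw [tsum_eq_sum (s := shell d r R), Finset.mul_sum]
  · refine Finset.sum_le_sum fun z hz => ?_
    rw [tsum_mul_left, shellKap, if_pos hz]
    calc _ ≤ kap z * (2 * Q.card * (M * nrm z) ^ 2) :=
          mul_le_mul_of_nonneg_left (tsum_shift_sub_sq_le hv fun x => hM x z) (kap_nonneg z)
      _ = 2 * Q.card * M ^ 2 * (kap z * nrm z ^ 2) := by ring
      _ = _ := by rw [kap_mul_nrm_sq (ne_zero_of_mem_shell hz)]
  · intro z hz
    simp only [shellKap, if_neg hz, zero_mul, tsum_zero]

/-- Short range fluctuations are controlled by the energy, by symmetrisation. -/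
lemma abs_tsum_jumpGenerator_shellKap_le (hd : 0 < d) {v h : Lattice d → ℝ}
    {Q : Finset (Lattice d)} (hv : ∀ x ∉ Q, v x = 0) (hh : Summable fun x => h x ^ 2) {M : ℝ}
    (hM0 : 0 ≤ M) (hM : ∀ x z, |v (x + z) - v x| ≤ M * nrm z) {a : Sym2 (Lattice d) → ℝ} {K : ℝ}
    (hK : 0 ≤ K) (ha : ∀ e : Sym2 (Lattice d), ¬ e.IsDiag → |a e| ≤ K) (r R : ℕ) :
    |∑' x, jumpGenerator (fun x z => a s(x, x + z) * shellKap d r R z) v x * h x| ≤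
      K * M * √(Q.card : ℝ) * √(∑ z ∈ shell d r R, (nrm z ^ d)⁻¹) * √(energy h) := by
  have hv2 : Summable fun x => v x ^ 2 := summable_sq_of_support hv
  have H := isJumpKernel_weight (summable_kap hd) (abs_shellKap_le r R) (shellKap_zero r R)
    (shellKap_neg r R) hK ha
  set F : Lattice d × Lattice d → ℝ := fun p => √(shellKap d r R p.2) * |v (p.1 + p.2) - v p.1|
  set E : Lattice d × Lattice d → ℝ := fun p => √(kap p.2) * |h (p.1 + p.2) - h p.1|
  have hF : ∀ p, F p ^ 2 = shellKap d r R p.2 * (v (p.1 + p.2) - v p.1) ^ 2 := fun p => by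
    rw [mul_pow, Real.sq_sqrt (shellKap_nonneg _ _ _), sq_abs]
  have hE : ∀ p, E p ^ 2 = kap p.2 * (h (p.1 + p.2) - h p.1) ^ 2 := fun p => by
    rw [mul_pow, Real.sq_sqrt (kap_nonneg _), sq_abs]
  have sE : Summable fun p => E p ^ 2 := by
    simp only [hE]
    exact (isJumpKernel_kap hd).summable_diff_sq hh
  have sF : Summable fun p => F p ^ 2 := by
    simp only [hF]
    refine .of_nonneg_of_le (fun p => mul_nonneg (shellKap_nonneg _ _ _) (sq_nonneg _)) (fun p => ?_)
      ((isJumpKernel_kap hd).summable_diff_sq hv2)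
    exact mul_le_mul_of_nonneg_right (shellKap_le _ _ _) (sq_nonneg _)
  have nE : ell2 E = √(energy h) := by
    rw [ell2, energy]
    simp only [hE]
  have nF : ell2 F ≤ √2 * (M * √(Q.card : ℝ) * √(∑ z ∈ shell d r R, (nrm z ^ d)⁻¹)) := by
    rw [ell2]
    simp only [hF]
    refine (Real.sqrt_le_sqrt (tsum_shellKap_mul_diff_sq_le hd hv hM r R)).trans (le_of_eq ?_)
    rw [Real.sqrt_mul (by positivity), Real.sqrt_mul (by positivity), Real.sqrt_mul (by positivity),
      Real.sqrt_sq hM0]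
    ring
  rw [H.tsum_jumpGenerator_mul hv2 hh, abs_mul]
  have hb : |∑' p : Lattice d × Lattice d, a s(p.1, p.1 + p.2) * shellKap d r R p.2 *
      ((v (p.1 + p.2) - v p.1) * (h (p.1 + p.2) - h p.1))| ≤ ∑' p, K * (F p * E p) := by
    rw [← Real.norm_eq_abs]
    refine tsum_of_norm_bounded ((summable_mul_of_sq sF sE).mul_left K).hasSum fun p => ?_
    rw [Real.norm_eq_abs, abs_mul, abs_mul, abs_mul, abs_of_nonneg (shellKap_nonneg _ _ _)]
    by_cases hp : p.2 = 0
    · rw [hp, shellKap_zero, mul_zero, zero_mul]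
      exact mul_nonneg hK (mul_nonneg (by positivity) (by positivity))
    -- The truncated kernel is divided asymmetrically: the factor with `v` keeps the truncation, so
    -- that only the mass of the shell enters, and the factor with `h` is enlarged to the full
    -- energy.
    · have h1 : shellKap d r R p.2 ≤ √(shellKap d r R p.2) * √(kap p.2) := by
        nth_rewrite 1 [← Real.mul_self_sqrt (shellKap_nonneg r R p.2)]
        gcongr
        exact shellKap_le _ _ _
      calc _ ≤ K * (√(shellKap d r R p.2) * √(kap p.2)) *
            (|v (p.1 + p.2) - v p.1| * |h (p.1 + p.2) - h p.1|) := by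
            refine mul_le_mul_of_nonneg_right ?_ (by positivity)
            exact mul_le_mul (ha _ (not_isDiag_add hp)) h1 (shellKap_nonneg _ _ _) hK
        _ = _ := by ring
  rw [tsum_mul_left] at hb
  have hc := (le_abs_self _).trans (abs_tsum_mul_le sF sE)
  have h2 : √2 ≤ 2 := Real.sqrt_le_sqrt (show (2 : ℝ) ≤ 4 by norm_num) |>.trans
    (by rw [show (4 : ℝ) = 2 ^ 2 by norm_num, Real.sqrt_sq two_pos.le])
  set T := M * √(Q.card : ℝ) * √(∑ z ∈ shell d r R, (nrm z ^ d)⁻¹) with hT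
  have hT0 : 0 ≤ T := by positivity
  calc _ ≤ 1 / 2 * (K * (√2 * T * √(energy h))) := by
        refine mul_le_mul (by norm_num) ?_ (abs_nonneg _) (by norm_num)
        refine hb.trans (mul_le_mul_of_nonneg_left (hc.trans ?_) hK)
        rw [nE]
        exact mul_le_mul_of_nonneg_right nF (Real.sqrt_nonneg _)
    _ ≤ 1 / 2 * (K * (2 * T * √(energy h))) := by gcongr
    _ = _ := by
        rw [hT]
        ring

/-- Long range jumps. -/
theorem exists_far_le (hd : 0 < d) {g : Space d → ℝ} (hg : IsTest g) {K : ℝ} (hK : 0 ≤ K) :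
    ∃ C : ℝ, 0 < C ∧ ∀ k n : ℕ, IsLogScale k n → ∀ a : Sym2 (Lattice d) → ℝ,
      (∀ e : Sym2 (Lattice d), ¬ e.IsDiag → |a e| ≤ K) →
      ∀ h : Lattice d → ℝ, (Summable fun x => h x ^ 2) →
      IsJumpKernel (fun z => K * tailKap d n z) (fun x z => a s(x, x + z) * tailKap d n z) ∧
      speed k * |∑' x, jumpGenerator (fun x z => a s(x, x + z) * tailKap d n z)
        (fun x => g (point k x)) x * h x| ≤ C / Real.log k * scaleFactor d k * ell2 h := by
  obtain ⟨C₁, hC₁, h1⟩ := exists_tsum_tailKap_le hd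
  obtain ⟨M, hM, hgM⟩ := hg.exists_abs_le
  obtain ⟨B, hB⟩ := hg.exists_radius
  -- The far part is bounded by its operator norm, with `8 = 2 * 4`: a factor `2` from that norm and
  -- `4` from `4^(-n) ≤ 4 / k^2`. The summand `1` keeps the constant positive when `K = 0`.
  refine ⟨8 * K * C₁ * M * √((6 * (B + 1) : ℝ) ^ d) + 1, by positivity,
    fun k n hs a ha h hh => ?_⟩
  have hk := hs.cast_pos
  have hl := hs.log_pos
  have ht0 : ∀ z, 0 ≤ tailKap d n z := fun z => by
    unfold tailKap
    split_ifs
    · exact kap_nonneg z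
    · exact le_rfl
  have H := isJumpKernel_weight (ρ := tailKap d n) (h1 n).1
    (fun z => (abs_of_nonneg (ht0 z)).le) (by simp [tailKap]) (fun z => by simp [tailKap]) hK ha
  refine ⟨H, ?_⟩
  have hv := summable_sq_point hg.compact hs.pos
  have hJ := abs_tsum_mul_le (H.summable_jumpGenerator_sq hv) hh
  have hJ2 := H.ell2_jumpGenerator_le hv
  rw [tsum_mul_left] at hJ2
  have hv3 := ell2_point_le hs.pos hs.le hs.lt hB hM.le hgM
  have h4 : ((4 : ℝ) ^ n)⁻¹ ≤ 4 / k ^ 2 := by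
    have h5 := hs.cast_le'
    have h6 : (k : ℝ) ^ 2 ≤ 4 * 4 ^ n := by
      calc (k : ℝ) ^ 2 ≤ (2 * 2 ^ n) ^ 2 := by gcongr
        _ = _ := by rw [mul_pow, ← pow_mul, mul_comm n, pow_mul]; norm_num
    rw [inv_le_iff_one_le_mul₀ (by positivity), div_mul_eq_mul_div, le_div_iff₀ (by positivity)]
    linarith
  have h7 := (h1 n).2.trans (mul_le_mul_of_nonneg_left h4 hC₁.le)
  set X := scaleFactor d k
  have hX := scaleFactor_nonneg d k
  have hH := ell2_nonneg h
  have htn : 0 ≤ ∑' z, tailKap d n z := tsum_nonneg ht0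
  calc _ ≤ speed k * (2 * (K * (C₁ * (4 / k ^ 2))) * (M * √((6 * (B + 1) : ℝ) ^ d) * X) * ell2 h) := by
        refine mul_le_mul_of_nonneg_left (hJ.trans ?_) (speed_pos hs.two_le).le
        refine mul_le_mul_of_nonneg_right (hJ2.trans ?_) hH
        refine mul_le_mul ?_ hv3 (ell2_nonneg _) (by positivity)
        gcongr
    _ = 8 * K * C₁ * M * √((6 * (B + 1) : ℝ) ^ d) / Real.log k * X * ell2 h := by
        unfold speed
        field_simp
        ring
    _ ≤ _ := by
        gcongr
        linarith

end Ranges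

/-! ### Fluctuations at short range, and the first moment at intermediate range. -/

section Fluctuations

/-- The square root of the energy at scale `k`. -/
def energyNorm (k : ℕ) (h : Lattice d → ℝ) : ℝ := √(speed k * energy h)

lemma energyNorm_nonneg (k : ℕ) (h : Lattice d → ℝ) : 0 ≤ energyNorm k h := Real.sqrt_nonneg _

lemma energyNorm_sq {k : ℕ} (hk : 2 ≤ k) (h : Lattice d → ℝ) :
    energyNorm k h ^ 2 = speed k * energy h :=
  Real.sq_sqrt (mul_nonneg (speed_pos hk).le (energy_nonneg h))

lemma mul_sqrt_energy {k : ℕ} (hk : 2 ≤ k) (h : Lattice d → ℝ) :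
    k * √(energy h) = energyNorm k h * √(Real.log k) := by
  have hl := log_pos_of_two_le hk
  rw [energyNorm, ← Real.sqrt_mul (mul_nonneg (speed_pos hk).le (energy_nonneg h)), speed]
  have : (k : ℝ) ^ 2 / Real.log k * energy h * Real.log k = k ^ 2 * energy h := by
    field_simp
  rw [this, Real.sqrt_mul (by positivity), Real.sqrt_sq (by positivity)]

/-- Short range jumps. -/
theorem exists_near_le (hd : 0 < d) {g : Space d → ℝ} (hg : IsTest g) {K : ℝ} (hK : 0 ≤ K) :
    ∃ C : ℝ, 0 < C ∧ ∀ k n : ℕ, IsLogScale k n → ∀ a : Sym2 (Lattice d) → ℝ,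
      (∀ e : Sym2 (Lattice d), ¬ e.IsDiag → |a e| ≤ K) →
      ∀ (R : ℕ) (h : Lattice d → ℝ), (Summable fun x => h x ^ 2) →
      speed k * |∑' x, jumpGenerator (fun x z => a s(x, x + z) * shellKap d 0 R z)
        (fun x => g (point k x)) x * h x| ≤
      C * scaleFactor d k * (√(∑ z ∈ shell d 0 R, (nrm z ^ d)⁻¹) / √(Real.log k)) *
        energyNorm k h := by
  obtain ⟨L, hL, hgL⟩ := hg.exists_lipschitz
  obtain ⟨B, hB⟩ := hg.exists_radius
  refine ⟨K * L * √((6 * (B + 1) : ℝ) ^ d) + 1, by positivity, fun k n hs a ha R h hh => ?_⟩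
  have hk := hs.cast_pos
  have hl := hs.log_pos
  have h1 := abs_tsum_jumpGenerator_shellKap_le hd (v := fun x => g (point k x))
    (Q := bigBox d B n) (fun x hx => eq_zero_of_notMem_bigBox hs.pos hs.lt hB hx) hh
    (M := L / k) (by positivity) (fun x z => by
      have := hgL (point k x) (point k z)
      rw [norm_point, ← point_add] at this
      calc _ ≤ _ := this
        _ = _ := by ring) hK ha 0 R
  set S := ∑ z ∈ shell d 0 R, (nrm z ^ d)⁻¹
  have h2 := sqrt_card_bigBox_le (d := d) (B := B) hs.le
  have hX := scaleFactor_nonneg d k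
  have hY := energyNorm_nonneg k h
  set X := scaleFactor d k
  calc _ ≤ speed k * (K * (L / k) * (√((6 * (B + 1) : ℝ) ^ d) * X) * √S * √(energy h)) := by
        refine mul_le_mul_of_nonneg_left (h1.trans ?_) (speed_pos hs.two_le).le
        gcongr
    _ = K * L * √((6 * (B + 1) : ℝ) ^ d) * X * √S * (k * √(energy h)) / Real.log k := by
        unfold speed
        field_simp
    _ = K * L * √((6 * (B + 1) : ℝ) ^ d) * X * (√S / √(Real.log k)) * energyNorm k h := by
        rw [mul_sqrt_energy hs.two_le]
        nth_rewrite 2 [← Real.mul_self_sqrt hl.le]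
        field_simp
    _ ≤ _ := by
        gcongr
        linarith

/-- The range below which the cancellations of the conductances are not used. -/
def cut (n : ℕ) : ℕ := (n + 1) ^ 3

/-- The fluctuation of the first moment of the jump rates. -/
def fluct (w : Sym2 (Lattice d) → ℝ) (n : ℕ) (i : Fin d) (x : Lattice d) : ℝ :=
  moment (fun z => w s(x, x + z) - 1) (shell d (cut n) (2 ^ n)) i

/-- The fluctuation of the second moment of the jump rates. -/
def fluct₂ (w : Sym2 (Lattice d) → ℝ) (n : ℕ) (i j : Fin d) (x : Lattice d) : ℝ :=
  moment₂ (fun z => w s(x, x + z) - 1) (shell d (cut n) (2 ^ n)) i j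

/-- The total size of the fluctuations at scale `2 ^ n` in a box. -/
def fluctSize (w : Sym2 (Lattice d) → ℝ) (n b : ℕ) : ℝ :=
  ∑ x ∈ box d (b * 2 ^ n),
    (∑ i, ∑ j ∈ Finset.range (n + 1), ((2 : ℝ) ^ j) ^ d * cubeAvgAdj j (fluct w n i) x ^ 2 +
      ∑ i, ∑ j, fluct₂ w n i j x ^ 2)

/-- The environment is well behaved at scale `2 ^ n`, in all boxes. -/
def IsGoodScale (w : Sym2 (Lattice d) → ℝ) (n : ℕ) : Prop :=
  ∀ b : ℕ, fluctSize w n b ≤ (b + 1 : ℝ) ^ (d + 2) * ((2 : ℝ) ^ n) ^ d / (n + 1 : ℝ) ^ 2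

lemma sq_div_le_scaleFactor {k n : ℕ} (hs : IsLogScale k n) (b : ℕ) :
    (b + 1 : ℝ) ^ (d + 2) * ((2 : ℝ) ^ n) ^ d / (n + 1 : ℝ) ^ 2 ≤
      (√((b + 1 : ℝ) ^ (d + 2)) * scaleFactor d k / (n + 1)) ^ 2 := by
  rw [div_pow, mul_pow, Real.sq_sqrt (by positivity), scaleFactor, Real.sq_sqrt (by positivity)]
  have := hs.cast_le
  gcongr

/-- Puts a good scale into the form required by the multiscale estimate, with `Γ` a multiple of
`scaleFactor d k / (n + 1)`. -/
lemma IsGoodScale.sqrt_sum_cubeAvgAdj_le {w : Sym2 (Lattice d) → ℝ} {k n : ℕ}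
    (hw : IsGoodScale w n) (hd : 2 ≤ d) (hs : IsLogScale k n) (b : ℕ) (i : Fin d) {j : ℕ}
    (hj : j ≤ n) : √(∑ x ∈ box d (b * 2 ^ n), cubeAvgAdj j (fluct w n i) x ^ 2) ≤
      √((b + 1 : ℝ) ^ (d + 2)) * scaleFactor d k / (n + 1) / 2 ^ j := by
  have hX := scaleFactor_nonneg d k
  refine Real.sqrt_le_iff.2 ⟨by positivity, ?_⟩
  rw [div_pow _ ((2 : ℝ) ^ j), le_div_iff₀ (by positivity)]
  refine le_trans ?_ ((hw b).trans (sq_div_le_scaleFactor hs b))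
  rw [Finset.sum_mul, fluctSize]
  refine Finset.sum_le_sum fun x _ => ?_
  -- The natural weight is `2^(jd)`, but only `2^(2j)` of it is needed.
  have h1 : ((2 : ℝ) ^ j) ^ 2 ≤ ((2 : ℝ) ^ j) ^ d :=
    pow_le_pow_right₀ (one_le_pow₀ one_le_two) hd
  calc cubeAvgAdj j (fluct w n i) x ^ 2 * ((2 : ℝ) ^ j) ^ 2
      ≤ ((2 : ℝ) ^ j) ^ d * cubeAvgAdj j (fluct w n i) x ^ 2 := by
        rw [mul_comm]
        gcongr
    _ ≤ ∑ l ∈ Finset.range (n + 1), ((2 : ℝ) ^ l) ^ d * cubeAvgAdj l (fluct w n i) x ^ 2 :=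
        Finset.single_le_sum (f := fun l => ((2 : ℝ) ^ l) ^ d * cubeAvgAdj l (fluct w n i) x ^ 2)
          (fun l _ => by positivity) (Finset.mem_range.2 (by omega))
    _ ≤ ∑ i, ∑ l ∈ Finset.range (n + 1), ((2 : ℝ) ^ l) ^ d * cubeAvgAdj l (fluct w n i) x ^ 2 :=
        Finset.single_le_sum (f := fun i => ∑ l ∈ Finset.range (n + 1),
          ((2 : ℝ) ^ l) ^ d * cubeAvgAdj l (fluct w n i) x ^ 2)
          (fun i _ => Finset.sum_nonneg fun l _ => by positivity) (Finset.mem_univ i)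
    _ ≤ _ := le_add_of_nonneg_right
        (Finset.sum_nonneg fun i _ => Finset.sum_nonneg fun j _ => sq_nonneg _)

lemma IsGoodScale.sqrt_sum_fluct₂_le {w : Sym2 (Lattice d) → ℝ} {k n : ℕ}
    (hw : IsGoodScale w n) (hs : IsLogScale k n) (b : ℕ) (i j : Fin d) :
    √(∑ x ∈ box d (b * 2 ^ n), fluct₂ w n i j x ^ 2) ≤
      √((b + 1 : ℝ) ^ (d + 2)) * scaleFactor d k := by
  have hX := scaleFactor_nonneg d k
  have h0 : √((b + 1 : ℝ) ^ (d + 2)) * scaleFactor d k / (n + 1) ≤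
      √((b + 1 : ℝ) ^ (d + 2)) * scaleFactor d k :=
    div_le_self (by positivity) (by linarith [show (0 : ℝ) ≤ n by positivity])
  refine le_trans (Real.sqrt_le_iff.2 ⟨by positivity, ?_⟩) h0
  refine le_trans ?_ ((hw b).trans (sq_div_le_scaleFactor hs b))
  rw [fluctSize]
  refine Finset.sum_le_sum fun x _ => ?_
  calc fluct₂ w n i j x ^ 2 ≤ ∑ j, fluct₂ w n i j x ^ 2 :=
        Finset.single_le_sum (f := fun j => fluct₂ w n i j x ^ 2) (fun j _ => sq_nonneg _)
          (Finset.mem_univ j)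
    _ ≤ ∑ i, ∑ j, fluct₂ w n i j x ^ 2 :=
        Finset.single_le_sum (f := fun i => ∑ j, fluct₂ w n i j x ^ 2)
          (fun i _ => Finset.sum_nonneg fun j _ => sq_nonneg _) (Finset.mem_univ i)
    _ ≤ _ := le_add_of_nonneg_left (Finset.sum_nonneg fun i _ => Finset.sum_nonneg fun j _ => by
        positivity)

lemma nrm_single (i : Fin d) : nrm (Pi.single i 1 : Lattice d) = 1 := by
  have := nrm_sq (Pi.single i 1 : Lattice d)
  rw [Finset.sum_eq_single i (fun j _ hj => by simp [hj]) (by simp)] at this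
  simp only [Pi.single_eq_same, Int.cast_one] at this
  exact (pow_left_inj₀ (nrm_nonneg _) zero_le_one two_ne_zero).1 this

/-- Unit jumps have rate one, so the discrete gradient is part of the energy. -/
lemma ell2_unit_shift_sub_le (hd : 0 < d) {h : Lattice d → ℝ} (hh : Summable fun x => h x ^ 2)
    (i : Fin d) : ell2 (fun x => h (x + Pi.single i 1) - h x) ≤ √(energy h) := by
  apply Real.sqrt_le_sqrt
  have hk : kap (Pi.single i 1 : Lattice d) = 1 := by rw [kap, nrm_single, one_pow, inv_one]
  have hS := (isJumpKernel_kap hd).summable_diff_sq hh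
  have hinj : Function.Injective fun x : Lattice d => (x, (Pi.single i 1 : Lattice d)) :=
    fun x y hxy => (Prod.ext_iff.1 hxy).1
  exact (summable_sq_sub (summable_sq_shift hh _) hh).tsum_le_tsum_of_inj _ hinj
    (fun p _ => mul_nonneg (kap_nonneg _) (sq_nonneg _)) (fun x => by rw [hk, one_mul]) hS

lemma ell2_mul_le {ι : Type*} {F f : ι → ℝ} {A : ℝ} (hA : 0 ≤ A)
    (hf : Summable fun x => f x ^ 2) (hF : ∀ x, |F x| ≤ A) :
    (Summable fun x => (F x * f x) ^ 2) ∧ ell2 (fun x => F x * f x) ≤ A * ell2 f := by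
  have hle : ∀ x, (F x * f x) ^ 2 ≤ A ^ 2 * f x ^ 2 := fun x => by
    rw [mul_pow]
    refine mul_le_mul_of_nonneg_right ?_ (sq_nonneg _)
    exact sq_le_sq' (by linarith [(abs_le.1 (hF x)).1]) (abs_le.1 (hF x)).2
  have hsum : Summable fun x => (F x * f x) ^ 2 :=
    .of_nonneg_of_le (fun _ => sq_nonneg _) hle (hf.mul_left _)
  refine ⟨hsum, Real.sqrt_le_iff.2 ⟨mul_nonneg hA (ell2_nonneg f), ?_⟩⟩
  rw [mul_pow, ell2_sq, ← tsum_mul_left]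
  exact hsum.tsum_le_tsum hle (hf.mul_left _)

lemma ell2_unit_shift_sub_mul_le (hd : 0 < d) {F h : Lattice d → ℝ}
    (hh : Summable fun x => h x ^ 2) {M L : ℝ} (hM : 0 ≤ M) (hL : 0 ≤ L) (hFM : ∀ x, |F x| ≤ M)
    (i : Fin d) (hFL : ∀ x, |F (x + Pi.single i 1) - F x| ≤ L) :
    ell2 (fun x => F (x + Pi.single i 1) * h (x + Pi.single i 1) - F x * h x) ≤
      M * √(energy h) + L * ell2 h := by
  have hh' := summable_sq_sub (summable_sq_shift hh (Pi.single i 1)) hh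
  obtain ⟨s1, b1⟩ := ell2_mul_le hM hh' fun x => hFM (x + Pi.single i 1)
  obtain ⟨s2, b2⟩ := ell2_mul_le hL hh hFL
  have e : (fun x => F (x + Pi.single i 1) * h (x + Pi.single i 1) - F x * h x) = fun x =>
      F (x + Pi.single i 1) * (h (x + Pi.single i 1) - h x) +
      (F (x + Pi.single i 1) - F x) * h x := by
    ext x
    ring
  rw [e]
  refine (ell2_add_le s1 s2).trans (add_le_add (b1.trans ?_) b2)
  exact mul_le_mul_of_nonneg_left (ell2_unit_shift_sub_le hd hh i) hM

/-- The numerical part of the bound on the first moment of the fluctuations. -/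
lemma mid_first_arith {k n : ℕ} (hs : IsLogScale k n) {δ Γ M L e s H Y lo : ℝ} (hδ : 0 ≤ δ)
    (hΓ : 0 ≤ Γ) (hM : 0 ≤ M) (hL : 0 ≤ L) (he : 0 ≤ e) (hH : 0 ≤ H) (hY : 0 ≤ Y) (hlo : 0 < lo)
    (hlo' : lo ≤ √(Real.log k)) (hs' : s ≤ M * H) (hY' : k * e = Y * √(Real.log k)) :
    k / Real.log k * (Γ / (n + 1) * (3 * δ * n * (M * e + L / k * H) + s / 2 ^ n)) ≤
      Γ / √(Real.log k) * ((3 * δ * M + (3 * δ * L + 2 * M) / lo) * (H + Y)) := by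
  have hk := hs.cast_pos
  have hl := hs.log_pos
  set D := M * e + L / k * H with hD
  have hD0 : 0 ≤ D := by positivity
  have hn1 : (n : ℝ) / (n + 1) ≤ 1 := by
    rw [div_le_one (by positivity)]
    linarith
  have hn2 : (1 : ℝ) / (n + 1) ≤ 1 := by
    rw [div_le_one (by positivity)]
    linarith [show (0 : ℝ) ≤ n by positivity]
  have hn3 : s / 2 ^ n ≤ 2 * M * H / k := by
    rw [div_le_div_iff₀ (by positivity) hk]
    have := hs.cast_le'
    calc s * k ≤ (M * H) * (2 * 2 ^ n) := by gcongr
      _ = _ := by ring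
  have hkD : k * D = M * (Y * √(Real.log k)) + L * H := by
    rw [← hY', hD]
    field_simp
  have hsl0 : 0 < √(Real.log k) := Real.sqrt_pos.2 hl
  have hb : Γ / (n + 1) * (3 * δ * n * D + s / 2 ^ n) ≤ Γ * (3 * δ * D + 2 * M * H / k) := by
    calc Γ / (n + 1) * (3 * δ * n * D + s / 2 ^ n)
        = Γ * (3 * δ * D * (n / (n + 1)) + s / 2 ^ n * (1 / (n + 1))) := by
          field_simp
      _ ≤ Γ * (3 * δ * D * 1 + 2 * M * H / k * (1 / (n + 1))) := by gcongr
      _ ≤ Γ * (3 * δ * D * 1 + 2 * M * H / k * 1) := by gcongr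
      _ = _ := by ring
  calc _ ≤ k / Real.log k * (Γ * (3 * δ * D + 2 * M * H / k)) :=
        mul_le_mul_of_nonneg_left hb (by positivity)
    _ = Γ / Real.log k * (3 * δ * (k * D) + 2 * M * H) := by
        field_simp
    _ = Γ / √(Real.log k) * (3 * δ * M * Y + (3 * δ * L + 2 * M) / √(Real.log k) * H) := by
        rw [hkD]
        nth_rewrite 1 [← Real.mul_self_sqrt hl.le]
        field_simp
        ring
    _ ≤ Γ / √(Real.log k) * (3 * δ * M * Y + (3 * δ * L + 2 * M) / lo * H) := by
        gcongr
    _ ≤ _ := by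
        refine mul_le_mul_of_nonneg_left ?_ (by positivity)
        have h1 : 0 ≤ 3 * δ * M * H := by positivity
        have h2 : 0 ≤ (3 * δ * L + 2 * M) / lo * Y := by positivity
        linarith

/-- The first moment of the fluctuations at intermediate range. -/
lemma exists_mid_first_le (hd : 2 ≤ d) {g : Space d → ℝ} (hg : IsTest g) {B : ℕ}
    (hB : ∀ y, (B : ℝ) < ‖y‖ → g y = 0) :
    ∃ C : ℝ, 0 < C ∧ ∀ k n : ℕ, IsLogScale k n → ∀ w : Sym2 (Lattice d) → ℝ, IsGoodScale w n →
      ∀ (h : Lattice d → ℝ), (Summable fun x => h x ^ 2) → ∀ i : Fin d,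
      k / Real.log k * |∑ x ∈ bigBox d B n, fluct w n i x * (g (point k x) * h x)| ≤
        C * scaleFactor d k / √(Real.log k) * (ell2 h + energyNorm k h) := by
  obtain ⟨L, hL, hgL⟩ := hg.exists_lipschitz
  obtain ⟨M, hM, hgM⟩ := hg.exists_abs_le
  set Cb := √(((2 * (B + 1) : ℕ) + 1 : ℝ) ^ (d + 2)) with hCb
  have hl2 : 0 < Real.log 2 := Real.log_pos one_lt_two
  set lo := √(Real.log 2) with hlo
  have hlo0 : 0 < lo := Real.sqrt_pos.2 hl2
  refine ⟨Cb * (3 * d * M + (3 * d * L + 2 * M) / lo), by positivity, fun k n hs w hw h hh i => ?_⟩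
  have hk := hs.cast_pos
  have hl := hs.log_pos
  have hX := scaleFactor_nonneg d k
  have hY := energyNorm_nonneg k h
  have hH := ell2_nonneg h
  set X := scaleFactor d k
  set Y := energyNorm k h
  set φ : Lattice d → ℝ := fun x => g (point k x) * h x with hφ
  have hφ0 : ∀ x ∉ box d (B * k), φ x = 0 := fun x hx => by
    rw [hφ]
    simp only [eq_zero_of_notMem_box hB hs.pos hx, zero_mul]
  have e1 : ∑ x ∈ bigBox d B n, fluct w n i x * φ x = ∑' x, fluct w n i x * φ x := by
    rw [tsum_eq_sum]
    intro x hx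
    rw [hφ]
    simp only [eq_zero_of_notMem_bigBox hs.pos hs.lt hB hx, zero_mul, mul_zero]
  have hφh : ell2 φ ≤ M * ell2 h := (ell2_mul_le hM.le hh fun x => hgM (point k x)).2
  have hD : ∀ l, ell2 (fun x => φ (x + Pi.single l 1) - φ x) ≤
      M * √(energy h) + L / k * ell2 h := by
    intro l
    refine ell2_unit_shift_sub_mul_le (F := fun x => g (point k x)) (by omega) hh hM.le
      (by positivity) (fun x => hgM _) l fun x => ?_
    have := hgL (point k x) (point k (Pi.single l 1))
    rwa [norm_point, ← point_add, nrm_single, mul_one_div] at this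
  -- The factor `1 / (n + 1)` in `Γ` compensates the number `n` of scales. The enlarged box absorbs
  -- the cubes of side up to `2^n` around the support.
  have key := abs_tsum_mul_le_multiscale (fluct w n i) hφ0 (box_subset_bigBox hs.lt)
    (Γ := Cb * X / (n + 1)) (by positivity) (by positivity) hD fun j hj =>
      hw.sqrt_sum_cubeAvgAdj_le hd hs (2 * (B + 1)) i hj
  rw [e1]
  refine (mul_le_mul_of_nonneg_left key (by positivity)).trans
    ((mid_first_arith hs (Nat.cast_nonneg d) (by positivity) hM.le hL.le (Real.sqrt_nonneg _) hH hY
      hlo0 (Real.sqrt_le_sqrt hs.log_two_le) hφh (mul_sqrt_energy hs.two_le h)).trans (le_of_eq ?_))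
  ring

end Fluctuations

/-! ### Second moment and remainder at intermediate range. -/

section FarRange

lemma sum_abs_le {h : Lattice d → ℝ} (hh : Summable fun x => h x ^ 2) (Q : Finset (Lattice d)) :
    ∑ x ∈ Q, |h x| ≤ √(Q.card : ℝ) * ell2 h := by
  have h1 := abs_sum_mul_le Q (fun _ => (1 : ℝ)) fun x => |h x|
  simp only [one_mul, one_pow, sq_abs, Finset.sum_const, nsmul_eq_mul, mul_one] at h1
  exact ((le_abs_self _).trans h1).trans
    (mul_le_mul_of_nonneg_left (sqrt_sum_sq_le_ell2 hh Q) (Real.sqrt_nonneg _))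

lemma abs_sum_mul_le_of_abs_le {F h : Lattice d → ℝ} (hh : Summable fun x => h x ^ 2)
    {Q : Finset (Lattice d)} {A : ℝ} (hA : 0 ≤ A) (hF : ∀ x ∈ Q, |F x| ≤ A) :
    |∑ x ∈ Q, F x * h x| ≤ A * (√(Q.card : ℝ) * ell2 h) := by
  calc _ ≤ ∑ x ∈ Q, |F x * h x| := Finset.abs_sum_le_sum_abs _ _
    _ ≤ ∑ x ∈ Q, A * |h x| := by
        refine Finset.sum_le_sum fun x hx => ?_
        rw [abs_mul]
        exact mul_le_mul_of_nonneg_right (hF x hx) (abs_nonneg _)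
    _ ≤ _ := by
        rw [← Finset.mul_sum]
        exact mul_le_mul_of_nonneg_left (sum_abs_le hh Q) hA

lemma tsum_jumpGenerator_shellKap_eq {g : Space d → ℝ} {B k n : ℕ} (hs : IsLogScale k n)
    (hB : ∀ y, (B : ℝ) < ‖y‖ → g y = 0) (a : Lattice d → Lattice d → ℝ) (r : ℕ)
    {x : Lattice d} (hx : x ∉ bigBox d B n) :
    jumpGenerator (fun x z => a x z * shellKap d r (2 ^ n) z) (fun x => g (point k x)) x = 0 := by
  rw [jumpGenerator_shellKap]
  refine Finset.sum_eq_zero fun z hz => ?_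
  rw [eq_zero_of_notMem_bigBox hs.pos hs.lt hB hx,
    eq_zero_of_add_notMem_bigBox hs.pos hs.lt hB hx (shell_subset_box _ _ hz), sub_zero, mul_zero]

lemma log_div_le_div_sqrt {k n : ℕ} (hs : IsLogScale k n) {A : ℝ} (hA : 0 ≤ A) :
    A / Real.log k ≤ A / √(Real.log 2) / √(Real.log k) := by
  have hl2 : 0 < Real.log 2 := Real.log_pos one_lt_two
  rw [div_div]
  refine div_le_div_of_nonneg_left hA
    (mul_pos (Real.sqrt_pos.2 hl2) (Real.sqrt_pos.2 hs.log_pos)) ?_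
  nth_rewrite 2 [← Real.mul_self_sqrt hs.log_pos.le]
  exact mul_le_mul_of_nonneg_right (Real.sqrt_le_sqrt hs.log_two_le) (Real.sqrt_nonneg _)

/-- The second moment of the fluctuations at intermediate range. -/
lemma exists_mid_second_le {g : Space d → ℝ} (hg : IsTest g) (B : ℕ) :
    ∃ C : ℝ, 0 < C ∧ ∀ k n : ℕ, IsLogScale k n → ∀ w : Sym2 (Lattice d) → ℝ, IsGoodScale w n →
      ∀ (h : Lattice d → ℝ), (Summable fun x => h x ^ 2) → ∀ i j : Fin d,
      |∑ x ∈ bigBox d B n, fluct₂ w n i j x * (g (point k x) * h x)| ≤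
        C * scaleFactor d k * ell2 h := by
  obtain ⟨M, hM, hgM⟩ := hg.exists_abs_le
  refine ⟨√(((2 * (B + 1) : ℕ) + 1 : ℝ) ^ (d + 2)) * M, by positivity,
    fun k n hs w hw h hh i j => ?_⟩
  obtain ⟨s1, b1⟩ := ell2_mul_le hM.le hh fun x => hgM (point k x)
  refine (abs_sum_mul_le _ _ _).trans ?_
  have h2 := hw.sqrt_sum_fluct₂_le hs (2 * (B + 1)) i j
  have h3 := (sqrt_sum_sq_le_ell2 s1 (bigBox d B n)).trans b1
  calc _ ≤ √(((2 * (B + 1) : ℕ) + 1 : ℝ) ^ (d + 2)) * scaleFactor d k * (M * ell2 h) :=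
        mul_le_mul h2 h3 (Real.sqrt_nonneg _)
          (mul_nonneg (Real.sqrt_nonneg _) (scaleFactor_nonneg d k))
    _ = _ := by ring

/-- Jumps of intermediate range. -/
theorem exists_mid_le (hd : 2 ≤ d) {g : Space d → ℝ} (hg : IsTest g) {K : ℝ} (hK : 0 ≤ K) :
    ∃ C : ℝ, 0 < C ∧ ∀ k n : ℕ, IsLogScale k n → ∀ w : Sym2 (Lattice d) → ℝ,
      (∀ e : Sym2 (Lattice d), ¬ e.IsDiag → |w e - 1| ≤ K) → IsGoodScale w n →
      ∀ h : Lattice d → ℝ, (Summable fun x => h x ^ 2) →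
      speed k * |∑' x, jumpGenerator
        (fun x z => (w s(x, x + z) - 1) * shellKap d (cut n) (2 ^ n) z)
        (fun x => g (point k x)) x * h x| ≤
      C * scaleFactor d k / √(Real.log k) * (ell2 h + energyNorm k h) := by
  obtain ⟨B, hB⟩ := hg.exists_radius
  obtain ⟨C₃, hC₃, h3⟩ := hg.exists_taylor_three
  obtain ⟨C₁, hC₁, h1⟩ := exists_sum_kap_mul_nrm_cube_le (d := d) (by omega)
  choose Ca hCa ha using fun i => exists_mid_first_le hd (hg.pderiv i) (pderiv_eq_zero hB i)
  choose Cb hCb hb using fun i j => exists_mid_second_le ((hg.pderiv i).pderiv j) B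
  have hl2 : 0 < Real.log 2 := Real.log_pos one_lt_two
  have hlo : 0 < √(Real.log 2) := Real.sqrt_pos.2 hl2
  set Cr := K * C₃ * C₁ * √((6 * (B + 1) : ℝ) ^ d) with hCr
  set Sa := ∑ i, Ca i with hSa
  set Sb := ∑ i, ∑ j, Cb i j with hSb
  have hSa0 : 0 ≤ Sa := Finset.sum_nonneg fun i _ => (hCa i).le
  have hSb0 : 0 ≤ Sb := Finset.sum_nonneg fun i _ => Finset.sum_nonneg fun j _ => (hCb i j).le
  refine ⟨(Cr + Sb) / √(Real.log 2) + Sa + 1, by positivity, fun k n hs w hw hgood h hh => ?_⟩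
  have hk := hs.cast_pos
  have hl := hs.log_pos
  have hX := scaleFactor_nonneg d k
  have hY := energyNorm_nonneg k h
  have hH := ell2_nonneg h
  have hsp := (speed_pos hs.two_le).le
  set X := scaleFactor d k
  set Y := energyNorm k h
  set N := ell2 h
  set Q := bigBox d B n with hQ
  set A : Lattice d → ℝ := fun x => ∑ z ∈ shell d (cut n) (2 ^ n), (w s(x, x + z) - 1) * kap z *
    (g (point k (x + z)) - g (point k x)) with hA
  set T₁ : Lattice d → ℝ := fun x => ∑ i, fluct w n i x * pderiv i g (point k x) with hT₁
  set T₂ : Lattice d → ℝ := fun x =>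
    ∑ i, ∑ j, fluct₂ w n i j x * pderiv j (pderiv i g) (point k x) with hT₂
  have hsum : ∑' x, jumpGenerator (fun x z => (w s(x, x + z) - 1) * shellKap d (cut n) (2 ^ n) z)
      (fun x => g (point k x)) x * h x = ∑ x ∈ Q, A x * h x := by
    rw [tsum_eq_sum (s := Q)]
    · simp only [jumpGenerator_shellKap, hA]
    · intro x hx
      rw [tsum_jumpGenerator_shellKap_eq hs hB _ _ hx, zero_mul]
  have hrem : ∀ x ∈ Q, |A x - 1 / k * T₁ x - 1 / (2 * k ^ 2) * T₂ x| ≤ K * C₃ * C₁ / k ^ 2 := by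
    intro x _
    refine (abs_generator_sub_moments_le hK h3 k (fun z hz => hw _
      (not_isDiag_add (ne_zero_of_mem_shell hz))) x).trans ?_
    have hsub : ∑ z ∈ shell d (cut n) (2 ^ n), kap z * nrm z ^ 3 ≤
        ∑ z ∈ shell d 0 (2 ^ n), kap z * nrm z ^ 3 := by
      refine Finset.sum_le_sum_of_subset_of_nonneg (fun z hz => ?_) fun z _ _ =>
        mul_nonneg (kap_nonneg z) (pow_nonneg (nrm_nonneg z) 3)
      rw [mem_shell] at hz ⊢
      refine ⟨lt_of_le_of_lt ?_ hz.1, hz.2⟩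
      exact_mod_cast Nat.zero_le _
    calc _ ≤ K * C₃ / k ^ 3 * (C₁ * k) := by
          refine mul_le_mul_of_nonneg_left (hsub.trans ((h1 n).trans ?_)) (by positivity)
          exact mul_le_mul_of_nonneg_left hs.cast_le hC₁.le
      _ = _ := by field_simp
  have hI : |∑ x ∈ Q, (A x - 1 / k * T₁ x - 1 / (2 * k ^ 2) * T₂ x) * h x| ≤
      K * C₃ * C₁ / k ^ 2 * (√((6 * (B + 1) : ℝ) ^ d) * X * N) := by
    refine (abs_sum_mul_le_of_abs_le hh (by positivity) hrem).trans ?_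
    exact mul_le_mul_of_nonneg_left
      (mul_le_mul_of_nonneg_right (sqrt_card_bigBox_le hs.le) hH) (by positivity)
  have hII : k / Real.log k * |∑ x ∈ Q, T₁ x * h x| ≤ Sa * X / √(Real.log k) * (N + Y) := by
    have e : ∑ x ∈ Q, T₁ x * h x =
        ∑ i, ∑ x ∈ Q, fluct w n i x * (pderiv i g (point k x) * h x) := by
      rw [Finset.sum_comm]
      refine Finset.sum_congr rfl fun x _ => ?_
      rw [hT₁, Finset.sum_mul]
      exact Finset.sum_congr rfl fun i _ => by ring
    rw [e]
    calc _ ≤ k / Real.log k * ∑ i, |∑ x ∈ Q, fluct w n i x * (pderiv i g (point k x) * h x)| :=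
          mul_le_mul_of_nonneg_left (Finset.abs_sum_le_sum_abs _ _) (by positivity)
      _ ≤ ∑ i, Ca i * X / √(Real.log k) * (N + Y) := by
          rw [Finset.mul_sum]
          exact Finset.sum_le_sum fun i _ => ha i k n hs w hgood h hh i
      _ = _ := by
          rw [hSa]
          simp only [Finset.sum_mul, Finset.sum_div]
  have hIII : |∑ x ∈ Q, T₂ x * h x| ≤ Sb * X * N := by
    have e : ∑ x ∈ Q, T₂ x * h x =
        ∑ i, ∑ j, ∑ x ∈ Q, fluct₂ w n i j x * (pderiv j (pderiv i g) (point k x) * h x) := by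
      have e1 : ∀ i, ∑ j, ∑ x ∈ Q, fluct₂ w n i j x * (pderiv j (pderiv i g) (point k x) * h x) =
          ∑ x ∈ Q, ∑ j, fluct₂ w n i j x * (pderiv j (pderiv i g) (point k x) * h x) :=
        fun i => Finset.sum_comm
      simp only [e1]
      rw [Finset.sum_comm]
      refine Finset.sum_congr rfl fun x _ => ?_
      rw [hT₂, Finset.sum_mul]
      refine Finset.sum_congr rfl fun i _ => ?_
      rw [Finset.sum_mul]
      exact Finset.sum_congr rfl fun j _ => by ring
    rw [e]
    calc _ ≤ ∑ i, ∑ j, |∑ x ∈ Q, fluct₂ w n i j x * (pderiv j (pderiv i g) (point k x) * h x)| :=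
          (Finset.abs_sum_le_sum_abs _ _).trans
            (Finset.sum_le_sum fun i _ => Finset.abs_sum_le_sum_abs _ _)
      _ ≤ ∑ i, ∑ j, Cb i j * X * N :=
          Finset.sum_le_sum fun i _ => Finset.sum_le_sum fun j _ => hb i j k n hs w hgood h hh i j
      _ = _ := by
          rw [hSb]
          simp only [Finset.sum_mul]
  -- Scaling multiplies the three parts by `k^2 / log k`. The remainder and the second moment become
  -- `O(1 / log k)`, while the first moment keeps the large factor `k / log k`, which is why it
  -- needs cancellation over many scales.
  have hdec : ∑ x ∈ Q, A x * h x =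
      ∑ x ∈ Q, (A x - 1 / k * T₁ x - 1 / (2 * k ^ 2) * T₂ x) * h x +
        1 / k * ∑ x ∈ Q, T₁ x * h x + 1 / (2 * k ^ 2) * ∑ x ∈ Q, T₂ x * h x := by
    rw [Finset.mul_sum, Finset.mul_sum, ← Finset.sum_add_distrib, ← Finset.sum_add_distrib]
    exact Finset.sum_congr rfl fun x _ => by ring
  have hcomb : speed k * |∑ x ∈ Q, A x * h x| ≤
      Cr / Real.log k * (X * N) + Sa * X / √(Real.log k) * (N + Y) +
        Sb / Real.log k * (X * N) := by
    rw [hdec]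
    have t1 : speed k * |∑ x ∈ Q, (A x - 1 / k * T₁ x - 1 / (2 * k ^ 2) * T₂ x) * h x| ≤
        Cr / Real.log k * (X * N) := by
      refine (mul_le_mul_of_nonneg_left hI hsp).trans (le_of_eq ?_)
      rw [hCr]
      unfold speed
      field_simp
    have t2 : speed k * |1 / k * ∑ x ∈ Q, T₁ x * h x| ≤ Sa * X / √(Real.log k) * (N + Y) := by
      rw [abs_mul, abs_of_pos (by positivity), ← mul_assoc, speed_div_self hs.two_le]
      exact hII
    have t3 : speed k * |1 / (2 * k ^ 2) * ∑ x ∈ Q, T₂ x * h x| ≤ Sb / Real.log k * (X * N) := by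
      rw [abs_mul, abs_of_pos (by positivity), ← mul_assoc, speed_div_sq hs.two_le]
      calc _ ≤ 1 / (2 * Real.log k) * (Sb * X * N) :=
            mul_le_mul_of_nonneg_left hIII (by positivity)
        _ = 1 / 2 * (Sb / Real.log k * (X * N)) := by field_simp
        _ ≤ _ := by
            have : 0 ≤ Sb / Real.log k * (X * N) := by positivity
            linarith
    calc _ ≤ speed k * (|∑ x ∈ Q, (A x - 1 / k * T₁ x - 1 / (2 * k ^ 2) * T₂ x) * h x| +
          |1 / k * ∑ x ∈ Q, T₁ x * h x| + |1 / (2 * k ^ 2) * ∑ x ∈ Q, T₂ x * h x|) :=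
          mul_le_mul_of_nonneg_left (abs_add_three _ _ _) hsp
      _ ≤ _ := by
          rw [mul_add, mul_add]
          linarith
  rw [hsum]
  have hr := log_div_le_div_sqrt hs (show 0 ≤ (Cr + Sb) * (X * N) by positivity)
  have hsl : 0 < √(Real.log k) := Real.sqrt_pos.2 hl
  calc _ ≤ (Cr + Sb) * (X * N) / Real.log k + Sa * X / √(Real.log k) * (N + Y) := by
        refine hcomb.trans (le_of_eq ?_)
        ring
    _ ≤ (Cr + Sb) * (X * N) / √(Real.log 2) / √(Real.log k) +
          Sa * X / √(Real.log k) * (N + Y) := by linarith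
    _ = X / √(Real.log k) * ((Cr + Sb) / √(Real.log 2) * N + Sa * (N + Y)) := by
        field_simp
    _ ≤ X / √(Real.log k) * (((Cr + Sb) / √(Real.log 2) + Sa + 1) * (N + Y)) := by
        refine mul_le_mul_of_nonneg_left ?_ (by positivity)
        have : 0 ≤ (Cr + Sb) / √(Real.log 2) * Y := by positivity
        linarith
    _ = _ := by ring

end FarRange

/-! ### The error estimate in a good environment. -/

section ErrorEstimate

/-- Only the fluctuation `w - 1` is split at `cut n`. Beyond `2^n` the mean is not separated, since
jumps of that length are negligible as a whole. -/
lemma rate_eq_add (w : Sym2 (Lattice d) → ℝ) {n : ℕ} (hn : cut n ≤ 2 ^ n) (x z : Lattice d) :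
    rate w x z = (1 * shellKap d 0 (2 ^ n) z + (w s(x, x + z) - 1) * shellKap d 0 (cut n) z) +
      ((w s(x, x + z) - 1) * shellKap d (cut n) (2 ^ n) z + w s(x, x + z) * tailKap d n z) := by
  have hn' : (cut n : ℝ) ≤ 2 ^ n := by exact_mod_cast hn
  have hc : (0 : ℝ) ≤ cut n := Nat.cast_nonneg _
  simp only [rate, shellKap, tailKap, mem_shell]
  push_cast
  rcases (nrm_nonneg z).eq_or_lt with h0 | h0
  · have h1 : ¬ (cut n : ℝ) < nrm z := by linarith
    have h2 : ¬ (2 : ℝ) ^ n < nrm z := by linarith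
    have h3 : z = 0 := by
      by_contra h
      exact h0.not_lt (nrm_pos_iff.2 h)
    simp [h3]
  · by_cases h1 : nrm z ≤ cut n
    · have h2 : nrm z ≤ 2 ^ n := h1.trans hn'
      simp [h0, h1, h2, h1.not_gt, h2.not_gt]
      ring
    · have h1' := not_le.1 h1
      by_cases h2 : nrm z ≤ 2 ^ n
      · simp [h0, h1, h1', h2, h2.not_gt]
        ring
      · simp [h1, h2, not_le.1 h2]

lemma jumpGenerator_add {κ κ' : Lattice d → ℝ} {q q' : Lattice d → Lattice d → ℝ}
    (H : IsJumpKernel κ q) (H' : IsJumpKernel κ' q') {v : Lattice d → ℝ}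
    (hv : Summable fun x => v x ^ 2) (x : Lattice d) :
    jumpGenerator (fun x z => q x z + q' x z) v x = jumpGenerator q v x + jumpGenerator q' v x := by
  rw [jumpGenerator, jumpGenerator, jumpGenerator,
    ← (H.summable_generator hv x).tsum_add (H'.summable_generator hv x)]
  exact tsum_congr fun z => add_mul _ _ _

lemma IsJumpKernel.add {κ κ' : Lattice d → ℝ} {q q' : Lattice d → Lattice d → ℝ}
    (H : IsJumpKernel κ q) (H' : IsJumpKernel κ' q') :
    IsJumpKernel (fun z => κ z + κ' z) fun x z => q x z + q' x z where
  summable := H.summable.add H'.summable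
  bound x z := (abs_add_le _ _).trans (add_le_add (H.bound x z) (H'.bound x z))
  symm x z := by rw [H.symm, H'.symm]

/-- The mean generator with jumps up to `2 ^ n`, compared with the limit. -/
lemma exists_mean_le (hd : 0 < d) {g : Space d → ℝ} (hg : IsTest g) :
    ∃ C : ℝ, 0 < C ∧ ∀ k n : ℕ, IsLogScale k n → ∀ h : Lattice d → ℝ,
      (Summable fun x => h x ^ 2) →
      |∑' x, (speed k * jumpGenerator (fun _ z => 1 * shellKap d 0 (2 ^ n) z)
          (fun x => g (point k x)) x -
        limitCoefficient d * Laplacian.laplacian g (point k x)) * h x| ≤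
      C / Real.log k * scaleFactor d k * ell2 h := by
  obtain ⟨B, hB⟩ := hg.exists_radius
  obtain ⟨C, hC, hc⟩ := exists_consistency hd hg
  refine ⟨C * √((6 * (B + 1) : ℝ) ^ d), by positivity, fun k n hs h hh => ?_⟩
  have hl := hs.log_pos
  rw [tsum_eq_sum (s := bigBox d B n)]
  · refine (abs_sum_mul_le_of_abs_le hh (A := C / Real.log k) (by positivity) fun x _ => ?_).trans ?_
    · rw [jumpGenerator_shellKap fun _ _ => 1]
      simp only [one_mul]
      exact hc k n hs x
    · calc _ ≤ C / Real.log k * (√((6 * (B + 1) : ℝ) ^ d) * scaleFactor d k * ell2 h) := by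
            refine mul_le_mul_of_nonneg_left ?_ (by positivity)
            exact mul_le_mul_of_nonneg_right (sqrt_card_bigBox_le hs.le) (ell2_nonneg h)
        _ = _ := by ring
  · intro x hx
    rw [tsum_jumpGenerator_shellKap_eq hs hB (fun _ _ => 1) _ hx, hg.laplacian_eq]
    have : ∀ i, pderiv i (pderiv i g) (point k x) = 0 := fun i =>
      eq_zero_of_notMem_bigBox hs.pos hs.lt (pderiv_eq_zero (pderiv_eq_zero hB i) i) hx
    simp [this]

/-- Since `(N + Y)² ≤ 2 (N² + Y²)`, one factor `N + Y` cancels and `N + Y ≤ 2 e / c`. -/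
lemma add_le_of_quadratic {c e N Y : ℝ} (hc : 0 < c) (hN : 0 ≤ N) (hY : 0 ≤ Y) (he : 0 ≤ e)
    (h : c * (N ^ 2 + Y ^ 2) ≤ e * (N + Y)) : N ≤ 2 * e / c := by
  rw [le_div_iff₀ hc]
  rcases (add_nonneg hN hY).eq_or_lt with h0 | h0
  · have : N = 0 := by linarith
    rw [this]
    linarith
  · have h1 : c * (N + Y) * (N + Y) ≤ 2 * e * (N + Y) := by
      nlinarith [mul_nonneg hc.le (sq_nonneg (N - Y))]
    have h2 := le_of_mul_le_mul_right h1 h0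
    nlinarith

/-- The convergence rate at a scale where the environment is well behaved. -/
theorem exists_resolvent_error_le (hd : 2 ≤ d) {g : Space d → ℝ} (hg : IsTest g) {C₁ C₂ lam : ℝ}
    (hC₁ : 0 < C₁) (hC₂ : 0 < C₂) (hlam : 0 < lam) :
    ∃ C : ℝ, 0 < C ∧ ∀ k n : ℕ, IsLogScale k n → cut n ≤ 2 ^ n → ∀ w : Sym2 (Lattice d) → ℝ,
      (∀ e : Sym2 (Lattice d), ¬ e.IsDiag → C₁ ≤ w e ∧ w e ≤ C₂) → IsGoodScale w n →
      ∀ u, IsScaledResolvent w k lam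
        (fun x => lam * g x - limitCoefficient d * Laplacian.laplacian g x) u →
      ell2 (fun x => u x - g (point k x)) ≤
        C * scaleFactor d k * √((1 + Real.log (n + 1)) / Real.log k) := by
  have hd0 : 0 < d := by omega
  have hK : 0 ≤ C₂ + 1 := by linarith
  obtain ⟨A₁, hA₁, h1⟩ := exists_mean_le hd0 hg
  obtain ⟨A₂, hA₂, h2⟩ := exists_near_le hd0 hg hK
  obtain ⟨A₃, hA₃, h3⟩ := exists_mid_le hd hg hK
  obtain ⟨A₄, hA₄, h4⟩ := exists_far_le hd0 hg hK
  obtain ⟨A₅, hA₅, h5⟩ := exists_shell_sum_sub_log_le hd0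
  have ha0 := limitCoefficient_pos d
  set a₀ := limitCoefficient d
  set c := min lam (C₁ / 2) with hcdef
  have hc : 0 < c := lt_min hlam (by linarith)
  have hl2 : 0 < Real.log 2 := Real.log_pos one_lt_two
  set lo := √(Real.log 2) with hlo
  have hlo0 : 0 < lo := Real.sqrt_pos.2 hl2
  set As := √(A₅ + 6 * d * a₀) with hAs
  set At := (A₁ + A₄) / lo + A₂ * As + A₃ with hAt
  refine ⟨2 * At / c, by positivity, fun k n hs hcut w hw hgood u hu => ?_⟩
  have hl := hs.log_pos
  have hsl : 0 < √(Real.log k) := Real.sqrt_pos.2 hl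
  set v : Lattice d → ℝ := fun x => g (point k x) with hv
  have hv2 : Summable fun x => v x ^ 2 := summable_sq_point hg.compact hs.pos
  set h : Lattice d → ℝ := fun x => u x - v x with hh
  have hh2 : Summable fun x => h x ^ 2 := summable_sq_sub (memℓp_two_iff.1 hu.1) hv2
  have hE := hu.energy_le hd0 hC₁ hC₂ hw hs.two_le hv2
  have hX := scaleFactor_nonneg d k
  have hY := energyNorm_nonneg k h
  have hN := ell2_nonneg h
  have hsp := (speed_pos hs.two_le).le
  set X := scaleFactor d k
  set Y := energyNorm k h with hYdef
  set N := ell2 h with hNdef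
  set ρ := √(1 + Real.log (n + 1)) with hρ
  have hlogn : 0 ≤ Real.log (n + 1 : ℝ) :=
    Real.log_nonneg (by linarith [show (0 : ℝ) ≤ n by positivity])
  have hρ1 : 1 ≤ ρ := Real.one_le_sqrt.2 (by linarith)
  have hw1 := abs_sub_one_le_of_bounds hC₁ hw
  have hw2 := abs_le_of_bounds hC₁ hw
  have hkap := summable_kap hd0
  have H1 := isJumpKernel_weight (a := fun _ => 1) hkap (abs_shellKap_le 0 (2 ^ n))
    (shellKap_zero 0 (2 ^ n)) (shellKap_neg 0 (2 ^ n)) zero_le_one (fun _ _ => by simp)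
  have H2 := isJumpKernel_weight (a := fun e => w e - 1) hkap (abs_shellKap_le 0 (cut n))
    (shellKap_zero 0 (cut n)) (shellKap_neg 0 (cut n)) hK hw1
  have H3 := isJumpKernel_weight (a := fun e => w e - 1) hkap (abs_shellKap_le (cut n) (2 ^ n))
    (shellKap_zero (cut n) (2 ^ n)) (shellKap_neg (cut n) (2 ^ n)) hK hw1
  obtain ⟨H4, r4⟩ := h4 k n hs w hw2 h hh2
  have r1 := h1 k n hs h hh2
  have r2 := h2 k n hs (fun e => w e - 1) hw1 (cut n) h hh2
  have r3 := h3 k n hs w hw1 hgood h hh2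
  set J1 := jumpGenerator (fun _ z => 1 * shellKap d 0 (2 ^ n) z) v with hJ1
  set J2 := jumpGenerator (fun x z => (w s(x, x + z) - 1) * shellKap d 0 (cut n) z) v with hJ2
  set J3 := jumpGenerator (fun x z => (w s(x, x + z) - 1) * shellKap d (cut n) (2 ^ n) z) v with hJ3
  set J4 := jumpGenerator (fun x z => w s(x, x + z) * tailKap d n z) v with hJ4
  have hJ : ∀ x, jumpGenerator (rate w) v x = (J1 x + J2 x) + (J3 x + J4 x) := by
    intro x
    have e : rate w = fun x z => (1 * shellKap d 0 (2 ^ n) z +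
        (w s(x, x + z) - 1) * shellKap d 0 (cut n) z) +
        ((w s(x, x + z) - 1) * shellKap d (cut n) (2 ^ n) z + w s(x, x + z) * tailKap d n z) := by
      ext x z
      exact rate_eq_add w hcut x z
    rw [e, jumpGenerator_add (H1.add H2) (H3.add H4) hv2, jumpGenerator_add H1 H2 hv2,
      jumpGenerator_add H3 H4 hv2]
  have s2 := (summable_mul_of_sq (H2.summable_jumpGenerator_sq hv2) hh2).mul_left (speed k)
  have s3 := (summable_mul_of_sq (H3.summable_jumpGenerator_sq hv2) hh2).mul_left (speed k)
  have s4 := (summable_mul_of_sq (H4.summable_jumpGenerator_sq hv2) hh2).mul_left (speed k)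
  have hLap : Summable fun x => (a₀ * Laplacian.laplacian g (point k x)) ^ 2 := by
    have hs' : Summable fun x : Lattice d => (∑ i, pderiv i (pderiv i g) (point k x)) ^ 2 := by
      obtain ⟨B, hB⟩ := hg.exists_radius
      refine summable_sq_of_support (s := bigBox d B n) fun x hx => ?_
      exact Finset.sum_eq_zero fun i _ => eq_zero_of_notMem_bigBox hs.pos hs.lt
        (pderiv_eq_zero (pderiv_eq_zero hB i) i) hx
    simp only [hg.laplacian_eq, mul_pow]
    exact hs'.mul_left _
  have sJ1 : Summable fun x => (speed k * J1 x) ^ 2 := by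
    simp only [mul_pow]
    exact (H1.summable_jumpGenerator_sq hv2).mul_left _
  have s1 := summable_mul_of_sq (summable_sq_sub sJ1 hLap) hh2
  have hsplit : ∑' x, (lam * g (point k x) - a₀ * Laplacian.laplacian g (point k x) - lam * v x +
      speed k * jumpGenerator (rate w) v x) * (u x - v x) =
      (∑' x, (speed k * J1 x - a₀ * Laplacian.laplacian g (point k x)) * h x +
        speed k * ∑' x, J2 x * h x) + (speed k * ∑' x, J3 x * h x + speed k * ∑' x, J4 x * h x) := by
    rw [← tsum_mul_left, ← tsum_mul_left, ← tsum_mul_left, ← s1.tsum_add s2, ← s3.tsum_add s4,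
      ← (s1.add s2).tsum_add (s3.add s4)]
    refine tsum_congr fun x => ?_
    rw [hJ, hh, hv]
    ring
  rw [hsplit] at hE
  -- The only source of the iterated logarithm: `log (cut n) = 3 log (n + 1)`, and the `6` in `As`
  -- is `2 * 3`.
  have hS : √(∑ z ∈ shell d 0 (cut n), (nrm z ^ d)⁻¹) ≤ As * ρ := by
    rw [hAs, hρ, ← Real.sqrt_mul (by positivity)]
    apply Real.sqrt_le_sqrt
    have h6 := (abs_le.1 (h5 (cut n) (Nat.one_le_pow _ _ (Nat.succ_pos n)))).2
    have h7 : Real.log (cut n : ℝ) = 3 * Real.log (n + 1) := by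
      rw [cut]
      push_cast
      rw [Real.log_pow]
      norm_num
    rw [h7] at h6
    nlinarith [mul_nonneg hA₅.le hlogn, show 0 ≤ 6 * d * a₀ by positivity]
  have hb1 : A₁ / Real.log k * X * N ≤ A₁ / lo * (X * ρ / √(Real.log k)) * (N + Y) := by
    calc A₁ / Real.log k * X * N ≤ A₁ / lo / √(Real.log k) * X * N := by
          have := log_div_le_div_sqrt hs hA₁.le
          gcongr
      _ ≤ A₁ / lo / √(Real.log k) * (X * ρ) * (N + Y) := by
          gcongr
          · exact le_mul_of_one_le_right hX hρ1
          · linarith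
      _ = _ := by ring
  have hb4 : A₄ / Real.log k * X * N ≤ A₄ / lo * (X * ρ / √(Real.log k)) * (N + Y) := by
    calc A₄ / Real.log k * X * N ≤ A₄ / lo / √(Real.log k) * X * N := by
          have := log_div_le_div_sqrt hs hA₄.le
          gcongr
      _ ≤ A₄ / lo / √(Real.log k) * (X * ρ) * (N + Y) := by
          gcongr
          · exact le_mul_of_one_le_right hX hρ1
          · linarith
      _ = _ := by ring
  have hb2 : A₂ * X * (√(∑ z ∈ shell d 0 (cut n), (nrm z ^ d)⁻¹) / √(Real.log k)) * Y ≤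
      A₂ * As * (X * ρ / √(Real.log k)) * (N + Y) := by
    calc _ ≤ A₂ * X * (As * ρ / √(Real.log k)) * (N + Y) := by
          gcongr
          linarith
      _ = _ := by ring
  have hb3 : A₃ * X / √(Real.log k) * (N + Y) ≤ A₃ * (X * ρ / √(Real.log k)) * (N + Y) := by
    calc _ ≤ A₃ * (X * ρ) / √(Real.log k) * (N + Y) := by
          gcongr
          exact le_mul_of_one_le_right hX hρ1
      _ = _ := by ring
  -- All four pieces have been put over the common size `X * ρ / √(log k)`; the pieces without `ρ`
  -- use `ρ ≥ 1`, and those of order `1 / log k` use `log k ≥ log 2`.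
  have hquad : c * (N ^ 2 + Y ^ 2) ≤ At * (X * ρ / √(Real.log k)) * (N + Y) := by
    have e1 : c * (N ^ 2 + Y ^ 2) ≤ lam * N ^ 2 + speed k * C₁ / 2 * energy h := by
      have e2 : Y ^ 2 = speed k * energy h := energyNorm_sq hs.two_le h
      have e3 : speed k * C₁ / 2 * energy h = C₁ / 2 * Y ^ 2 := by
        rw [e2]
        ring
      rw [e3, mul_add]
      exact add_le_add (mul_le_mul_of_nonneg_right (min_le_left _ _) (sq_nonneg _))
        (mul_le_mul_of_nonneg_right (min_le_right _ _) (sq_nonneg _))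
    have f2 : speed k * ∑' x, J2 x * h x ≤ speed k * |∑' x, J2 x * h x| :=
      mul_le_mul_of_nonneg_left (le_abs_self _) hsp
    have f3 : speed k * ∑' x, J3 x * h x ≤ speed k * |∑' x, J3 x * h x| :=
      mul_le_mul_of_nonneg_left (le_abs_self _) hsp
    have f4 : speed k * ∑' x, J4 x * h x ≤ speed k * |∑' x, J4 x * h x| :=
      mul_le_mul_of_nonneg_left (le_abs_self _) hsp
    have f1 := le_abs_self (∑' x, (speed k * J1 x - a₀ * Laplacian.laplacian g (point k x)) * h x)
    have e4 : At * (X * ρ / √(Real.log k)) * (N + Y) =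
        A₁ / lo * (X * ρ / √(Real.log k)) * (N + Y) +
        A₂ * As * (X * ρ / √(Real.log k)) * (N + Y) + A₃ * (X * ρ / √(Real.log k)) * (N + Y) +
        A₄ / lo * (X * ρ / √(Real.log k)) * (N + Y) := by
      rw [hAt]
      ring
    rw [e4]
    linarith
  have hfin := add_le_of_quadratic hc hN hY (by positivity) hquad
  refine hfin.trans (le_of_eq ?_)
  rw [Real.sqrt_div (by linarith)]
  ring

end ErrorEstimate

/-! ### Variances of linear combinations of conductances. -/

section Variance

variable {Ω : Type*} [MeasurableSpace Ω] {P : Measure Ω} [IsProbabilityMeasure P] {C₁ C₂ : ℝ}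
  {w : Sym2 (Lattice d) → Ω → ℝ}

/-- Distinct edges are uncorrelated, by independence and the normalisation of the mean. -/
lemma IsConductance.integral_mul (hw : IsConductance P C₁ C₂ w) (hC₁ : 0 < C₁)
    {e e' : Sym2 (Lattice d)} (he : ¬ e.IsDiag) (he' : ¬ e'.IsDiag) (h : e ≠ e') :
    ∫ ω, (w e ω - 1) * (w e' ω - 1) ∂P = 0 := by
  have h1 := hw.indep.indepFun (i := ⟨e, he⟩) (j := ⟨e', he'⟩) (by simpa using h)
  have h2 := h1.comp (φ := fun t => t - 1) (ψ := fun t => t - 1) (by fun_prop) (by fun_prop)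
  have hm := (hw.measurable e he).sub_const 1
  have hm' := (hw.measurable e' he').sub_const 1
  have h3 : ∫ ω, w e ω - 1 ∂P = 0 := by
    rw [integral_sub, hw.mean_one e he]
    · simp
    · refine Integrable.of_bound (hw.measurable e he).aestronglyMeasurable C₂ (.of_forall fun ω => ?_)
      obtain ⟨a, b⟩ := hw.bounds e he ω
      rw [Real.norm_eq_abs, abs_le]
      constructor <;> linarith
    · exact integrable_const _
  have h4 := h2.integral_fun_mul_eq_mul_integral hm.aestronglyMeasurable hm'.aestronglyMeasurable
  simp only [Function.comp_apply, h3, zero_mul] at h4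
  exact h4

variable {ι : Type*} {s : Finset ι} {e : ι → Sym2 (Lattice d)}

/-- A linear combination of centred conductances in which each of them occurs at most twice. -/
theorem IsConductance.integral_sq_sum_le (hw : IsConductance P C₁ C₂ w) (hC₁ : 0 < C₁)
    (he : ∀ i ∈ s, ¬ (e i).IsDiag) (a : ι → ℝ)
    (hmult : ∀ i ∈ s, ∃ i', ∀ j ∈ s, e i = e j → j = i ∨ j = i') :
    ∫ ω, (∑ i ∈ s, a i * (w (e i) ω - 1)) ^ 2 ∂P ≤ 2 * (C₂ + 1) ^ 2 * ∑ i ∈ s, a i ^ 2 := by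
  classical
  have hK : ∀ i ∈ s, ∀ ω, |w (e i) ω - 1| ≤ C₂ + 1 := fun i hi ω =>
    abs_sub_one_le_of_bounds hC₁ (w := fun e => w e ω) (fun e he => hw.bounds e he ω) _ (he i hi)
  have hb : ∀ i ∈ s, ∀ j ∈ s, ∀ ω,
      |(w (e i) ω - 1) * (w (e j) ω - 1)| ≤ (C₂ + 1) ^ 2 := fun i hi j hj ω => by
    rw [abs_mul, sq]
    exact mul_le_mul (hK i hi ω) (hK j hj ω) (abs_nonneg _) ((abs_nonneg _).trans (hK i hi ω))
  have hint : ∀ i ∈ s, ∀ j ∈ s, Integrable (fun ω => (w (e i) ω - 1) * (w (e j) ω - 1)) P :=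
    fun i hi j hj => .of_bound (((hw.measurable _ (he i hi)).sub_const 1).mul
      ((hw.measurable _ (he j hj)).sub_const 1)).aestronglyMeasurable _ (.of_forall (hb i hi j hj))
  have h1 : ∀ ω, (∑ i ∈ s, a i * (w (e i) ω - 1)) ^ 2 =
      ∑ i ∈ s, ∑ j ∈ s, a i * a j * ((w (e i) ω - 1) * (w (e j) ω - 1)) := fun ω => by
    rw [sq, Finset.sum_mul_sum]
    exact Finset.sum_congr rfl fun i _ => Finset.sum_congr rfl fun j _ => by ring
  simp only [h1]
  rw [integral_finsetSum _ fun i hi => integrable_finsetSum _ fun j hj =>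
    (hint i hi j hj).const_mul _]
  have h2 : ∀ i ∈ s, ∀ j ∈ s, ∫ ω, a i * a j * ((w (e i) ω - 1) * (w (e j) ω - 1)) ∂P ≤
      if e i = e j then (C₂ + 1) ^ 2 / 2 * (a i ^ 2 + a j ^ 2) else 0 := by
    intro i hi j hj
    rw [integral_const_mul]
    split_ifs with h
    · have h3 : |∫ ω, (w (e i) ω - 1) * (w (e j) ω - 1) ∂P| ≤ (C₂ + 1) ^ 2 := by
        have := norm_integral_le_of_norm_le_const (μ := P) (C := (C₂ + 1) ^ 2)
          (f := fun ω => (w (e i) ω - 1) * (w (e j) ω - 1)) (.of_forall (hb i hi j hj))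
        simpa using this
      -- This bound on the cross terms lets the double sum be symmetrised to `a i ^ 2`, after which
      -- each index `i` has at most two partners.
      have h4 : |a i * a j| ≤ (a i ^ 2 + a j ^ 2) / 2 := by
        rw [abs_mul, ← sq_abs (a i), ← sq_abs (a j)]
        linarith [two_mul_le_add_sq |a i| |a j|]
      calc _ ≤ |a i * a j * ∫ ω, (w (e i) ω - 1) * (w (e j) ω - 1) ∂P| := le_abs_self _
        _ ≤ (a i ^ 2 + a j ^ 2) / 2 * (C₂ + 1) ^ 2 := by
          rw [abs_mul]
          exact mul_le_mul h4 h3 (abs_nonneg _) (by positivity)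
        _ = _ := by ring
    · rw [hw.integral_mul hC₁ (he i hi) (he j hj) h, mul_zero]
  calc _ ≤ ∑ i ∈ s, ∑ j ∈ s, if e i = e j then (C₂ + 1) ^ 2 / 2 * (a i ^ 2 + a j ^ 2) else 0 := by
        refine Finset.sum_le_sum fun i hi => ?_
        rw [integral_finsetSum _ fun j hj => (hint i hi j hj).const_mul _]
        exact Finset.sum_le_sum fun j hj => h2 i hi j hj
    _ = ∑ i ∈ s, ∑ j ∈ s, if e i = e j then (C₂ + 1) ^ 2 * a i ^ 2 else 0 := by
        have h5 : ∑ i ∈ s, ∑ j ∈ s, (if e i = e j then (C₂ + 1) ^ 2 / 2 * a j ^ 2 else 0) =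
            ∑ i ∈ s, ∑ j ∈ s, if e i = e j then (C₂ + 1) ^ 2 / 2 * a i ^ 2 else 0 := by
          rw [Finset.sum_comm]
          simp only [eq_comm]
        have h6 : ∀ (p : Prop) [Decidable p] (x y : ℝ),
            (if p then (C₂ + 1) ^ 2 / 2 * (x + y) else 0) =
              (if p then (C₂ + 1) ^ 2 / 2 * x else 0) + if p then (C₂ + 1) ^ 2 / 2 * y else 0 := by
          intro p _ x y
          split_ifs <;> ring
        simp only [h6, Finset.sum_add_distrib]
        rw [h5]
        simp only [← Finset.sum_add_distrib]
        refine Finset.sum_congr rfl fun i _ => Finset.sum_congr rfl fun j _ => ?_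
        split_ifs <;> ring
    _ ≤ ∑ i ∈ s, 2 * (C₂ + 1) ^ 2 * a i ^ 2 := by
        refine Finset.sum_le_sum fun i hi => ?_
        obtain ⟨i', hi'⟩ := hmult i hi
        rw [← Finset.sum_filter, Finset.sum_const, nsmul_eq_mul]
        have hc : (s.filter fun j => e i = e j).card ≤ 2 :=
          (Finset.card_le_card (t := {i, i'}) fun j hj => by
            rw [Finset.mem_filter] at hj
            simpa using hi' j hj.1 hj.2).trans Finset.card_le_two
        have hc' : ((s.filter fun j => e i = e j).card : ℝ) ≤ 2 := by exact_mod_cast hc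
        rw [mul_assoc 2]
        gcongr
    _ = _ := by rw [Finset.mul_sum]

lemma edge_eq_edge {x z x' z' : Lattice d} (h : s(x, x + z) = s(x', x' + z')) :
    (x' = x ∧ z' = z) ∨ (x' = x + z ∧ z' = -z) := by
  rw [Sym2.eq_iff] at h
  rcases h with ⟨h1, h2⟩ | ⟨h1, h2⟩
  · left
    subst h1
    exact ⟨rfl, (add_left_cancel h2).symm⟩
  · right
    refine ⟨h2.symm, ?_⟩
    rw [← h2, add_assoc] at h1
    have := left_eq_add.1 h1
    exact eq_neg_of_add_eq_zero_right this

lemma IsConductance.integral_sq_sum_edges_le (hw : IsConductance P C₁ C₂ w) (hC₁ : 0 < C₁)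
    (T S : Finset (Lattice d)) (hS : ∀ z ∈ S, z ≠ 0) (b : Lattice d → ℝ) (x : Lattice d) :
    ∫ ω, (∑ c ∈ T, ∑ z ∈ S, b z * (w s(x - c, x - c + z) ω - 1)) ^ 2 ∂P ≤
      2 * (C₂ + 1) ^ 2 * (T.card * ∑ z ∈ S, b z ^ 2) := by
  have h := hw.integral_sq_sum_le hC₁ (s := T ×ˢ S) (e := fun p => s(x - p.1, x - p.1 + p.2))
    (fun p hp => not_isDiag_add (hS _ (Finset.mem_product.1 hp).2)) (fun p => b p.2)
    -- The same edge is reached a second time only from its other endpoint, by the reversed jump.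
    (fun p hp => ⟨(p.1 - p.2, -p.2), fun q hq h => by
      rcases edge_eq_edge h with ⟨h1, h2⟩ | ⟨h1, h2⟩
      · exact Or.inl (Prod.ext (sub_right_injective h1) h2)
      · right
        refine Prod.ext ?_ h2
        have : x - q.1 = x - (p.1 - p.2) := by rw [h1]; abel
        exact sub_right_injective this⟩)
  simpa [Finset.sum_product] using h

end Variance

/-! ### Almost surely all large scales are good. -/

section Probability

variable {Ω : Type*} [MeasurableSpace Ω] {P : Measure Ω} {C₁ C₂ : ℝ}
  {w : Sym2 (Lattice d) → Ω → ℝ}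

lemma IsConductance.measurable_fluct (hw : IsConductance P C₁ C₂ w) (n : ℕ) (i : Fin d)
    (x : Lattice d) : Measurable fun ω => fluct (fun e => w e ω) n i x :=
  Finset.measurable_fun_sum _ fun _ hz => ((((hw.measurable _
    (not_isDiag_add (ne_zero_of_mem_shell hz))).sub_const 1).mul_const _).mul_const _)

lemma IsConductance.measurable_fluct₂ (hw : IsConductance P C₁ C₂ w) (n : ℕ) (i j : Fin d)
    (x : Lattice d) : Measurable fun ω => fluct₂ (fun e => w e ω) n i j x :=
  Finset.measurable_fun_sum _ fun _ hz => ((((hw.measurable _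
    (not_isDiag_add (ne_zero_of_mem_shell hz))).sub_const 1).mul_const _).mul_const _)

lemma IsConductance.measurable_cubeAvgAdj (hw : IsConductance P C₁ C₂ w) (n j : ℕ) (i : Fin d)
    (x : Lattice d) : Measurable fun ω => cubeAvgAdj j (fluct (fun e => w e ω) n i) x :=
  (Finset.measurable_fun_sum _ fun _ _ => hw.measurable_fluct n i _).const_mul _

lemma IsConductance.measurable_fluctSize (hw : IsConductance P C₁ C₂ w) (n b : ℕ) :
    Measurable fun ω => fluctSize (fun e => w e ω) n b := by
  have h1 := fun i j x => hw.measurable_cubeAvgAdj n j i x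
  have h2 := hw.measurable_fluct₂ n
  unfold fluctSize
  fun_prop

lemma fluctSize_nonneg (w : Sym2 (Lattice d) → ℝ) (n b : ℕ) : 0 ≤ fluctSize w n b := by
  unfold fluctSize
  positivity

section moments

variable [IsProbabilityMeasure P]

lemma IsConductance.memLp (hw : IsConductance P C₁ C₂ w) (hC₁ : 0 < C₁) {e : Sym2 (Lattice d)}
    (he : ¬ e.IsDiag) : MemLp (fun ω => w e ω - 1) 2 P :=
  .of_bound ((hw.measurable e he).sub_const 1).aestronglyMeasurable (C₂ + 1) (.of_forall fun ω =>
    abs_sub_one_le_of_bounds hC₁ (w := fun e => w e ω) (fun e he => hw.bounds e he ω) e he)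

lemma IsConductance.memLp_fluct (hw : IsConductance P C₁ C₂ w) (hC₁ : 0 < C₁) (n : ℕ) (i : Fin d)
    (x : Lattice d) : MemLp (fun ω => fluct (fun e => w e ω) n i x) 2 P :=
  memLp_finsetSum _ fun _ hz =>
    ((hw.memLp hC₁ (not_isDiag_add (ne_zero_of_mem_shell hz))).mul_const _).mul_const _

lemma IsConductance.memLp_fluct₂ (hw : IsConductance P C₁ C₂ w) (hC₁ : 0 < C₁) (n : ℕ)
    (i j : Fin d) (x : Lattice d) : MemLp (fun ω => fluct₂ (fun e => w e ω) n i j x) 2 P :=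
  memLp_finsetSum _ fun _ hz =>
    ((hw.memLp hC₁ (not_isDiag_add (ne_zero_of_mem_shell hz))).mul_const _).mul_const _

lemma IsConductance.memLp_cubeAvgAdj (hw : IsConductance P C₁ C₂ w) (hC₁ : 0 < C₁) (n j : ℕ)
    (i : Fin d) (x : Lattice d) :
    MemLp (fun ω => cubeAvgAdj j (fluct (fun e => w e ω) n i) x) 2 P :=
  (memLp_finsetSum _ fun _ _ => hw.memLp_fluct hC₁ n i _).const_mul _

/-- The cubic growth of `cut n` becomes the power `6` here. The later steps spend it: one power on
the number of averaging scales, two on summability over `n`, and the rest on the bound required of a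
good scale. -/
lemma sum_shell_sq_le (hd : 4 ≤ d) (n : ℕ) {b : Lattice d → ℝ}
    (hb : ∀ z ∈ shell d (cut n) (2 ^ n), |b z| ≤ kap z * nrm z ^ 2) :
    ∑ z ∈ shell d (cut n) (2 ^ n), b z ^ 2 ≤ ((n + 1 : ℝ) ^ 6)⁻¹ * ∑' z : Lattice d, kap z := by
  have h1 : ∑ z ∈ shell d (cut n) (2 ^ n), kap z ≤ ∑' z : Lattice d, kap z :=
    (summable_kap (by omega)).sum_le_tsum _ fun z _ => kap_nonneg z
  calc _ ≤ ∑ z ∈ shell d (cut n) (2 ^ n), ((cut n : ℝ) ^ 2)⁻¹ * kap z := by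
        refine Finset.sum_le_sum fun z hz => ?_
        calc b z ^ 2 = |b z| ^ 2 := (sq_abs _).symm
          _ ≤ (kap z * nrm z ^ 2) ^ 2 := pow_le_pow_left₀ (abs_nonneg _) (hb z hz) 2
          _ = kap z ^ 2 * nrm z ^ 4 := by ring
          _ ≤ _ := kap_sq_mul_nrm_le hd (Nat.one_le_pow _ _ n.succ_pos) hz
    _ = ((n + 1 : ℝ) ^ 6)⁻¹ * ∑ z ∈ shell d (cut n) (2 ^ n), kap z := by
        rw [← Finset.mul_sum, cut]
        push_cast
        ring
    _ ≤ _ := by gcongr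

/-- An average over `2^(jd)` points behaves as one of almost independent variables, although
neighbouring sums share edges, since the sharing is at most twofold. -/
lemma IsConductance.integral_cubeAvgAdj_sq_le (hw : IsConductance P C₁ C₂ w) (hC₁ : 0 < C₁)
    (hd : 4 ≤ d) (n j : ℕ) (i : Fin d) (x : Lattice d) :
    ((2 : ℝ) ^ j) ^ d * ∫ ω, cubeAvgAdj j (fluct (fun e => w e ω) n i) x ^ 2 ∂P ≤
      2 * (C₂ + 1) ^ 2 * (∑' z : Lattice d, kap z) * ((n + 1 : ℝ) ^ 6)⁻¹ := by
  have h1 := hw.integral_sq_sum_edges_le hC₁ (cube d j) (shell d (cut n) (2 ^ n))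
    (fun z hz => ne_zero_of_mem_shell hz) (fun z => kap z * z i) x
  have h2 := sum_shell_sq_le hd n (b := fun z => kap z * z i) fun z hz => by
    rw [abs_mul, abs_of_nonneg (kap_nonneg z)]
    refine mul_le_mul_of_nonneg_left ((abs_le_nrm z i).trans ?_) (kap_nonneg z)
    exact le_self_pow₀ (one_le_nrm (ne_zero_of_mem_shell hz)) two_ne_zero
  have e : ∀ ω, cubeAvgAdj j (fluct (fun e => w e ω) n i) x ^ 2 = ((((2 : ℝ) ^ j) ^ d)⁻¹) ^ 2 *
      (∑ c ∈ cube d j, ∑ z ∈ shell d (cut n) (2 ^ n),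
        kap z * z i * (w s(x - c, x - c + z) ω - 1)) ^ 2 := fun ω => by
    rw [← mul_pow, cubeAvgAdj]
    congr 2
    refine Finset.sum_congr rfl fun c _ => Finset.sum_congr rfl fun z _ => ?_
    ring
  simp only [e]
  rw [integral_const_mul]
  rw [card_cube] at h1
  push_cast at h1
  calc _ ≤ ((2 : ℝ) ^ j) ^ d * (((((2 : ℝ) ^ j) ^ d)⁻¹) ^ 2 * (2 * (C₂ + 1) ^ 2 *
        (((2 : ℝ) ^ j) ^ d * (((n + 1 : ℝ) ^ 6)⁻¹ * ∑' z : Lattice d, kap z)))) := by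
        gcongr
        refine h1.trans ?_
        gcongr
    _ = _ := by
        field_simp

lemma IsConductance.integral_fluct₂_sq_le (hw : IsConductance P C₁ C₂ w) (hC₁ : 0 < C₁)
    (hd : 4 ≤ d) (n : ℕ) (i j : Fin d) (x : Lattice d) :
    ∫ ω, fluct₂ (fun e => w e ω) n i j x ^ 2 ∂P ≤
      2 * (C₂ + 1) ^ 2 * (∑' z : Lattice d, kap z) * ((n + 1 : ℝ) ^ 6)⁻¹ := by
  have h1 := hw.integral_sq_sum_edges_le hC₁ {0} (shell d (cut n) (2 ^ n))
    (fun z hz => ne_zero_of_mem_shell hz) (fun z => kap z * (z i * z j)) x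
  have h2 := sum_shell_sq_le hd n (b := fun z => kap z * (z i * z j)) fun z hz => by
    rw [abs_mul, abs_of_nonneg (kap_nonneg z), abs_mul, sq]
    exact mul_le_mul_of_nonneg_left (mul_le_mul (abs_le_nrm z i) (abs_le_nrm z j) (abs_nonneg _)
      (nrm_nonneg z)) (kap_nonneg z)
  have e : ∀ ω, fluct₂ (fun e => w e ω) n i j x = ∑ c ∈ ({0} : Finset (Lattice d)),
      ∑ z ∈ shell d (cut n) (2 ^ n), kap z * (z i * z j) * (w s(x - c, x - c + z) ω - 1) :=
    fun ω => by
      rw [Finset.sum_singleton, sub_zero, fluct₂, moment₂]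
      refine Finset.sum_congr rfl fun z _ => ?_
      ring
  simp only [e]
  refine h1.trans ?_
  rw [Finset.card_singleton, Nat.cast_one, one_mul, mul_assoc _ (∑' z : Lattice d, kap z),
    mul_comm (∑' z : Lattice d, kap z)]
  gcongr

lemma IsConductance.integrable_fluctSize (hw : IsConductance P C₁ C₂ w) (hC₁ : 0 < C₁) (n b : ℕ) :
    Integrable (fun ω => fluctSize (fun e => w e ω) n b) P :=
  integrable_finsetSum _ fun x _ => (integrable_finsetSum _ fun i _ => integrable_finsetSum _
    fun j _ => (hw.memLp_cubeAvgAdj hC₁ n j i x).integrable_sq.const_mul _).add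
    (integrable_finsetSum _ fun i _ => integrable_finsetSum _
      fun j _ => (hw.memLp_fluct₂ hC₁ n i j x).integrable_sq)

lemma IsConductance.integral_fluctSize_le (hw : IsConductance P C₁ C₂ w) (hC₁ : 0 < C₁)
    (hd : 4 ≤ d) (n b : ℕ) : ∫ ω, fluctSize (fun e => w e ω) n b ∂P ≤
      2 ^ d * (d + d ^ 2) * (2 * (C₂ + 1) ^ 2 * ∑' z : Lattice d, kap z) *
        (b + 1 : ℝ) ^ d * ((2 : ℝ) ^ n) ^ d / (n + 1 : ℝ) ^ 5 := by
  set A := 2 * (C₂ + 1) ^ 2 * ∑' z : Lattice d, kap z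
  have hA : 0 ≤ A := mul_nonneg (by positivity) (tsum_nonneg kap_nonneg)
  have i1 := fun x i j => (hw.memLp_cubeAvgAdj hC₁ n j i x).integrable_sq
  have i2 := fun x i j => (hw.memLp_fluct₂ hC₁ n i j x).integrable_sq
  unfold fluctSize
  refine (integral_finsetSum _ fun x _ => Integrable.add (integrable_finsetSum _ fun i _ =>
    integrable_finsetSum _ fun j _ => (i1 x i j).const_mul _)
    (integrable_finsetSum _ fun i _ => integrable_finsetSum _ fun j _ => i2 x i j)).trans_le ?_
  have hx : ∀ x : Lattice d, ∫ ω, (∑ i, ∑ j ∈ Finset.range (n + 1),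
      ((2 : ℝ) ^ j) ^ d * cubeAvgAdj j (fluct (fun e => w e ω) n i) x ^ 2 +
      ∑ i, ∑ j, fluct₂ (fun e => w e ω) n i j x ^ 2) ∂P ≤
      (d + d ^ 2) * A / (n + 1 : ℝ) ^ 5 := by
    intro x
    rw [integral_add (integrable_finsetSum _ fun i _ => integrable_finsetSum _
      fun j _ => (i1 x i j).const_mul _)
      (integrable_finsetSum _ fun i _ => integrable_finsetSum _ fun j _ => i2 x i j),
      integral_finsetSum _ fun i _ => integrable_finsetSum _ fun j _ => (i1 x i j).const_mul _,
      integral_finsetSum _ fun i _ => integrable_finsetSum _ fun j _ => i2 x i j]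
    have h1 : ∑ i : Fin d, ∫ ω, ∑ j ∈ Finset.range (n + 1),
        ((2 : ℝ) ^ j) ^ d * cubeAvgAdj j (fluct (fun e => w e ω) n i) x ^ 2 ∂P ≤
        ∑ _i : Fin d, ∑ _j ∈ Finset.range (n + 1), A * ((n + 1 : ℝ) ^ 6)⁻¹ := by
      refine Finset.sum_le_sum fun i _ => ?_
      rw [integral_finsetSum _ fun j _ => (i1 x i j).const_mul _]
      refine Finset.sum_le_sum fun j _ => ?_
      rw [integral_const_mul]
      exact hw.integral_cubeAvgAdj_sq_le hC₁ hd n j i x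
    have h2 : ∑ i : Fin d, ∫ ω, ∑ j, fluct₂ (fun e => w e ω) n i j x ^ 2 ∂P ≤
        ∑ _i : Fin d, ∑ _j : Fin d, A * ((n + 1 : ℝ) ^ 6)⁻¹ := by
      refine Finset.sum_le_sum fun i _ => ?_
      rw [integral_finsetSum _ fun j _ => i2 x i j]
      exact Finset.sum_le_sum fun j _ => hw.integral_fluct₂_sq_le hC₁ hd n i j x
    refine (add_le_add h1 h2).trans ?_
    simp only [Finset.sum_const, Finset.card_univ, Fintype.card_fin, Finset.card_range,
      nsmul_eq_mul]
    push_cast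
    -- The `n + 1` values of `j` cost one power.
    have h3 : (n + 1 : ℝ) * ((n + 1 : ℝ) ^ 6)⁻¹ = ((n + 1 : ℝ) ^ 5)⁻¹ := by
      field_simp
    have h4 : ((n + 1 : ℝ) ^ 6)⁻¹ ≤ ((n + 1 : ℝ) ^ 5)⁻¹ := by
      gcongr
      · linarith [show (0 : ℝ) ≤ n by positivity]
      · norm_num
    calc _ = d * A * ((n + 1 : ℝ) * ((n + 1 : ℝ) ^ 6)⁻¹) +
          d ^ 2 * A * ((n + 1 : ℝ) ^ 6)⁻¹ := by ring
      _ ≤ d * A * ((n + 1 : ℝ) ^ 5)⁻¹ + d ^ 2 * A * ((n + 1 : ℝ) ^ 5)⁻¹ := by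
        rw [h3]
        gcongr
      _ = _ := by ring
  have hcard : ((box d (b * 2 ^ n)).card : ℝ) ≤ (2 * ((b + 1) * 2 ^ n)) ^ d := by
    rw [card_box]
    push_cast
    have := one_le_pow₀ (n := n) (one_le_two (α := ℝ))
    gcongr
    linarith
  calc _ ≤ ∑ x ∈ box d (b * 2 ^ n), (d + d ^ 2) * A / (n + 1 : ℝ) ^ 5 :=
        Finset.sum_le_sum fun x _ => hx x
    _ ≤ (2 * ((b + 1) * 2 ^ n)) ^ d * ((d + d ^ 2) * A / (n + 1 : ℝ) ^ 5) := by
        rw [Finset.sum_const, nsmul_eq_mul]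
        gcongr
    _ = _ := by
        rw [mul_pow, mul_pow]
        ring

/-- Almost surely, all large scales are good. -/
theorem IsConductance.exists_isGoodScale (hw : IsConductance P C₁ C₂ w) (hC₁ : 0 < C₁)
    (hd : 4 ≤ d) : ∃ N : Ω → ℕ, Measurable N ∧
      ∀ᵐ ω ∂P, ∀ n, N ω ≤ n → IsGoodScale (fun e => w e ω) n := by
  set A := 2 ^ d * (d + d ^ 2) * (2 * (C₂ + 1) ^ 2 * ∑' z : Lattice d, kap z) with hAdef
  have hA : 0 ≤ A := mul_nonneg (by positivity)
    (mul_nonneg (by positivity) (tsum_nonneg kap_nonneg))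
  -- The weight is chosen so that the expectation is summable over scales and boxes, as `(n+1)^(-2)
  -- (b+1)^(-2)`, whereas `F ≤ n + 1` is exactly the defining bound of a good scale. The two spare
  -- powers of `b + 1` allow all boxes at once, so the threshold does not depend on the support of
  -- the test function.
  let F : ℕ × ℕ → Ω → ℝ := fun p ω => (p.1 + 1 : ℝ) ^ 3 *
    ((p.2 + 1 : ℝ) ^ (d + 2) * ((2 : ℝ) ^ p.1) ^ d)⁻¹ * fluctSize (fun e => w e ω) p.1 p.2
  have hF0 : ∀ p ω, 0 ≤ F p ω := fun p ω => mul_nonneg (by positivity) (fluctSize_nonneg _ _ _)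
  have hFm : ∀ p, Measurable (F p) := fun p => (hw.measurable_fluctSize _ _).const_mul _
  have hFi : ∀ p, Integrable (F p) P := fun p => (hw.integrable_fluctSize hC₁ _ _).const_mul _
  have hFle : ∀ p, ∫ ω, F p ω ∂P ≤ A * (((p.1 + 1 : ℝ) ^ 2)⁻¹ * ((p.2 + 1 : ℝ) ^ 2)⁻¹) := by
    intro p
    rw [integral_const_mul]
    calc _ ≤ (p.1 + 1 : ℝ) ^ 3 * ((p.2 + 1 : ℝ) ^ (d + 2) * ((2 : ℝ) ^ p.1) ^ d)⁻¹ *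
          (A * (p.2 + 1 : ℝ) ^ d * ((2 : ℝ) ^ p.1) ^ d / (p.1 + 1 : ℝ) ^ 5) := by
          gcongr
          exact hw.integral_fluctSize_le hC₁ hd _ _
      _ = _ := by
          field_simp
          ring
  have hsum1 : Summable fun n : ℕ => ((n + 1 : ℝ) ^ 2)⁻¹ := by
    have := (summable_nat_add_iff 1).2 (Real.summable_nat_pow_inv (p := 2) |>.2 one_lt_two)
    exact_mod_cast this
  have hsum : Summable fun p : ℕ × ℕ => A * (((p.1 + 1 : ℝ) ^ 2)⁻¹ * ((p.2 + 1 : ℝ) ^ 2)⁻¹) :=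
    (hsum1.mul_of_nonneg hsum1 (fun n => by positivity) (fun n => by positivity)).mul_left A
  let S : Ω → ℝ≥0∞ := fun ω => ∑' p, ENNReal.ofReal (F p ω)
  have hSm : Measurable S := Measurable.tsum fun p => (hFm p).ennreal_ofReal
  have hS : ∫⁻ ω, S ω ∂P ≠ ∞ := by
    rw [lintegral_tsum fun p => (hFm p).ennreal_ofReal.aemeasurable]
    refine ne_top_of_le_ne_top hsum.tsum_ofReal_ne_top (ENNReal.tsum_le_tsum fun p => ?_)
    rw [← ofReal_integral_eq_lintegral_ofReal (hFi p) (.of_forall (hF0 p))]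
    exact ENNReal.ofReal_le_ofReal (hFle p)
  -- Each term is at most the sum `S`, hence at most `n + 1` as soon as `n` exceeds `S`. On the null
  -- event `S = ∞` the value is irrelevant.
  refine ⟨fun ω => ⌈(S ω).toReal⌉₊, Nat.measurable_ceil.comp hSm.ennreal_toReal, ?_⟩
  filter_upwards [ae_lt_top hSm hS] with ω hω n hn b
  have h1 : ENNReal.ofReal (F (n, b) ω) ≤ S ω := ENNReal.le_tsum (n, b)
  have h2 : F (n, b) ω ≤ (S ω).toReal := by
    rw [← ENNReal.toReal_ofReal (hF0 (n, b) ω)]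
    exact ENNReal.toReal_mono hω.ne h1
  have h3 : F (n, b) ω ≤ n + 1 := by
    have := Nat.ceil_le.1 hn
    linarith
  simp only [F] at h3
  rw [le_div_iff₀ (by positivity)]
  rw [mul_assoc, mul_comm ((b + 1 : ℝ) ^ (d + 2) * ((2 : ℝ) ^ n) ^ d)⁻¹, ← div_eq_mul_inv,
    ← mul_div_assoc, div_le_iff₀ (by positivity)] at h3
  have h4 : (0 : ℝ) < n + 1 := by positivity
  refine le_of_mul_le_mul_left ?_ h4
  linarith [h3]

end moments

end Probability

/-! ### From the scaled lattice to the whole space, and elementary rates. -/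

section Extension

/-- The base case is `12^3 = 1728 ≤ 2048`. -/
lemma cut_le_two_pow {n : ℕ} (hn : 11 ≤ n) : cut n ≤ 2 ^ n := by
  induction n, hn using Nat.le_induction with
  | base => norm_num [cut]
  | succ n hn ih =>
    rw [cut] at ih ⊢
    rw [pow_succ 2 n]
    have h1 : 11 * n ^ 2 ≤ n * n ^ 2 := Nat.mul_le_mul_right _ hn
    have h2 : 11 * n ≤ n * n := Nat.mul_le_mul_right _ hn
    have h3 : (n + 1 + 1) ^ 3 = n * n ^ 2 + 6 * n ^ 2 + 12 * n + 8 := by ring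
    have h4 : (n + 1) ^ 3 = n * n ^ 2 + 3 * n ^ 2 + 3 * n + 1 := by ring
    rw [h4] at ih
    rw [h3]
    nlinarith

lemma isLogScale_log {k : ℕ} (hk : 2 ≤ k) : IsLogScale k (Nat.log 2 k) where
  two_le := hk
  le := Nat.pow_log_le_self 2 (by omega)
  lt := Nat.lt_pow_succ_log_self one_lt_two k

/-- Cells have volume `k^(-d)`, and `scaleFactor d k` is the square root of `k^d`. -/
lemma eLpNorm_two_extendCells {k : ℕ} (hk : 0 < k) {h : Lattice d → ℝ}
    (hh : Summable fun x => h x ^ 2) :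
    eLpNorm (extendCells k h) 2 volume = ENNReal.ofReal (ell2 h / scaleFactor d k) := by
  have hk' : (0 : ℝ) < k := by exact_mod_cast hk
  have e : ∫⁻ x, ‖extendCells k h x‖ₑ ^ (2 : ℝ) = ENNReal.ofReal ((ell2 h / scaleFactor d k) ^ 2) := by
    have h1 := lintegral_cells hk fun z => ENNReal.ofReal (h z ^ 2)
    rw [← ENNReal.ofReal_tsum_of_nonneg (fun z => sq_nonneg _) hh, ← ENNReal.ofReal_mul
      (by positivity)] at h1
    rw [div_pow, ell2_sq, scaleFactor, Real.sq_sqrt (by positivity), div_eq_inv_mul, ← h1]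
    refine lintegral_congr fun x => ?_
    rw [extendCells_eq, Real.enorm_eq_ofReal_abs, ENNReal.rpow_two, ← ENNReal.ofReal_pow (abs_nonneg _),
      sq_abs]
  have h0 : 0 ≤ ell2 h / scaleFactor d k :=
    div_nonneg (Real.sqrt_nonneg _) (scaleFactor_nonneg d k)
  rw [eLpNorm_eq_lintegral_rpow_enorm_toReal two_ne_zero ENNReal.ofNat_ne_top, ENNReal.toReal_ofNat, e,
    ENNReal.ofReal_rpow_of_nonneg (by positivity) (by positivity), ← Real.sqrt_eq_rpow,
    Real.sqrt_sq h0]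

lemma measurable_extendCells (k : ℕ) (h : Lattice d → ℝ) : Measurable (extendCells k h) :=
  (measurable_of_countable h).comp (measurable_cellIndex k)

/-- A test function is close to its restriction to the scaled lattice. -/
lemma IsTest.exists_eLpNorm_extendCells_sub_le {g : Space d → ℝ} (hg : IsTest g) :
    ∃ C : ℝ, 0 < C ∧ ∀ k : ℕ, 2 ≤ k →
      eLpNorm (fun x => extendCells k (fun z => g (point k z)) x - g x) 2 volume ≤
        ENNReal.ofReal (C / k) := by
  obtain ⟨L, hL, hgL⟩ := hg.exists_lipschitz
  obtain ⟨B, hB⟩ := hg.exists_radius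
  -- A point and the corner of its cell are within `√d / k ≤ √d`, so outside this ball both values
  -- of `g` vanish; inside, the Lipschitz bound applies.
  set s := Metric.closedBall (0 : Space d) (B + √d)
  have hs : volume s ≠ ∞ := (isCompact_closedBall _ _).measure_ne_top
  refine ⟨L * √d * (volume s ^ (1 / 2 : ℝ)).toReal + 1, by positivity, fun k hk => ?_⟩
  have hk' : (2 : ℝ) ≤ k := by exact_mod_cast hk
  have h1 : ∀ x, ‖extendCells k (fun z => g (point k z)) x - g x‖ ≤
      ‖s.indicator (fun _ => L * (√d / k)) x‖ := fun x => by
    have h2 := norm_sub_point_cellIndex_le (by omega : 0 < k) x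
    rw [extendCells_eq]
    by_cases hx : x ∈ s
    · rw [Set.indicator_of_mem hx, Real.norm_eq_abs, Real.norm_eq_abs,
        abs_of_nonneg (a := L * (√d / k)) (by positivity)]
      have h3 := hgL x (point k (cellIndex k x) - x)
      rw [add_sub_cancel, norm_sub_rev] at h3
      exact h3.trans (by gcongr)
    · rw [mem_closedBall_zero_iff, not_le] at hx
      have h4 : √d / k ≤ √d := div_le_self (by positivity) (by linarith)
      have h5 : ‖x‖ ≤ ‖x - point k (cellIndex k x)‖ + ‖point k (cellIndex k x)‖ := by
        simpa using norm_add_le (x - point k (cellIndex k x)) (point k (cellIndex k x))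
      have h6 : 0 ≤ √d := Real.sqrt_nonneg _
      rw [hB x (by linarith), hB (point k (cellIndex k x)) (by linarith)]
      simp
  refine (eLpNorm_mono h1).trans ?_
  rw [eLpNorm_indicator_const measurableSet_closedBall two_ne_zero ENNReal.ofNat_ne_top,
    ENNReal.toReal_ofNat, Real.enorm_eq_ofReal (by positivity),
    ← ENNReal.ofReal_toReal (ENNReal.rpow_ne_top_of_nonneg (y := 1 / 2) (by norm_num) hs),
    ← ENNReal.ofReal_mul (by positivity)]
  refine ENNReal.ofReal_le_ofReal ?_
  rw [ENNReal.toReal_ofReal ENNReal.toReal_nonneg]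
  have : L * (√d / k) * (volume s ^ (1 / 2 : ℝ)).toReal =
    L * √d * (volume s ^ (1 / 2 : ℝ)).toReal / k := by ring
  rw [this]
  gcongr
  linarith

/-- As `n + 1` is at most a multiple of `log k`, the inequality `log x ≤ x^δ / δ` trades the
iterated logarithm for an arbitrarily small power of `log k`. -/
lemma exists_sqrt_log_le {δ : ℝ} (hδ : 0 < δ) : ∃ C : ℝ, 0 < C ∧ ∀ k n : ℕ, IsLogScale k n →
    √((1 + Real.log (n + 1)) / Real.log k) ≤ C * Real.log k ^ (-(1 / 2 : ℝ) + δ / 2) := by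
  have hl2 := Real.log_pos one_lt_two
  set A := (1 + δ⁻¹) * (2 / Real.log 2) ^ δ
  refine ⟨√A, by positivity, fun k n hs => ?_⟩
  have hl := hs.log_pos
  have h2 := hs.log_two_le
  have h1 : (n + 1 : ℝ) ≤ 2 / Real.log 2 * Real.log k := by
    rw [div_mul_eq_mul_div, le_div_iff₀ hl2]
    linarith [hs.mul_log_two_le]
  have h3 : (1 : ℝ) ≤ 2 / Real.log 2 * Real.log k := by
    linarith [show (0 : ℝ) ≤ n by positivity]
  have h4 : Real.log (n + 1) ≤ (2 / Real.log 2 * Real.log k) ^ δ / δ :=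
    (Real.log_le_rpow_div (by positivity) hδ).trans (by gcongr)
  have h5 := Real.one_le_rpow h3 hδ.le
  have h6 : 1 + Real.log (n + 1) ≤ A * Real.log k ^ δ := by
    calc _ ≤ (2 / Real.log 2 * Real.log k) ^ δ + (2 / Real.log 2 * Real.log k) ^ δ / δ :=
          add_le_add h5 h4
      _ = _ := by
          rw [Real.mul_rpow (by positivity) hl.le]
          ring
  have h7 : Real.log k ^ (-(1 / 2 : ℝ) + δ / 2) = √(Real.log k ^ δ / Real.log k) := by
    nth_rewrite 3 [← Real.rpow_one (Real.log k)]
    rw [← Real.rpow_sub hl, Real.sqrt_eq_rpow, ← Real.rpow_mul hl.le]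
    congr 1
    ring
  rw [h7, ← Real.sqrt_mul (by positivity)]
  refine Real.sqrt_le_sqrt ?_
  rw [← mul_div_assoc]
  gcongr

lemma exists_inv_le {δ : ℝ} (hδ : 0 < δ) : ∃ C : ℝ, 0 < C ∧ ∀ k : ℕ, 2 ≤ k →
    1 / (k : ℝ) ≤ C * Real.log k ^ (-(1 / 2 : ℝ) + δ / 2) := by
  have hl2 := Real.log_pos one_lt_two
  refine ⟨(Real.log 2 ^ (1 / 2 + δ / 2))⁻¹, by positivity, fun k hk => ?_⟩
  have hl := log_pos_of_two_le hk
  have hk' : (2 : ℝ) ≤ k := by exact_mod_cast hk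
  have h1 : Real.log k ≤ k := (Real.log_le_sub_one_of_pos (by positivity)).trans (by linarith)
  calc 1 / (k : ℝ) ≤ 1 / Real.log k := by gcongr
    _ = (Real.log k ^ (1 / 2 + δ / 2))⁻¹ * Real.log k ^ (-(1 / 2 : ℝ) + δ / 2) := by
        rw [← Real.rpow_neg hl.le, ← Real.rpow_add hl, one_div, ← Real.rpow_neg_one]
        congr 1
        ring
    _ ≤ _ := by
        gcongr

/-- The error estimate for the resolvents on the whole space, in a good environment. -/
theorem exists_eLpNorm_sub_le (hd : 2 ≤ d) {C₁ C₂ : ℝ} (hC₁ : 0 < C₁) (hC₂ : 0 < C₂) {lam : ℝ}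
    (hlam : 0 < lam) {δ : ℝ} (hδ : 0 < δ) {g : Space d → ℝ} (hg : IsTest g) :
    ∃ C : ℝ, 0 < C ∧ ∀ k n : ℕ, IsLogScale k n → cut n ≤ 2 ^ n →
      ∀ w : Sym2 (Lattice d) → ℝ,
      (∀ e : Sym2 (Lattice d), ¬ e.IsDiag → C₁ ≤ w e ∧ w e ≤ C₂) → IsGoodScale w n →
      ∀ u, IsScaledResolvent w k lam
        (fun x => lam * g x - limitCoefficient d * Laplacian.laplacian g x) u →
      eLpNorm (fun x => extendCells k u x - g x) 2 volume ≤
        ENNReal.ofReal (C * Real.log k ^ (-(1 / 2 : ℝ) + δ / 2)) := by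
  obtain ⟨A, hA, h1⟩ := exists_resolvent_error_le hd hg hC₁ hC₂ hlam
  obtain ⟨A', hA', h2⟩ := hg.exists_eLpNorm_extendCells_sub_le
  obtain ⟨D, hD, h3⟩ := exists_sqrt_log_le hδ
  obtain ⟨D', hD', h4⟩ := exists_inv_le hδ
  refine ⟨A * D + A' * D', by positivity, fun k n hs hn w hw hgood u hu => ?_⟩
  have hk := hs.two_le
  have hX : 0 < scaleFactor d k := by
    have := hs.cast_pos
    unfold scaleFactor
    positivity
  have hu2 := summable_sq_sub (memℓp_two_iff.1 hu.1) (summable_sq_point hg.compact hs.pos)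
  -- The lattice error and the discretisation error of `g` are separated; the second is `O(1 / k)`,
  -- far below the target rate.
  have e : (fun x => extendCells k u x - g x) =
      (extendCells k fun z => u z - g (point k z)) +
        fun x => extendCells k (fun z => g (point k z)) x - g x := by
    ext x
    simp [extendCells_eq]
  rw [e]
  refine (eLpNorm_add_le (measurable_extendCells k _).aestronglyMeasurable
    ((measurable_extendCells k _).sub hg.continuous.measurable).aestronglyMeasurable
    one_le_two).trans ?_
  rw [add_mul, ENNReal.ofReal_add (by positivity) (by positivity)]
  refine add_le_add ?_ ((h2 k hk).trans (ENNReal.ofReal_le_ofReal ?_))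
  · rw [eLpNorm_two_extendCells hs.pos hu2]
    refine ENNReal.ofReal_le_ofReal ?_
    rw [div_le_iff₀ hX]
    calc _ ≤ A * scaleFactor d k * √((1 + Real.log (n + 1)) / Real.log k) :=
          h1 k n hs hn w hw hgood u hu
      _ ≤ A * scaleFactor d k * (D * Real.log k ^ (-(1 / 2 : ℝ) + δ / 2)) := by
          gcongr
          exact h3 k n hs
      _ = _ := by ring
  · calc A' / k = A' * (1 / k) := by ring
      _ ≤ A' * (D' * Real.log k ^ (-(1 / 2 : ℝ) + δ / 2)) := by
          gcongr
          exact h4 k hk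
      _ = _ := by ring

lemma IsTest.hasCompactSupport_sub_laplacian {g : Space d → ℝ} (hg : IsTest g) (a lam : ℝ) :
    HasCompactSupport fun x => lam * g x - a * Laplacian.laplacian g x := by
  refine HasCompactSupport.intro hg.compact.isCompact fun x hx => ?_
  have h : g =ᶠ[𝓝 x] fun _ => 0 := by
    filter_upwards [(isClosed_tsupport g).isOpen_compl.mem_nhds hx] with y hy
    exact image_eq_zero_of_notMem_tsupport hy
  have h2 : ∀ i, CriticalWalk.pderiv i g =ᶠ[𝓝 x] fun _ => 0 := fun i => by
    filter_upwards [h.eventuallyEq_nhds] with y hy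
    rw [CriticalWalk.pderiv, hy.fderiv_eq]
    simp
  have h3 : ∀ i, CriticalWalk.pderiv i (CriticalWalk.pderiv i g) x = 0 := fun i => by
    rw [CriticalWalk.pderiv, (h2 i).fderiv_eq]
    simp
  rw [h.eq_of_nhds, hg.laplacian_eq]
  simp [h3]

end Extension

end CriticalWalk

end

/-! ### The main theorem. -/

open CriticalWalk in
theorem theorem1p1 (d : ℕ) (hd : 3 < d) (C₁ C₂ : ℝ) (hC₁ : 0 < C₁) (hC₁₂ : C₁ ≤ C₂) :
    ∃ a₀ : ℝ, 0 < a₀ ∧ Tendsto (CriticalWalk.coefficientApprox d) atTop (𝓝 a₀) ∧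
    ∀ lam : ℝ, 0 < lam →
      -- the resolvent of the limit operator is well defined
      (∀ f ∈ CriticalWalk.testData d a₀ lam,
        ∃ v, CriticalWalk.IsLimitResolvent a₀ lam f v ∧
          ∀ v', CriticalWalk.IsLimitResolvent a₀ lam f v' → v' =ᵐ[volume] v) ∧
      ∀ γ : ℝ, 0 < γ →
        ∃ C₀ : (CriticalWalk.Space d → ℝ) → ℝ, (∀ f, 0 < C₀ f) ∧
        ∀ (Ω : Type*) [MeasurableSpace Ω] (P : Measure Ω) [IsProbabilityMeasure P]
          (w : Sym2 (CriticalWalk.Lattice d) → Ω → ℝ),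
          CriticalWalk.IsConductance P C₁ C₂ w →
          -- the scaled resolvents are well defined
          (∀ ω, ∀ f ∈ CriticalWalk.testData d a₀ lam, ∀ k : ℕ, 2 ≤ k →
            ∃! u, CriticalWalk.IsScaledResolvent (fun e => w e ω) k lam f u) ∧
          ∃ k₀ : Ω → ℕ, Measurable k₀ ∧ (∀ ω, 2 ≤ k₀ ω) ∧
            ∀ᵐ ω ∂P, ∀ f ∈ CriticalWalk.testData d a₀ lam, ∀ k : ℕ, k₀ ω ≤ k →
              ∀ u v, CriticalWalk.IsScaledResolvent (fun e => w e ω) k lam f u →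
                CriticalWalk.IsLimitResolvent a₀ lam f v →
                MemLp (fun x => CriticalWalk.extendCells k u x - v x) 2 volume ∧
                eLpNorm (fun x => CriticalWalk.extendCells k u x - v x) 2 volume ≤
                  ENNReal.ofReal (C₀ f *
                    Real.log k ^ (-(1 / 2 : ℝ) + (1 + γ) / (2 * ((d : ℝ) - 2)))) := by
  classical
  have hC₂ : 0 < C₂ := hC₁.trans_le hC₁₂
  have ha := limitCoefficient_pos d
  refine ⟨limitCoefficient d, ha, tendsto_coefficientApprox (by omega), fun lam hlam => ⟨?_, ?_⟩⟩
  · rintro f ⟨g, hg, hg', rfl⟩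
    have h := IsTest.isLimitResolvent ⟨hg, hg'⟩ (limitCoefficient d) lam
    exact ⟨g, h, fun v' hv' => h.ae_eq ha hlam hv'⟩
  intro γ hγ
  have hd2 : (0 : ℝ) < (d : ℝ) - 2 := by
    have : (3 : ℝ) < d := by exact_mod_cast hd
    linarith
  -- The estimate holds for every positive `δ`; the stated exponent is one instance.
  set δ : ℝ := (1 + γ) / ((d : ℝ) - 2)
  have hδ : 0 < δ := by positivity
  have hexp : (1 + γ) / (2 * ((d : ℝ) - 2)) = δ / 2 := by
    rw [mul_comm, ← div_div]
  rw [hexp]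
  have hrate : ∀ f ∈ testData d (limitCoefficient d) lam, ∃ C : ℝ, 0 < C ∧
      ∀ k n : ℕ, IsLogScale k n → cut n ≤ 2 ^ n → ∀ w : Sym2 (Lattice d) → ℝ,
      (∀ e : Sym2 (Lattice d), ¬ e.IsDiag → C₁ ≤ w e ∧ w e ≤ C₂) → IsGoodScale w n →
      ∀ u v, IsScaledResolvent w k lam f u → IsLimitResolvent (limitCoefficient d) lam f v →
      eLpNorm (fun x => extendCells k u x - v x) 2 volume ≤
        ENNReal.ofReal (C * Real.log k ^ (-(1 / 2 : ℝ) + δ / 2)) := by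
    rintro f ⟨g, hg, hg', rfl⟩
    obtain ⟨C, hC, h⟩ := exists_eLpNorm_sub_le (by omega) hC₁ hC₂ hlam hδ ⟨hg, hg'⟩
    refine ⟨C, hC, fun k n hs hn w hw hgood u v hu hv => ?_⟩
    -- Any limit resolvent of `f` agrees almost everywhere with `g`, so the norm may be computed
    -- with `g`.
    have hv' := (IsTest.isLimitResolvent ⟨hg, hg'⟩ (limitCoefficient d) lam).ae_eq ha hlam hv
    rw [eLpNorm_congr_ae (g := fun x => extendCells k u x - g x)
      (by filter_upwards [hv'] with x hx; rw [hx])]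
    exact h k n hs hn w hw hgood u hu
  choose! C₀ hC₀ hC using hrate
  -- Outside the class the value `1` only ensures positivity. The constants are fixed before the
  -- probability space, so they do not depend on the law of the conductances.
  refine ⟨fun f => if f ∈ testData d (limitCoefficient d) lam then C₀ f else 1, fun f => ?_, ?_⟩
  · dsimp only
    split_ifs with hf
    exacts [hC₀ f hf, one_pos]
  intro Ω _ P _ w hw
  have hb : ∀ ω, ∀ e : Sym2 (Lattice d), ¬ e.IsDiag → C₁ ≤ w e ω ∧ w e ω ≤ C₂ :=
    fun ω e he => hw.bounds e he ω
  refine ⟨?_, ?_⟩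
  · rintro ω f ⟨g, hg, hg', rfl⟩ k hk
    exact existsUnique_isScaledResolvent (by omega) hC₁ hC₂ (hb ω) hk hlam (summable_sq_point
      (IsTest.hasCompactSupport_sub_laplacian ⟨hg, hg'⟩ _ _) (by omega))
  obtain ⟨N, hN, hgood⟩ := hw.exists_isGoodScale hC₁ hd
  -- For `k` above this threshold the dyadic scale `Nat.log 2 k` is at least `N ω`, so it is good,
  -- and at least `11`, so `cut n ≤ 2 ^ n`.
  refine ⟨fun ω => 2 ^ max 11 (N ω), ?_, fun ω => ?_, ?_⟩
  · exact (measurable_of_countable fun m : ℕ => 2 ^ max 11 m).comp hN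
  · exact le_self_pow₀ one_le_two (by omega)
  filter_upwards [hgood] with ω hω f hf k hk u v hu hv
  have hk0 : 2 ≤ k := le_trans (le_self_pow₀ one_le_two (by omega)) hk
  have hlog : max 11 (N ω) ≤ Nat.log 2 k := Nat.le_log_of_pow_le one_lt_two hk
  have h := hC f hf k _ (isLogScale_log hk0) (cut_le_two_pow ((le_max_left _ _).trans hlog)) _
    (hb ω) (hω _ ((le_max_right _ _).trans hlog)) u v hu hv
  rw [if_pos hf]
  obtain ⟨G, hG, -⟩ := id hv
  exact ⟨⟨(measurable_extendCells k u).aestronglyMeasurable.sub hG.1.aestronglyMeasurable,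
    h.trans_lt ENNReal.ofReal_lt_top⟩, h⟩
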